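/- Let $\widetilde G=\widetilde{\mathrm{SL}}_2(\mathbb Q_2)$ be the double cover of $\mathrm{SL}_2(\mathbb Q_2)$ with its usual locally compact topology, that is, the set $\mathrm{SL}_2(\mathbb Q_2)\times\{\pm1\}$ with the group law $(g,\epsilon_1)(h,\epsilon_2)=(gh,\epsilon_1\epsilon_2\sigma_2(g,h))$. Here, with $(\cdot,\cdot)$ the Hilbert symbol of $\mathbb Q_2$ and $g=\begin{pmatrix}a&b\\c&d\end{pmatrix}$, one puts $\tau(g)=c$ if $c\neq0$ and $\tau(g)=d$ if $c=0$; $s_2(g)=(c,d)$ if $cd\ne0$ and $\mathrm{ord}_2(c)$ is odd, and $s_2(g)=1$ otherwise; and $$\sigma_2(g,h)=(\tau(gh)\tau(g),\tau(gh)\tau(h))\,s_2(g)s_2(h)s_2(gh).$$ Write $\bar g=(g,1)$ and $$x(s)=\begin{pmatrix}1&s\\0&1\end{pmatrix},\quad y(s)=\begin{pmatrix}1&0\\s&1\end{pmatrix},\quad w(t)=\begin{pmatrix}0&t\\-t^{-1}&0\end{pmatrix},\quad h(t)=\begin{pmatrix}t&0\\0&t^{-1}\end{pmatrix}.$$ Let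 $S=\overline{K_0^2(8)}$ be the full inverse image in $\widetilde G$ of the group of matrices in $\mathrm{SL}_2(\mathbb Z_2)$ with lower left entry in $8\mathbb Z_2$. Let $\xi=\pm i$ be a primitive fourth root of unity in $\mathbb C$, and let $\chi_1$ be the character of $S$ given by $$\chi_1\big(\bar x(s)\,\bar h(u)\,\bar y(t)\,(I,\epsilon)\big)=\epsilon\cdot\begin{cases}1&u\equiv1,5\pmod 8,\\ \xi&u\equiv3,7\pmod 8,\end{cases}\qquad s\in\mathbb Z_2,\ u\in\mathbb Z_2^\times,\ t\in8\mathbb Z_2,\ \epsilon=\pm1,$$ so that $\chi_1((-I,1))=\xi$. Let $H(S,\chi_1)$ be the algebra of locally constant, compactly supported functions $f:\widetilde G\to\mathbb C$ with $f(kgk')=\overline{\chi_1(k)}\,\overline{\chi_1(k')}f(g)$ for all $k,k'\in S$, $g\in\widetilde G$, under the convolution $(f_1*f_2)(h)=\int_{\widetilde G}f_1(g)f_2(g^{-1}h)\,dg$, where the Haar measure is normalized so that $S$ has measure $1$. Put $\zeta_8=(1+\xi)/\sqrt2$. For $n\in\mathbb Z$ let $\mathcal U_n\in H(S,\chi_1)$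 be the function supported on $S\,\bar w(2^{-n})\,S$ with $\mathcal U_n(k\,\bar w(2^{-n})\,k')=\overline{\chi_1(k)}\,\overline{\zeta_8}\,\overline{\chi_1(k')}$ for $k,k'\in S$; let $\mathcal V\in H(S,\chi_1)$ be the function supported on $S\,\bar y(4)\,S$ with $\mathcal V(\bar y(4))=1$. Put $\widehat{\mathcal U}_1=\tfrac1{\sqrt2}\mathcal U_1$ and $\widehat{\mathcal U}_2=\tfrac1{\sqrt2}\mathcal U_2$. Then $H(S,\chi_1)$ is the unital associative $\mathbb C$-algebra generated by $\widehat{\mathcal U}_1,\widehat{\mathcal U}_2,\mathcal V$ with the defining relations 1. $\widehat{\mathcal U}_1^2=1+\mathcal V$, 2. $\widehat{\mathcal U}_2^2=1$, 3. $\widehat{\mathcal U}_1\mathcal V=\mathcal V\widehat{\mathcal U}_1=\widehat{\mathcal U}_1$, 4. $\widehat{\mathcal U}_2\mathcal V\widehat{\mathcal U}_2=\mathcal V\widehat{\mathcal U}_2\mathcal V$, where the identity element $1$ is the function supported on $S$ with value $\overline{\chi_1(k)}$ at $k\in S$. That is, these three elements generate $H(S,\chi_1)$ as an algebra, they satisfy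 the relations, and every relation among them is a consequence of these. -/

import Mathlib

namespace Metaplectic

open Classical in
/-- The Hilbert symbol `(a, b)` of a field: `1` if `z² = a x² + b y²` has a nontrivial solution,
`-1` otherwise. -/
noncomputable def hilbertSym {F : Type*} [Field F] (a b : F) : ℤˣ :=
  if ∃ x y z : F, (x, y, z) ≠ (0, 0, 0) ∧ z ^ 2 = a * x ^ 2 + b * y ^ 2 then 1 else -1

section Hilbert

variable {F : Type*} [Field F]

theorem hilbertSym_comm (a b : F) : hilbertSym a b = hilbertSym b a := by
  have h : ∀ a b : F, (∃ x y z : F, (x, y, z) ≠ (0, 0, 0) ∧ z ^ 2 = a * x ^ 2 + b * y ^ 2) →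
      ∃ x y z : F, (x, y, z) ≠ (0, 0, 0) ∧ z ^ 2 = b * x ^ 2 + a * y ^ 2 := by
    rintro a b ⟨x, y, z, hne, h⟩
    refine ⟨y, x, z, ?_, by rw [h]; ring⟩
    simp only [ne_eq, Prod.mk.injEq, not_and] at hne ⊢
    tauto
  unfold hilbertSym
  congr 1
  exact propext ⟨h a b, h b a⟩

theorem hilbertSym_eq_one_of {a b : F} (x y z : F) (hx : x ≠ 0)
    (h : z ^ 2 = a * x ^ 2 + b * y ^ 2) : hilbertSym a b = 1 := by
  unfold hilbertSym
  rw [if_pos]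
  exact ⟨x, y, z, by simp [hx], h⟩

/- The values of the norm form of `F(√c)` -/
def IsNormOf (c a : F) : Prop := ∃ u v : F, a = u ^ 2 - c * v ^ 2

theorem hilbertSym_eq_one_iff [CharZero F] {a c : F} (hc : c ≠ 0) :
    hilbertSym a c = 1 ↔ IsNormOf c a := by
  constructor
  · intro h
    unfold hilbertSym at h
    split_ifs at h with hs
    · obtain ⟨x, y, z, hne, hz⟩ := hs
      by_cases hx : x = 0
      · subst hx
        have hy : y ≠ 0 := by
          rintro rfl
          have : z = 0 := by simpa using hz
          exact hne (by simp [this])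
        have hzz : z ≠ 0 := by
          rintro rfl
          have : c * y ^ 2 = 0 := by rw [← sub_eq_zero] at hz; linear_combination -hz
          simp [hc, hy] at this
        refine ⟨(a + 1) / 2, (a - 1) / 2 * (y / z), ?_⟩
        have h2 : c * (y / z) ^ 2 = 1 := by
          rw [div_pow, ← mul_div_assoc, div_eq_one_iff_eq (pow_ne_zero 2 hzz)]
          linear_combination -hz
        linear_combination ((a - 1) / 2) ^ 2 * h2
      · refine ⟨z / x, y / x, ?_⟩
        field_simp
        linear_combination -hz
    · exact absurd h (by decide)
  · rintro ⟨u, v, h⟩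
    exact hilbertSym_eq_one_of 1 v u one_ne_zero (by rw [h]; ring)

theorem IsNormOf.mul {c a b : F} (ha : IsNormOf c a) (hb : IsNormOf c b) :
    IsNormOf c (a * b) := by
  obtain ⟨u, v, rfl⟩ := ha
  obtain ⟨s, t, rfl⟩ := hb
  exact ⟨u * s + c * v * t, u * t + v * s, by ring⟩

theorem IsNormOf.sq (c t : F) : IsNormOf c (t ^ 2) := ⟨t, 0, by ring⟩

theorem IsNormOf.of_mul_sq {c a t : F} (ht : t ≠ 0) (h : IsNormOf c (a * t ^ 2)) :
    IsNormOf c a := by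
  have := h.mul (IsNormOf.sq c t⁻¹)
  rwa [mul_assoc, ← mul_pow, mul_inv_cancel₀ ht, one_pow, mul_one] at this

theorem IsNormOf.of_mul_right {c a b : F} (ha0 : a ≠ 0) (ha : IsNormOf c a)
    (h : IsNormOf c (a * b)) : IsNormOf c b := by
  refine IsNormOf.of_mul_sq ha0 ?_
  have := ha.mul h
  rwa [show a * (a * b) = b * a ^ 2 by ring] at this

theorem IsNormOf.of_base_sq {c a t : F} (h : IsNormOf (c * t ^ 2) a) : IsNormOf c a := by
  obtain ⟨u, v, rfl⟩ := h
  exact ⟨u, v * t, by ring⟩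

theorem IsNormOf.base_sq {c a t : F} (ht : t ≠ 0) (h : IsNormOf c a) :
    IsNormOf (c * t ^ 2) a := by
  obtain ⟨u, v, rfl⟩ := h
  exact ⟨u, v / t, by field_simp⟩

/- `1 + 8ℤ₂` consists of squares of units. -/
theorem exists_sq_of_sub_one (w : ℤ_[2]) : ∃ t : ℤ_[2], t ^ 2 = 1 + 8 * w := by
  have key := hensels_lemma (p := 2) (R := ℤ_[2])
    (F := Polynomial.X ^ 2 - Polynomial.C (1 + 8 * w)) (a := 1) (by
      have h8 : ‖(8 : ℤ_[2])‖ = 1 / 8 := by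
        have := PadicInt.norm_p_pow (p := 2) 3
        norm_num at this
        rw [this]
      have h2 : ‖(2 : ℤ_[2])‖ = 1 / 2 := by
        have := PadicInt.norm_p (p := 2)
        norm_num at this
        rw [this]
      have hw := PadicInt.norm_le_one w
      simp only [map_sub, map_pow, Polynomial.aeval_X, Polynomial.aeval_C,
        Polynomial.derivative_X_pow, Polynomial.derivative_C]
      simp only [map_mul, map_pow, Polynomial.aeval_X, Polynomial.aeval_C, map_zero]
      simp
      rw [h8, h2]
      nlinarith [norm_nonneg w])
  obtain ⟨z, hz, -⟩ := key
  refine ⟨z, ?_⟩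
  simpa [sub_eq_zero] using hz

theorem one_add_eight_ne_zero (w : ℤ_[2]) : (1 + 8 * w : ℤ_[2]) ≠ 0 := by
  intro h
  have := congrArg (PadicInt.toZModPow 1) h
  have h8 : ((8 : ℕ) : ZMod (2 ^ 1)) = 0 := by decide
  simp only [map_add, map_one, map_mul, map_zero] at this
  rw [show (8 : ℤ_[2]) = ((8 : ℕ) : ℤ_[2]) by norm_num, map_natCast, h8] at this
  simp at this

def sqReps : List ℕ := [1, 3, 5, 7, 2, 6, 10, 14]

theorem eight_dvd_of_toZModPow {x y : ℤ_[2]}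
    (h : PadicInt.toZModPow 3 x = PadicInt.toZModPow 3 y) : ∃ w, x = y + 8 * w := by
  have : x - y ∈ RingHom.ker (PadicInt.toZModPow (p := 2) 3) := by
    rw [RingHom.mem_ker, map_sub, h, sub_self]
  rw [PadicInt.ker_toZModPow, Ideal.mem_span_singleton] at this
  obtain ⟨w, hw⟩ := this
  refine ⟨w, ?_⟩
  rw [← sub_eq_iff_eq_add', hw]
  norm_num

/- an odd 2-adic integer is `r (1 + 8w)` with `r` in `1, 3, 5, 7` -/
theorem exists_odd_rep (u : ℤ_[2]ˣ) :
    ∃ r ∈ ([1, 3, 5, 7] : List ℕ), ∃ w : ℤ_[2], (u : ℤ_[2]) = r * (1 + 8 * w) := by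
  have h : ∀ z : ZMod (2 ^ 3), IsUnit z → ∃ r ∈ ([1, 3, 5, 7] : List ℕ), z = (r : ZMod (2 ^ 3)) ∧
      (r : ZMod (2 ^ 3)) * r = 1 := by decide
  obtain ⟨r, hr, hz, hrr⟩ := h _ (u.isUnit.map (PadicInt.toZModPow (p := 2) 3))
  refine ⟨r, hr, ?_⟩
  -- `r * r = 1 + 8 m`, so `u = r (1 + 8 w)` with `1 + 8 w = u / r`
  obtain ⟨w, hw⟩ := eight_dvd_of_toZModPow (x := (u : ℤ_[2])) (y := (r : ℤ_[2]))
    (by rw [hz, map_natCast])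
  have hunit : IsUnit (r : ℤ_[2]) := by
    rw [PadicInt.isUnit_iff]
    by_contra hne
    have hlt := lt_of_le_of_ne (PadicInt.norm_le_one _) hne
    have := (PadicInt.norm_int_lt_one_iff_dvd (p := 2) (r : ℤ)).1 (by exact_mod_cast hlt)
    simp only [List.mem_cons, List.not_mem_nil, or_false] at hr
    omega
  obtain ⟨r', hr'⟩ := hunit.exists_right_inv
  exact ⟨r' * w, by rw [hw]; linear_combination -8 * w * hr'⟩

theorem exists_sqRep {a : ℚ_[2]} (ha : a ≠ 0) :
    ∃ r ∈ sqReps, ∃ t : ℚ_[2], t ≠ 0 ∧ a = r * t ^ 2 := by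
  obtain ⟨n, u, hu⟩ : ∃ (n : ℤ) (u : ℤ_[2]ˣ), a = (u : ℤ_[2]) * (2 : ℚ_[2]) ^ n := by
    have hn : ‖a * (2 : ℚ_[2]) ^ (-a.valuation)‖ = 1 := by
      rw [norm_mul, norm_zpow, Padic.norm_eq_zpow_neg_valuation ha]
      have h2 := Padic.norm_p (p := 2)
      norm_num at h2
      rw [h2, one_div, inv_zpow, Nat.cast_ofNat]
      exact mul_inv_cancel₀ (zpow_ne_zero _ two_ne_zero)
    refine ⟨a.valuation, PadicInt.mkUnits hn, ?_⟩
    rw [PadicInt.mkUnits_eq, mul_assoc, ← zpow_add₀ (by norm_num)]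
    simp
  obtain ⟨r, hr, w, hw⟩ := exists_odd_rep u
  obtain ⟨t, ht⟩ := exists_sq_of_sub_one w
  have ht0 : (t : ℚ_[2]) ≠ 0 := by
    intro h0
    have : t = 0 := Subtype.ext h0
    exact one_add_eight_ne_zero w (by rw [← ht, this]; simp)
  have hw' : ((u : ℤ_[2]) : ℚ_[2]) = r * (t : ℚ_[2]) ^ 2 := by
    rw [hw, ← ht]; push_cast; rfl
  rcases Int.even_or_odd' n with ⟨m, rfl | rfl⟩
  · refine ⟨r, ?_, t * 2 ^ m, mul_ne_zero ht0 (zpow_ne_zero _ two_ne_zero), ?_⟩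
    · simp only [sqReps, List.mem_cons, List.not_mem_nil, or_false] at hr ⊢; omega
    · rw [hu, hw', mul_pow, ← zpow_natCast ((2 : ℚ_[2]) ^ m), ← zpow_mul]
      push_cast; rw [mul_comm m 2]; ring
  · refine ⟨2 * r, ?_, t * 2 ^ m, mul_ne_zero ht0 (zpow_ne_zero _ two_ne_zero), ?_⟩
    · simp only [sqReps, List.mem_cons, List.not_mem_nil, or_false] at hr ⊢; omega
    · rw [hu, hw', mul_pow, ← zpow_natCast ((2 : ℚ_[2]) ^ m), ← zpow_mul,
        zpow_add₀ (by norm_num)]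
      push_cast; rw [mul_comm m 2]; ring

set_option maxRecDepth 100000 in
theorem normTable : ∀ c ∈ sqReps, ∃ n ∈ sqReps, ∀ a ∈ sqReps, ∃ A ∈ [a, n * a],
    ∃ k ∈ List.range 2, ∃ u ∈ List.range 16, ∃ v ∈ List.range 16,
      ((u : ℤ) ^ 2 - c * (v : ℤ) ^ 2) % (8 * A * 4 ^ k) = A * 4 ^ k := by
  decide +kernel

theorem isNormOf_of_table {c A u v : ℤ} {n : ℕ} (hA : A ≠ 0)
    (h : (u ^ 2 - c * v ^ 2) % (8 * A * 4 ^ n) = A * 4 ^ n) : IsNormOf (c : ℚ_[2]) A := by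
  have h1 := Int.emod_add_mul_ediv (u ^ 2 - c * v ^ 2) (8 * A * 4 ^ n)
  rw [h] at h1
  set j := (u ^ 2 - c * v ^ 2) / (8 * A * 4 ^ n)
  obtain ⟨t, ht⟩ := exists_sq_of_sub_one (j : ℤ_[2])
  have ht0 : (t : ℚ_[2]) ≠ 0 := by
    intro h0
    have : t = 0 := Subtype.ext h0
    exact one_add_eight_ne_zero _ (by rw [← ht, this]; simp)
  have ht' : (t : ℚ_[2]) ^ 2 = 1 + 8 * (j : ℚ_[2]) := by
    calc (t : ℚ_[2]) ^ 2 = ((t ^ 2 : ℤ_[2]) : ℚ_[2]) := by push_cast; rfl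
      _ = _ := by rw [ht]; push_cast; rfl
  refine IsNormOf.of_mul_sq (t := t * 2 ^ n) (mul_ne_zero ht0 (pow_ne_zero _ two_ne_zero))
    ⟨u, v, ?_⟩
  have h2 : ((A * 4 ^ n + 8 * A * 4 ^ n * j : ℤ) : ℚ_[2]) = ((u ^ 2 - c * v ^ 2 : ℤ) : ℚ_[2]) := by
    rw [h1]
  push_cast at h2
  rw [mul_pow, ht', ← pow_mul, mul_comm n 2, pow_mul]
  norm_num
  linear_combination h2

theorem exists_index_two {c : ℚ_[2]} (hc : c ≠ 0) : ∃ n : ℚ_[2], n ≠ 0 ∧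
    ∀ a : ℚ_[2], a ≠ 0 → IsNormOf c a ∨ IsNormOf c (n * a) := by
  have hpos : ∀ r ∈ sqReps, r ≠ 0 := by decide
  obtain ⟨r, hr, s, hs, rfl⟩ := exists_sqRep hc
  obtain ⟨n, hn, H⟩ := normTable r hr
  refine ⟨n, by exact_mod_cast hpos n hn, fun a ha => ?_⟩
  obtain ⟨q, hq, t, ht, rfl⟩ := exists_sqRep ha
  obtain ⟨A, hA, _, -, u, -, v, -, h⟩ := H q hq
  have hA0 : A ≠ 0 := by
    simp only [List.mem_cons, List.not_mem_nil, or_false] at hA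
    rcases hA with rfl | rfl
    · exact hpos _ hq
    · exact mul_ne_zero (hpos _ hn) (hpos _ hq)
  have key := isNormOf_of_table (c := r) (A := A) (by exact_mod_cast hA0) h
  simp only [Int.cast_natCast] at key
  have key2 := (key.base_sq hs).mul (IsNormOf.sq _ t)
  simp only [List.mem_cons, List.not_mem_nil, or_false] at hA
  rcases hA with rfl | rfl
  · exact Or.inl key2
  · right; push_cast at key2; rwa [← mul_assoc]

theorem hilbertSym_mul_left {a b c : ℚ_[2]} (ha : a ≠ 0) (hb : b ≠ 0) (hc : c ≠ 0) :
    hilbertSym (a * b) c = hilbertSym a c * hilbertSym b c := by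
  have h1 := hilbertSym_eq_one_iff (a := a) hc
  have h2 := hilbertSym_eq_one_iff (a := b) hc
  have h3 := hilbertSym_eq_one_iff (a := a * b) hc
  by_cases hA : IsNormOf c a
  · by_cases hB : IsNormOf c b
    · rw [h1.2 hA, h2.2 hB, h3.2 (hA.mul hB), one_mul]
    · have hAB : ¬ IsNormOf c (a * b) := fun h => hB (IsNormOf.of_mul_right ha hA h)
      have e2 := (Int.units_eq_one_or (hilbertSym b c)).resolve_left (mt h2.1 hB)
      have e3 := (Int.units_eq_one_or (hilbertSym (a * b) c)).resolve_left (mt h3.1 hAB)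
      rw [h1.2 hA, e2, e3, one_mul]
  · have e1 := (Int.units_eq_one_or (hilbertSym a c)).resolve_left (mt h1.1 hA)
    by_cases hB : IsNormOf c b
    · have hAB : ¬ IsNormOf c (a * b) := fun h =>
        hA (IsNormOf.of_mul_right hb hB (by rwa [mul_comm]))
      have e3 := (Int.units_eq_one_or (hilbertSym (a * b) c)).resolve_left (mt h3.1 hAB)
      rw [e1, h2.2 hB, e3, mul_one]
    · have e2 := (Int.units_eq_one_or (hilbertSym b c)).resolve_left (mt h2.1 hB)
      obtain ⟨n, hn, H⟩ := exists_index_two hc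
      have hna := (H a ha).resolve_left hA
      have hnb := (H b hb).resolve_left hB
      have hAB : IsNormOf c (a * b) := by
        refine IsNormOf.of_mul_sq hn ?_
        have := hna.mul hnb
        rwa [show n * a * (n * b) = a * b * n ^ 2 by ring] at this
      rw [e1, e2, h3.2 hAB]; rfl

/- The symbol on `ℚ₂ˣ`, written additively, for bookkeeping. -/
noncomputable def hilb (a b : ℚ_[2]ˣ) : ZMod 2 :=
  if hilbertSym (a : ℚ_[2]) (b : ℚ_[2]) = 1 then 0 else 1

theorem hilb_comm (a b : ℚ_[2]ˣ) : hilb a b = hilb b a := by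
  unfold hilb; rw [hilbertSym_comm]

theorem hilb_mul_left (a b c : ℚ_[2]ˣ) : hilb (a * b) c = hilb a c + hilb b c := by
  unfold hilb
  rw [Units.val_mul, hilbertSym_mul_left a.ne_zero b.ne_zero c.ne_zero]
  rcases Int.units_eq_one_or (hilbertSym (a : ℚ_[2]) c) with h | h <;>
  rcases Int.units_eq_one_or (hilbertSym (b : ℚ_[2]) c) with h' | h' <;>
  rw [h, h'] <;> decide

theorem hilb_mul_right (a b c : ℚ_[2]ˣ) : hilb a (b * c) = hilb a b + hilb a c := by
  rw [hilb_comm, hilb_mul_left, hilb_comm b, hilb_comm c]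

theorem hilb_inv_left (a c : ℚ_[2]ˣ) : hilb a⁻¹ c = hilb a c := by
  have h1 : hilb 1 c = 0 := by simpa using hilb_mul_left 1 1 c
  have h := hilb_mul_left a⁻¹ a c
  rw [inv_mul_cancel, h1] at h
  have : ∀ x y : ZMod 2, 0 = x + y → x = y := by decide
  exact this _ _ h

theorem hilb_inv_right (a c : ℚ_[2]ˣ) : hilb a c⁻¹ = hilb a c := by
  rw [hilb_comm, hilb_inv_left, hilb_comm]

theorem hilb_eq_zero {a b : ℚ_[2]ˣ} (h : hilbertSym (a : ℚ_[2]) (b : ℚ_[2]) = 1) :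
    hilb a b = 0 := by unfold hilb; rw [if_pos h]

theorem hilb_neg_self (a : ℚ_[2]ˣ) : hilb a (-a) = 0 :=
  hilb_eq_zero (hilbertSym_eq_one_of 1 1 0 one_ne_zero (by push_cast; ring))

theorem hilb_self (a : ℚ_[2]ˣ) : hilb a a = hilb a (-1) := by
  have h := hilb_neg_self a
  rw [show -a = (-1) * a by simp, hilb_mul_right] at h
  have : ∀ x y : ZMod 2, x + y = 0 → y = x := by decide
  exact this _ _ h

theorem hilb_neg_right (a b : ℚ_[2]ˣ) : hilb a (-b) = hilb a (-1) + hilb a b := by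
  rw [← hilb_mul_right]; simp

theorem hilb_neg_left (a b : ℚ_[2]ˣ) : hilb (-a) b = hilb (-1) b + hilb a b := by
  rw [← hilb_mul_left]; simp

theorem hilbertSym_eq_iff (a b c d : ℚ_[2]ˣ) :
    hilbertSym (a : ℚ_[2]) (b : ℚ_[2]) = hilbertSym (c : ℚ_[2]) (d : ℚ_[2]) ↔
      hilb a b = hilb c d := by
  unfold hilb
  rcases Int.units_eq_one_or (hilbertSym (a : ℚ_[2]) b) with h | h <;>
  rcases Int.units_eq_one_or (hilbertSym (c : ℚ_[2]) d) with h' | h' <;>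
  rw [h, h'] <;> decide

/- The three-term relation. -/
theorem hilb_add {P Q R : ℚ_[2]ˣ} (h : (R : ℚ_[2]) = Q + P) : hilb (P * R) (Q * R) = 0 :=
  hilb_eq_zero (hilbertSym_eq_one_of 1 1 R one_ne_zero (by push_cast; rw [h]; ring))

end Hilbert

open Matrix

/-- `SL₂(ℚ₂)` -/
abbrev SL2 := SpecialLinearGroup (Fin 2) ℚ_[2]

open Classical in
/-- `τ(g) = c` if `c ≠ 0`, and `τ(g) = d` if `c = 0`, where `(c, d)` is the lower row of `g`. -/
noncomputable def tau (g : SL2) : ℚ_[2] := if g 1 0 ≠ 0 then g 1 0 else g 1 1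

open Classical in
/-- `s₂(g) = (c, d)` if `cd ≠ 0` and `ord₂(c)` is odd, and `s₂(g) = 1` otherwise. -/
noncomputable def sfun (g : SL2) : ℤˣ :=
  if g 1 0 * g 1 1 ≠ 0 ∧ Odd (g 1 0).valuation then hilbertSym (g 1 0) (g 1 1) else 1

/-- The Kubota-Gelbart 2-cocycle `σ₂` on `SL₂(ℚ₂)`. -/
noncomputable def sigma (g h : SL2) : ℤˣ :=
  hilbertSym (tau (g * h) * tau g) (tau (g * h) * tau h) * (sfun g * sfun h * sfun (g * h))

theorem det_eq (g : SL2) : g 0 0 * g 1 1 - g 0 1 * g 1 0 = 1 := by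
  have := g.det_coe; rwa [Matrix.det_fin_two] at this

theorem mul_00 (g h : SL2) : (g * h) 0 0 = g 0 0 * h 0 0 + g 0 1 * h 1 0 := by
  simp [Matrix.mul_apply, Fin.sum_univ_two]
theorem mul_01 (g h : SL2) : (g * h) 0 1 = g 0 0 * h 0 1 + g 0 1 * h 1 1 := by
  simp [Matrix.mul_apply, Fin.sum_univ_two]
theorem mul_10 (g h : SL2) : (g * h) 1 0 = g 1 0 * h 0 0 + g 1 1 * h 1 0 := by
  simp [Matrix.mul_apply, Fin.sum_univ_two]
theorem mul_11 (g h : SL2) : (g * h) 1 1 = g 1 0 * h 0 1 + g 1 1 * h 1 1 := by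
  simp [Matrix.mul_apply, Fin.sum_univ_two]

theorem ne_zero_of_c_eq_zero {g : SL2} (h : g 1 0 = 0) : g 1 1 ≠ 0 := by
  intro h'; have := det_eq g; simp [h, h'] at this

theorem tau_ne_zero (g : SL2) : tau g ≠ 0 := by
  unfold tau; split_ifs with h
  · exact h
  · exact ne_zero_of_c_eq_zero (not_not.1 h)

noncomputable def tauU (g : SL2) : ℚ_[2]ˣ := Units.mk0 (tau g) (tau_ne_zero g)

theorem tau_mul_of_left {g h : SL2} (hg : g 1 0 = 0) : tau (g * h) = g 1 1 * tau h := by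
  have h1 := ne_zero_of_c_eq_zero hg
  unfold tau
  rw [mul_10, mul_11, hg]
  by_cases hh : h 1 0 = 0 <;> simp [hh, h1]

theorem tau_mul_of_right {g h : SL2} (hh : h 1 0 = 0) :
    tau (g * h) = tau g * h 1 1 ∨ tau (g * h) = tau g * (h 1 1)⁻¹ := by
  have h1 := ne_zero_of_c_eq_zero hh
  have hd := det_eq h
  have h0 : h 0 0 = (h 1 1)⁻¹ := by
    rw [hh] at hd; field_simp; linear_combination hd
  unfold tau
  rw [mul_10, mul_11, hh]
  by_cases hg : g 1 0 = 0 <;> simp [hg, h1, h0]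

theorem tau_of_ne {g : SL2} (hg : g 1 0 ≠ 0) : tau g = g 1 0 := by simp [tau, hg]
theorem tau_of_eq {g : SL2} (hg : g 1 0 = 0) : tau g = g 1 1 := by simp [tau, hg]

theorem tau_mul_of_mul {g h : SL2} (hh : h 1 0 ≠ 0)
    (h0 : (g * h) 1 0 = 0) : tau (g * h) = -(g 1 0 / h 1 0) := by
  rw [tau_of_eq h0, mul_11]
  rw [mul_10] at h0
  have hd := det_eq h
  field_simp
  linear_combination h 1 1 * h0 - g 1 0 * hd

theorem plucker (g h k : SL2) :
    (g * h) 1 0 * (h * k) 1 0 = h 1 0 * (g * h * k) 1 0 + g 1 0 * k 1 0 := by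
  have hd := det_eq h
  simp only [mul_10, mul_11]
  linear_combination g 1 0 * k 1 0 * hd

/-- The cocycle without its coboundary part, written additively. -/
noncomputable def alpha (g h : SL2) : ZMod 2 := hilb (tauU (g * h) * tauU g) (tauU (g * h) * tauU h)

theorem alpha_cocycle (g h k : SL2) :
    alpha g h + alpha (g * h) k = alpha g (h * k) + alpha h k := by
  unfold alpha
  rw [← mul_assoc g h k]
  by_cases c1 : g 1 0 = 0
  · obtain ⟨d, hd⟩ : ∃ d : ℚ_[2]ˣ, (d : ℚ_[2]) = g 1 1 :=
      ⟨Units.mk0 _ (ne_zero_of_c_eq_zero c1), rfl⟩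
    have e1 : tauU g = d := Units.ext (by simp [tauU, tau_of_eq c1, hd])
    have e2 : tauU (g * h) = d * tauU h := Units.ext (by simp [tauU, tau_mul_of_left c1, hd])
    have e3 : tauU (g * h * k) = d * tauU (h * k) :=
      Units.ext (by rw [mul_assoc]; simp [tauU, tau_mul_of_left c1, hd])
    rw [e1, e2, e3]
    simp only [hilb_mul_left, hilb_mul_right]
    grind [hilb_comm, hilb_self]
  by_cases c2 : h 1 0 = 0
  · obtain ⟨d, hd⟩ : ∃ d : ℚ_[2]ˣ, (d : ℚ_[2]) = h 1 1 :=
      ⟨Units.mk0 _ (ne_zero_of_c_eq_zero c2), rfl⟩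
    have e1 : tauU h = d := Units.ext (by simp [tauU, tau_of_eq c2, hd])
    have e2 : tauU (g * h) = tauU g * d ∨ tauU (g * h) = tauU g * d⁻¹ :=
      (tau_mul_of_right (g := g) c2).imp (fun H => Units.ext (by simp [tauU, H, hd]))
        (fun H => Units.ext (by simp [tauU, H, hd]))
    have e3 : tauU (h * k) = d * tauU k := Units.ext (by simp [tauU, tau_mul_of_left c2, hd])
    rcases e2 with e2 | e2 <;> rw [e1, e2, e3] <;>
    simp only [hilb_mul_left, hilb_mul_right, hilb_inv_left, hilb_inv_right] <;>
    grind [hilb_comm, hilb_self]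
  by_cases c3 : k 1 0 = 0
  · obtain ⟨d, hd⟩ : ∃ d : ℚ_[2]ˣ, (d : ℚ_[2]) = k 1 1 :=
      ⟨Units.mk0 _ (ne_zero_of_c_eq_zero c3), rfl⟩
    have e1 : tauU k = d := Units.ext (by simp [tauU, tau_of_eq c3, hd])
    have e2 : ∀ g : SL2, tauU (g * k) = tauU g * d ∨ tauU (g * k) = tauU g * d⁻¹ := fun g =>
      (tau_mul_of_right (g := g) c3).imp (fun H => Units.ext (by simp [tauU, H, hd]))
        (fun H => Units.ext (by simp [tauU, H, hd]))
    rcases e2 h with e3 | e3 <;> rcases e2 (g * h) with e4 | e4 <;> rw [e1, e3, e4] <;>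
    simp only [hilb_mul_left, hilb_mul_right, hilb_inv_left, hilb_inv_right] <;>
    grind [hilb_comm, hilb_self]
  have P := plucker g h k
  obtain ⟨m, hm, hself⟩ : ∃ m : ℚ_[2]ˣ, (m : ℚ_[2]) = -1 ∧ ∀ a, hilb a a = hilb a m :=
    ⟨-1, by simp, hilb_self⟩
  obtain ⟨x1, hx1⟩ : ∃ x : ℚ_[2]ˣ, (x : ℚ_[2]) = g 1 0 := ⟨Units.mk0 _ c1, rfl⟩
  obtain ⟨x2, hx2⟩ : ∃ x : ℚ_[2]ˣ, (x : ℚ_[2]) = h 1 0 := ⟨Units.mk0 _ c2, rfl⟩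
  obtain ⟨x3, hx3⟩ : ∃ x : ℚ_[2]ˣ, (x : ℚ_[2]) = k 1 0 := ⟨Units.mk0 _ c3, rfl⟩
  have t1 : tauU g = x1 := Units.ext (by simp [tauU, tau_of_ne c1, hx1])
  have t2 : tauU h = x2 := Units.ext (by simp [tauU, tau_of_ne c2, hx2])
  have t3 : tauU k = x3 := Units.ext (by simp [tauU, tau_of_ne c3, hx3])
  -- the value of `τ(ghk)` when `c(gh) c(hk) = 0`
  have t123 : (g * h) 1 0 * (h * k) 1 0 = 0 → tauU (g * h * k) = m * (x1 * x3 * x2⁻¹) := by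
    intro H
    rw [H] at P
    have hc : (g * h * k) 1 0 = -(g 1 0 * k 1 0 * (h 1 0)⁻¹) := by
      field_simp; linear_combination -P
    have hne : (g * h * k) 1 0 ≠ 0 := by
      rw [hc]; simp [c1, c2, c3]
    exact Units.ext (by simp [tauU, hm, tau_of_ne hne, hc, hx1, hx2, hx3])
  by_cases c12 : (g * h) 1 0 = 0
  · have t12 : tauU (g * h) = m * (x1 * x2⁻¹) :=
      Units.ext (by simp [tauU, hm, tau_mul_of_mul c2 c12, hx1, hx2, div_eq_mul_inv])
    have t := t123 (by rw [c12, zero_mul])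
    by_cases c23 : (h * k) 1 0 = 0
    · have t23 : tauU (h * k) = m * (x2 * x3⁻¹) :=
        Units.ext (by simp [tauU, hm, tau_mul_of_mul c3 c23, hx2, hx3, div_eq_mul_inv])
      rw [t1, t2, t3, t12, t23, t]
      simp only [hilb_mul_left, hilb_mul_right, hilb_inv_left, hilb_inv_right]
      grind [hilb_comm]
    · rw [t1, t2, t3, t12, t]
      simp only [hilb_mul_left, hilb_mul_right, hilb_inv_left, hilb_inv_right]
      grind [hilb_comm]
  by_cases c23 : (h * k) 1 0 = 0
  · have t23 : tauU (h * k) = m * (x2 * x3⁻¹) :=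
      Units.ext (by simp [tauU, hm, tau_mul_of_mul c3 c23, hx2, hx3, div_eq_mul_inv])
    have t := t123 (by rw [c23, mul_zero])
    rw [t1, t2, t3, t23, t]
    simp only [hilb_mul_left, hilb_mul_right, hilb_inv_left, hilb_inv_right]
    grind [hilb_comm]
  obtain ⟨x12, hx12⟩ : ∃ x : ℚ_[2]ˣ, (x : ℚ_[2]) = (g * h) 1 0 := ⟨Units.mk0 _ c12, rfl⟩
  obtain ⟨x23, hx23⟩ : ∃ x : ℚ_[2]ˣ, (x : ℚ_[2]) = (h * k) 1 0 := ⟨Units.mk0 _ c23, rfl⟩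
  have t12 : tauU (g * h) = x12 := Units.ext (by simp [tauU, tau_of_ne c12, hx12])
  have t23 : tauU (h * k) = x23 := Units.ext (by simp [tauU, tau_of_ne c23, hx23])
  by_cases c123 : (g * h * k) 1 0 = 0
  · have t : tauU (g * h * k) = m * (x12 * x3⁻¹) :=
      Units.ext (by simp [tauU, hm, tau_mul_of_mul c3 c123, hx12, hx3, div_eq_mul_inv])
    have e : x23 = x1 * x3 * x12⁻¹ := by
      rw [eq_mul_inv_iff_mul_eq]
      refine Units.ext ?_
      push_cast
      rw [hx1, hx3, hx12, hx23]
      linear_combination P + h 1 0 * c123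
    rw [t1, t2, t3, t12, t23, t, e]
    simp only [hilb_mul_left, hilb_mul_right, hilb_inv_left, hilb_inv_right]
    grind [hilb_comm]
  · obtain ⟨x, hx⟩ : ∃ x : ℚ_[2]ˣ, (x : ℚ_[2]) = (g * h * k) 1 0 := ⟨Units.mk0 _ c123, rfl⟩
    have t : tauU (g * h * k) = x := Units.ext (by simp [tauU, tau_of_ne c123, hx])
    have := hilb_add (P := x1 * x3) (Q := x2 * x) (R := x12 * x23)
      (by push_cast; rw [hx1, hx2, hx3, hx12, hx23, hx]; exact P)
    rw [t1, t2, t3, t12, t23, t]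
    simp only [hilb_mul_left, hilb_mul_right] at this ⊢
    grind [hilb_comm, hilb_self]


/-- sign attached to an element of `ZMod 2` -/
def sgnZ (x : ZMod 2) : ℤˣ := if x = 0 then 1 else -1

theorem sgnZ_add (x y : ZMod 2) : sgnZ (x + y) = sgnZ x * sgnZ y := by
  revert x y; decide

theorem hilbertSym_eq_sgnZ (a b : ℚ_[2]ˣ) :
    hilbertSym (a : ℚ_[2]) (b : ℚ_[2]) = sgnZ (hilb a b) := by
  unfold hilb
  rcases Int.units_eq_one_or (hilbertSym (a : ℚ_[2]) b) with h | h <;> rw [h] <;> decide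

theorem sigma_eq (g h : SL2) :
    sigma g h = sgnZ (alpha g h) * (sfun g * sfun h * sfun (g * h)) := by
  unfold sigma alpha
  rw [← hilbertSym_eq_sgnZ]
  simp [tauU]

/-- `σ₂` is a 2-cocycle. -/
theorem sigma_cocycle (g h k : SL2) :
    sigma g h * sigma (g * h) k = sigma g (h * k) * sigma h k := by
  have H := congrArg sgnZ (alpha_cocycle g h k)
  rw [sgnZ_add, sgnZ_add] at H
  simp only [sigma_eq, ← mul_assoc g h k]
  have e1 := Int.units_mul_self (sfun (g * h))
  have e2 := Int.units_mul_self (sfun (h * k))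
  calc _ = (sgnZ (alpha g h) * sgnZ (alpha (g * h) k)) *
        (sfun g * sfun h * sfun k * sfun (g * h * k)) * (sfun (g * h) * sfun (g * h)) := by
        ac_rfl
    _ = (sgnZ (alpha g (h * k)) * sgnZ (alpha h k)) *
        (sfun g * sfun h * sfun k * sfun (g * h * k)) * (sfun (h * k) * sfun (h * k)) := by
        rw [e1, e2, H]
    _ = _ := by ac_rfl

theorem sfun_of_c {g : SL2} (h : g 1 0 = 0) : sfun g = 1 := by simp [sfun, h]

theorem hilb_one_left (a : ℚ_[2]ˣ) : hilb 1 a = 0 := by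
  simpa using hilb_mul_left 1 1 a

theorem hilb_one_right (a : ℚ_[2]ˣ) : hilb a 1 = 0 := by rw [hilb_comm, hilb_one_left]

theorem tauU_of_eq {g : SL2} {d : ℚ_[2]ˣ} (hg : g 1 0 = 0) (hd : g 1 1 = d) : tauU g = d :=
  Units.ext (by simp [tauU, tau_of_eq hg, hd])

theorem tauU_of_ne {g : SL2} {c : ℚ_[2]ˣ} (hc : g 1 0 = c) : tauU g = c :=
  Units.ext (by simp [tauU, tau_of_ne (g := g) (by rw [hc]; exact c.ne_zero), hc])

theorem sgnZ_zero : sgnZ 0 = 1 := rfl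

theorem sigma_one_left (g : SL2) : sigma 1 g = 1 := by
  have h1 : tauU 1 = 1 := tauU_of_eq (by simp) (by simp)
  rw [sigma_eq, sfun_of_c (g := 1) (by simp), one_mul, one_mul, Int.units_mul_self, mul_one]
  unfold alpha
  rw [one_mul, h1, mul_one, hilb_mul_right]
  have : ∀ x : ZMod 2, sgnZ (x + x) = 1 := by decide
  exact this _

theorem sigma_one_right (g : SL2) : sigma g 1 = 1 := by
  have h1 : tauU 1 = 1 := tauU_of_eq (by simp) (by simp)
  rw [sigma_eq, sfun_of_c (g := 1) (by simp), mul_one, mul_one, Int.units_mul_self, mul_one]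
  unfold alpha
  rw [mul_one, h1, mul_one, hilb_mul_left]
  have : ∀ x : ZMod 2, sgnZ (x + x) = 1 := by decide
  exact this _

/-- The double cover of `SL₂(ℚ₂)`: pairs `(g, ε)` with `ε = ±1`, with the group law
`(g, ε₁)(h, ε₂) = (gh, ε₁ ε₂ σ₂(g, h))`. -/
@[ext]
structure Mp2 where
  mat : SL2
  sgn : ℤˣ

namespace Mp2

noncomputable instance : Mul Mp2 :=
  ⟨fun x y => ⟨x.mat * y.mat, x.sgn * y.sgn * sigma x.mat y.mat⟩⟩
noncomputable instance : One Mp2 := ⟨⟨1, 1⟩⟩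
noncomputable instance : Inv Mp2 := ⟨fun x => ⟨x.mat⁻¹, x.sgn * sigma x.mat⁻¹ x.mat⟩⟩

theorem mul_def (x y : Mp2) : x * y = ⟨x.mat * y.mat, x.sgn * y.sgn * sigma x.mat y.mat⟩ := rfl
theorem one_def : (1 : Mp2) = ⟨1, 1⟩ := rfl
theorem inv_def (x : Mp2) : x⁻¹ = ⟨x.mat⁻¹, x.sgn * sigma x.mat⁻¹ x.mat⟩ := rfl

noncomputable instance : Group Mp2 :=
  Group.ofLeftAxioms
    (by
      intro x y z
      simp only [mul_def, Mp2.mk.injEq]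
      refine ⟨mul_assoc _ _ _, ?_⟩
      have H := sigma_cocycle x.mat y.mat z.mat
      calc _ = x.sgn * y.sgn * z.sgn * (sigma x.mat y.mat * sigma (x.mat * y.mat) z.mat) := by
            ac_rfl
        _ = _ := by rw [H]; ac_rfl)
    (by
      intro x
      simp only [mul_def, one_def, one_mul, sigma_one_left, mul_one])
    (by
      intro x
      simp only [mul_def, one_def, inv_def, inv_mul_cancel, Mp2.mk.injEq, true_and]
      calc _ = (x.sgn * x.sgn) * (sigma x.mat⁻¹ x.mat * sigma x.mat⁻¹ x.mat) := by ac_rfl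
        _ = 1 := by rw [Int.units_mul_self, Int.units_mul_self, mul_one])

/-- The covering map. -/
noncomputable def proj : Mp2 →* SL2 where
  toFun := Mp2.mat
  map_one' := rfl
  map_mul' _ _ := rfl

/-- The element `(g, 1)`. -/
def bar (g : SL2) : Mp2 := ⟨g, 1⟩

/-- The topology of the double cover as a locally compact group. The section `k ↦ (k, 1)` is a
homomorphism on a neighbourhood of `1` in `SL₂(ℚ₂)` (the cover splits there), and the left
translates of this section near `1` are the local homeomorphisms that define the topology. (It is
not the product topology, because `σ₂` is not continuous.) -/
instance : TopologicalSpace Mp2 where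
  IsOpen U := ∀ g ∈ U, ∀ᶠ k in nhds (1 : SL2), g * bar k ∈ U
  isOpen_univ := fun _ _ => Filter.Eventually.of_forall fun _ => Set.mem_univ _
  isOpen_inter := fun _ _ hs ht g hg => (hs g hg.1).and (ht g hg.2)
  isOpen_sUnion := fun _ hS g ⟨U, hU, hg⟩ => (hS U hU g hg).mono fun _ hk => ⟨U, hU, hk⟩

instance : MeasurableSpace Mp2 := borel Mp2
instance : BorelSpace Mp2 := ⟨rfl⟩

end Mp2

open Mp2

/-- `K₀(2ⁿ)`: the matrices in `SL₂(ℤ₂)` whose lower left entry lies in `2ⁿ ℤ₂`. -/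
def K0 (n : ℕ) : Subgroup SL2 where
  carrier := {A | ∃ a b c d : ℤ_[2], A 0 0 = a ∧ A 0 1 = b ∧ A 1 0 = 2 ^ n * c ∧ A 1 1 = d}
  one_mem' := ⟨1, 0, 0, 1, by simp, by simp, by simp, by simp⟩
  mul_mem' := by
    rintro A B ⟨a, b, c, d, h1, h2, h3, h4⟩ ⟨a', b', c', d', h1', h2', h3', h4'⟩
    refine ⟨a * a' + b * (2 ^ n * c'), a * b' + b * d', c * a' + d * c',
      2 ^ n * c * b' + d * d', ?_, ?_, ?_, ?_⟩
    · rw [mul_00, h1, h2, h1', h3']; push_cast; rfl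
    · rw [mul_01, h1, h2, h2', h4']; push_cast; rfl
    · rw [mul_10, h3, h4, h1', h3']; push_cast; ring
    · rw [mul_11, h3, h4, h2', h4']; push_cast; rfl
  inv_mem' := by
    rintro A ⟨a, b, c, d, h1, h2, h3, h4⟩
    refine ⟨d, -b, -c, a, ?_, ?_, ?_, ?_⟩ <;>
    simp [Matrix.adjugate_fin_two, h1, h2, h3, h4]

/-- The full inverse image of `K₀(2ⁿ)` in the double cover. -/
noncomputable def K0bar (n : ℕ) : Subgroup Mp2 := (K0 n).comap proj

/-- `x(s)` -/
noncomputable def xMat (s : ℚ_[2]) : SL2 := ⟨!![1, s; 0, 1], by simp [Matrix.det_fin_two]⟩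
/-- `y(s)` -/
noncomputable def yMat (s : ℚ_[2]) : SL2 := ⟨!![1, 0; s, 1], by simp [Matrix.det_fin_two]⟩
/-- `w(t)` -/
noncomputable def wMat (t : ℚ_[2]ˣ) : SL2 :=
  ⟨!![0, (t : ℚ_[2]); -(t⁻¹ : ℚ_[2]ˣ), 0], by simp [Matrix.det_fin_two]⟩
/-- `h(t)` -/
noncomputable def hMat (t : ℚ_[2]ˣ) : SL2 :=
  ⟨!![(t : ℚ_[2]), 0; 0, (t⁻¹ : ℚ_[2]ˣ)], by simp [Matrix.det_fin_two]⟩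

/- If `A ∈ K₀(8)` then its lower right entry is a unit with square in `1 + 8ℤ₂`. -/
theorem sq_eq_of_mem {A : SL2} {a b c d : ℤ_[2]} (h1 : A 0 0 = a) (h2 : A 0 1 = b)
    (h3 : A 1 0 = 2 ^ 3 * c) (h4 : A 1 1 = d) :
    a * d = 1 + 8 * (b * c) ∧ ∃ w : ℤ_[2], d * d = 1 + 8 * w := by
  have hdet := det_eq A
  rw [h1, h2, h3, h4] at hdet
  have h : a * d = 1 + 8 * (b * c) := by
    refine Subtype.ext ?_
    push_cast
    change (a : ℚ_[2]) * d = 1 + 8 * (b * c)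
    linear_combination hdet
  refine ⟨h, eight_dvd_of_toZModPow ?_⟩
  have h' := congrArg (PadicInt.toZModPow 3) h
  have h8 : ((8 : ℕ) : ZMod (2 ^ 3)) = 0 := by decide
  simp only [map_add, map_one, map_mul] at h'
  rw [show (8 : ℤ_[2]) = ((8 : ℕ) : ℤ_[2]) by norm_num, map_natCast, h8, zero_mul, add_zero] at h'
  rw [map_mul, map_one]
  have : ∀ a d : ZMod (2 ^ 3), a * d = 1 → d * d = 1 := by decide
  exact this _ _ h'

theorem lowerRight_ne_zero (g : K0bar 3) : (g : Mp2).mat 1 1 ≠ 0 := by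
  obtain ⟨a, b, c, d, h1, h2, h3, h4⟩ := g.2
  obtain ⟨-, w, hw⟩ := sq_eq_of_mem h1 h2 h3 h4
  intro h0
  have h0' : (d : ℚ_[2]) = 0 := by rw [← h4]; exact h0
  have : d = 0 := Subtype.ext h0'
  exact one_add_eight_ne_zero w (by rw [← hw, this]; simp)

/-- The lower right entry `d` of an element of the inverse image of `K₀(8)`. -/
noncomputable def lowerRight (g : K0bar 3) : ℚ_[2]ˣ :=
  Units.mk0 ((g : Mp2).mat 1 1) (lowerRight_ne_zero g)

/-- The product `(x(s), 1)(h(u), 1)(y(t), 1)` over the triangular decomposition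
`A = x(s) h(u) y(t)` of `A ∈ K₀(8)`: here `u = d⁻¹`, `s = b / d`, `t = c / d`. -/
noncomputable def triPart (g : K0bar 3) : Mp2 :=
  bar (xMat ((g : Mp2).mat 0 1 / (g : Mp2).mat 1 1)) * bar (hMat (lowerRight g)⁻¹) *
    bar (yMat ((g : Mp2).mat 1 0 / (g : Mp2).mat 1 1))

/-- The sign `e` in `(A, ε) = (x(s), 1)(h(u), 1)(y(t), 1)(I, e)`. -/
noncomputable def triSgn (g : K0bar 3) : ℤˣ := ((triPart g)⁻¹ * (g : Mp2)).sgn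

open Classical in
/-- The value of `χ₁` at `(h(u), 1)`, for a unit `u`: `1` if `u ≡ 1, 5 mod 8`, and `ξ` if
`u ≡ 3, 7 mod 8`. -/
noncomputable def torusChar (ξ : ℂ) (u : ℚ_[2]ˣ) : ℂ :=
  if ∃ z : ℤ_[2], (u : ℚ_[2]) = 1 + 8 * z ∨ (u : ℚ_[2]) = 5 + 8 * z then 1 else ξ

open Classical in
/- The symbol `(-c, d)`, written additively (`0` if `c = 0`). -/
noncomputable def rho (A : SL2) : ZMod 2 :=
  if h : A 1 0 ≠ 0 ∧ A 1 1 ≠ 0 then hilb (-(Units.mk0 _ h.1)) (Units.mk0 _ h.2) else 0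

theorem SL2_ext {A B : SL2} (h1 : A 0 0 = B 0 0) (h2 : A 0 1 = B 0 1) (h3 : A 1 0 = B 1 0)
    (h4 : A 1 1 = B 1 1) : A = B := by
  ext i j
  fin_cases i <;> fin_cases j <;> assumption

theorem xMat_apply (s : ℚ_[2]) :
    xMat s 0 0 = 1 ∧ xMat s 0 1 = s ∧ xMat s 1 0 = 0 ∧ xMat s 1 1 = 1 := by simp [xMat]
theorem yMat_apply (s : ℚ_[2]) :
    yMat s 0 0 = 1 ∧ yMat s 0 1 = 0 ∧ yMat s 1 0 = s ∧ yMat s 1 1 = 1 := by simp [yMat]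
theorem hMat_apply (s : ℚ_[2]ˣ) : hMat s 0 0 = s ∧ hMat s 0 1 = 0 ∧ hMat s 1 0 = 0 ∧
    hMat s 1 1 = (s⁻¹ : ℚ_[2]ˣ) := by simp [hMat]

theorem triangular (A : SL2) (d : ℚ_[2]ˣ) (hd : A 1 1 = d) :
    xMat (A 0 1 / A 1 1) * hMat d⁻¹ * yMat (A 1 0 / A 1 1) = A := by
  have hdet := det_eq A
  obtain ⟨x1, x2, x3, x4⟩ := xMat_apply (A 0 1 / A 1 1)
  obtain ⟨y1, y2, y3, y4⟩ := yMat_apply (A 1 0 / A 1 1)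
  obtain ⟨h1, h2, h3, h4⟩ := hMat_apply d⁻¹
  have hd0 : A 1 1 ≠ 0 := by rw [hd]; exact d.ne_zero
  simp only [Units.val_inv_eq_inv_val, inv_inv, ← hd] at h1 h2 h3 h4
  apply SL2_ext <;>
  simp only [mul_00, mul_01, mul_10, mul_11, x1, x2, x3, x4, y1, y2, y3, y4, h1, h2, h3, h4] <;>
  field_simp <;> first | ring1 | linear_combination (-1 : ℚ_[2]) * hdet

theorem triPart_mat (g : K0bar 3) : (triPart g).mat = (g : Mp2).mat :=
  triangular _ (lowerRight g) rfl

theorem triSgn_eq (g : K0bar 3) :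
    triSgn g = (g : Mp2).sgn * sfun (g : Mp2).mat * sgnZ (rho (g : Mp2).mat) := by
  have hP := triPart_mat g
  have e : (g : Mp2) = triPart g * ⟨1, (triPart g).sgn * (g : Mp2).sgn⟩ := by
    rw [mul_def, mul_one, sigma_one_right, mul_one, hP, ← mul_assoc, Int.units_mul_self, one_mul]
  have e2 : triSgn g = (triPart g).sgn * (g : Mp2).sgn := by
    unfold triSgn; rw [e, inv_mul_cancel_left, ← e]
  rw [e2, mul_comm, mul_assoc]
  congr 1
  set A := (g : Mp2).mat with hA
  set d := lowerRight g with hd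
  have hAd : A 1 1 = d := rfl
  have hx : ∀ s, xMat s 1 0 = 0 ∧ xMat s 1 1 = 1 := fun s => by simp [xMat]
  have hh : ∀ s, hMat s 1 0 = 0 ∧ hMat s 1 1 = (s⁻¹ : ℚ_[2]ˣ) := fun s => by simp [hMat]
  have hy : ∀ s, yMat s 1 0 = s ∧ yMat s 1 1 = 1 := fun s => by simp [yMat]
  set X := xMat (A 0 1 / A 1 1)
  set Hh := hMat d⁻¹ with hHh
  set Y := yMat (A 1 0 / A 1 1) with hY
  have hm : X * Hh * Y = A := hP
  have tX : tauU X = 1 := tauU_of_eq (hx _).1 (by rw [(hx _).2]; simp)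
  have tH : tauU Hh = d := tauU_of_eq (hh _).1 (by rw [(hh _).2]; simp)
  have cXH : (X * Hh) 1 0 = 0 := by rw [mul_10, (hx _).1, (hh _).1]; simp
  have dXH : (X * Hh) 1 1 = d := by rw [mul_11, (hx _).1, (hx _).2, (hh _).2]; simp
  have tXH : tauU (X * Hh) = d := tauU_of_eq cXH dXH
  have tA : tauU A = d * tauU Y := by
    rw [← hm]; exact Units.ext (by simp [tauU, tau_mul_of_left cXH, dXH])
  have sY : sfun Y = 1 := by
    unfold sfun
    split_ifs
    · rw [hY, (hy _).2, hilbertSym_comm]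
      exact hilbertSym_eq_one_of 1 0 1 one_ne_zero (by ring)
    · rfl
  have s1 : (triPart g).sgn = sigma X Hh * sigma (X * Hh) Y := by
    have : (triPart g).sgn = 1 * 1 * sigma X Hh * 1 * sigma (X * Hh) Y := rfl
    rw [this]; simp
  rw [s1, sigma_eq, sigma_eq, sfun_of_c (hx _).1, sfun_of_c (hh _).1, sfun_of_c cXH, sY, hm]
  have a1 : alpha X Hh = 0 := by
    unfold alpha; rw [tX, tH, tXH]
    simp only [hilb_mul_right, mul_one]
    have : ∀ x : ZMod 2, x + x = 0 := by decide
    exact this _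
  have a2 : alpha (X * Hh) Y = rho A := by
    unfold alpha; rw [hm, tXH, tA]
    unfold rho
    have hd0 : A 1 1 ≠ 0 := lowerRight_ne_zero g
    by_cases hc : A 1 0 = 0
    · rw [dif_neg (by simp [hc])]
      have tY : tauU Y = 1 := tauU_of_eq (by rw [hY, (hy _).1, hc]; simp) (by rw [hY, (hy _).2]; simp)
      rw [tY]
      simp only [hilb_mul_left, mul_one]
      have : ∀ x : ZMod 2, x + x = 0 := by decide
      exact this _
    · rw [dif_pos ⟨hc, hd0⟩]
      have tY : tauU Y = Units.mk0 _ hc * d⁻¹ :=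
        tauU_of_ne (by rw [hY, (hy _).1, hAd, div_eq_mul_inv]; simp)
      rw [tY, hilb_neg_left, show Units.mk0 _ hd0 = d from rfl]
      simp only [hilb_mul_left, hilb_mul_right, hilb_inv_left, hilb_inv_right]
      grind [hilb_comm, hilb_self]
  rw [a1, a2, sgnZ_zero]
  simp [mul_comm]


/-! the character -/

theorem even_of_sq_add {x y : ℤ_[2]}
    (h : PadicInt.toZModPow 2 x * PadicInt.toZModPow 2 x +
      PadicInt.toZModPow 2 y * PadicInt.toZModPow 2 y = 0) :
    (∃ x', x = 2 * x') ∧ ∃ y', y = 2 * y' := by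
  have key : ∀ a b : ZMod (2 ^ 2), a * a + b * b = 0 →
      (a = (0 : ℕ) ∨ a = (2 : ℕ)) ∧ (b = (0 : ℕ) ∨ b = (2 : ℕ)) := by decide
  have ev : ∀ z : ℤ_[2], (PadicInt.toZModPow 2 z = (0 : ℕ) ∨ PadicInt.toZModPow 2 z = (2 : ℕ)) →
      ∃ z', z = 2 * z' := by
    intro z hz
    have : ∃ m : ℕ, PadicInt.toZModPow 2 z = PadicInt.toZModPow 2 (2 * (m : ℤ_[2])) := by
      rcases hz with hz | hz
      · exact ⟨0, by rw [hz]; simp⟩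
      · refine ⟨1, ?_⟩
        rw [hz, ← map_natCast (PadicInt.toZModPow (p := 2) 2)]; congr 1; norm_num
    obtain ⟨m, hm⟩ := this
    have hk : z - 2 * (m : ℤ_[2]) ∈ RingHom.ker (PadicInt.toZModPow (p := 2) 2) := by
      rw [RingHom.mem_ker, map_sub, hm, sub_self]
    rw [PadicInt.ker_toZModPow, Ideal.mem_span_singleton] at hk
    obtain ⟨w, hw⟩ := hk
    refine ⟨m + 2 * w, ?_⟩
    push_cast at hw
    linear_combination hw
  obtain ⟨h1, h2⟩ := key _ _ h
  exact ⟨ev x h1, ev y h2⟩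

theorem no_norm {d e : ℤ_[2]} (hd : PadicInt.toZModPow 2 d = 3) (he : PadicInt.toZModPow 2 e = 3)
    (n : ℕ) : ∀ x y : ℤ_[2], 4 ^ n * d ≠ x ^ 2 - e * y ^ 2 := by
  have h4 : PadicInt.toZModPow (p := 2) 2 4 = 0 := by
    rw [show (4 : ℤ_[2]) = ((4 : ℕ) : ℤ_[2]) by norm_num, map_natCast]; decide
  induction n with
  | zero =>
    intro x y h
    have h' := congrArg (PadicInt.toZModPow 2) h
    simp only [pow_zero, one_mul, map_sub, map_mul, map_pow, hd, he] at h'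
    have : ∀ a b : ZMod (2 ^ 2), 3 ≠ a ^ 2 - 3 * b ^ 2 := by decide
    exact this _ _ h'
  | succ n ih =>
    intro x y h
    have h' := congrArg (PadicInt.toZModPow 2) h
    simp only [pow_succ, mul_assoc, map_sub, map_mul, map_pow, he, h4, zero_mul, mul_zero] at h'
    simp only [pow_zero, one_mul] at h'
    have : ∀ a b : ZMod (2 ^ 2), 0 = a * a - 3 * (b * b) → a * a + b * b = 0 := by decide
    obtain ⟨⟨x', rfl⟩, y', rfl⟩ := even_of_sq_add (this _ _ h')
    refine ih x' y' ?_
    have h40 : (4 : ℤ_[2]) ≠ 0 := by norm_num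
    refine mul_left_cancel₀ h40 ?_
    linear_combination h

theorem exists_pow_mul (u : ℚ_[2]) : ∃ n : ℕ, ∀ m, n ≤ m →
    ∃ x : ℤ_[2], 2 ^ m * u = x := by
  obtain ⟨n, hn⟩ := pow_unbounded_of_one_lt ‖u‖ (by norm_num : (1 : ℝ) < 2)
  refine ⟨n, fun m hm => ?_⟩
  have h2 : ‖(2 : ℚ_[2])‖ = 2⁻¹ := by simpa using Padic.norm_p (p := 2)
  have : ‖2 ^ m * u‖ ≤ 1 := by
    rw [norm_mul, norm_pow, h2, inv_pow, inv_mul_le_iff₀ (by positivity), mul_one]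
    exact hn.le.trans (pow_le_pow_right₀ (by norm_num) hm)
  exact ⟨⟨_, this⟩, rfl⟩

theorem hilbertSym_three {d e : ℤ_[2]} (hd : PadicInt.toZModPow 2 d = 3)
    (he : PadicInt.toZModPow 2 e = 3) : hilbertSym (d : ℚ_[2]) (e : ℚ_[2]) = -1 := by
  have he0 : (e : ℚ_[2]) ≠ 0 := by
    intro h0
    have : e = 0 := Subtype.ext h0
    rw [this, map_zero] at he
    exact absurd he (by decide)
  refine (Int.units_eq_one_or _).resolve_left fun h => ?_
  obtain ⟨u, v, huv⟩ := (hilbertSym_eq_one_iff he0).1 h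
  obtain ⟨n1, hn1⟩ := exists_pow_mul u
  obtain ⟨n2, hn2⟩ := exists_pow_mul v
  obtain ⟨x, hx⟩ := hn1 (max n1 n2) (le_max_left _ _)
  obtain ⟨y, hy⟩ := hn2 (max n1 n2) (le_max_right _ _)
  refine no_norm hd he (max n1 n2) x y (Subtype.ext ?_)
  push_cast
  rw [← hx, ← hy, show ((4 : ℤ_[2]) : ℚ_[2]) = 2 ^ 2 by norm_num; rfl]
  rw [← pow_mul, mul_comm 2, pow_mul]
  linear_combination ((2 : ℚ_[2]) ^ max n1 n2) ^ 2 * huv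

theorem normTable_units : ∀ r ∈ ([1, 5] : List ℕ), ∀ s ∈ ([1, 3, 5, 7] : List ℕ),
    ∃ u ∈ List.range 16, ∃ v ∈ List.range 16,
      ((u : ℤ) ^ 2 - s * (v : ℤ) ^ 2) % (8 * r * 4 ^ 0) = r * 4 ^ 0 := by
  decide +kernel

theorem exists_odd_rep_sq (u : ℤ_[2]ˣ) : ∃ r ∈ ([1, 3, 5, 7] : List ℕ), ∃ t : ℚ_[2], t ≠ 0 ∧
    ((u : ℤ_[2]) : ℚ_[2]) = r * t ^ 2 ∧
      PadicInt.toZModPow 2 (u : ℤ_[2]) = (r : ZMod (2 ^ 2)) := by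
  obtain ⟨r, hr, w, hw⟩ := exists_odd_rep u
  obtain ⟨t, ht⟩ := exists_sq_of_sub_one w
  refine ⟨r, hr, t, ?_, ?_, ?_⟩
  · intro h0
    have : t = 0 := Subtype.ext h0
    exact one_add_eight_ne_zero w (by rw [← ht, this]; simp)
  · rw [hw, ← ht]; push_cast; rfl
  · have h8 : PadicInt.toZModPow (p := 2) 2 8 = 0 := by
      rw [show (8 : ℤ_[2]) = ((8 : ℕ) : ℤ_[2]) by norm_num, map_natCast]; decide
    rw [hw, map_mul, map_add, map_mul, h8, map_natCast, map_one, zero_mul, add_zero, mul_one]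

theorem hilbertSym_of_one {u v : ℤ_[2]ˣ} (hu : PadicInt.toZModPow 2 (u : ℤ_[2]) = 1) :
    hilbertSym ((u : ℤ_[2]) : ℚ_[2]) ((v : ℤ_[2]) : ℚ_[2]) = 1 := by
  obtain ⟨r, hr, t, ht, hut, hur⟩ := exists_odd_rep_sq u
  obtain ⟨s, hs, q, hq, hvq, -⟩ := exists_odd_rep_sq v
  have hr' : r ∈ ([1, 5] : List ℕ) := by
    rw [hu] at hur
    simp only [List.mem_cons, List.not_mem_nil, or_false] at hr ⊢
    rcases hr with rfl | rfl | rfl | rfl <;> first | omega | exact absurd hur (by decide)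
  obtain ⟨x, -, y, -, h⟩ := normTable_units r hr' s hs
  have hr0 : r ≠ 0 := by
    simp only [List.mem_cons, List.not_mem_nil, or_false] at hr; omega
  have hs0 : s ≠ 0 := by
    simp only [List.mem_cons, List.not_mem_nil, or_false] at hs; omega
  have key := isNormOf_of_table (c := s) (A := r) (by exact_mod_cast hr0) h
  simp only [Int.cast_natCast] at key
  rw [hut, hvq]
  refine (hilbertSym_eq_one_iff ?_).2 ((key.base_sq hq).mul (IsNormOf.sq _ t))
  exact mul_ne_zero (by exact_mod_cast hs0) (pow_ne_zero _ hq)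


theorem toZModPow_two_eight : PadicInt.toZModPow (p := 2) 2 8 = 0 := by
  rw [show (8 : ℤ_[2]) = ((8 : ℕ) : ℤ_[2]) by norm_num, map_natCast]; decide

theorem toZModPow_unit (v : ℤ_[2]ˣ) :
    PadicInt.toZModPow 2 (v : ℤ_[2]) = 1 ∨ PadicInt.toZModPow 2 (v : ℤ_[2]) = 3 := by
  have h : ∀ z : ZMod (2 ^ 2), IsUnit z → z = 1 ∨ z = 3 := by decide
  exact h _ (v.isUnit.map _)

theorem torusChar_eq (ξ : ℂ) (u : ℚ_[2]ˣ) (v : ℤ_[2]ˣ)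
    (h : (u : ℚ_[2]) * ((v : ℤ_[2]) : ℚ_[2]) = 1) :
    torusChar ξ u = if PadicInt.toZModPow 2 (v : ℤ_[2]) = 1 then 1 else ξ := by
  have h5 : PadicInt.toZModPow (p := 2) 2 5 = 1 := by
    rw [show (5 : ℤ_[2]) = ((5 : ℕ) : ℤ_[2]) by norm_num, map_natCast]; decide
  have hu : (u : ℚ_[2]) = ((v⁻¹ : ℤ_[2]ˣ) : ℤ_[2]) := by
    have h1 : (((v⁻¹ : ℤ_[2]ˣ) : ℤ_[2]) : ℚ_[2]) * ((v : ℤ_[2]) : ℚ_[2]) = 1 := by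
      rw [← PadicInt.coe_mul, Units.inv_mul, PadicInt.coe_one]
    have hv : ((v : ℤ_[2]) : ℚ_[2]) ≠ 0 := right_ne_zero_of_mul (h ▸ one_ne_zero)
    exact mul_right_cancel₀ hv (h.trans h1.symm)
  unfold torusChar
  congr 1
  refine propext ⟨?_, fun hv => ?_⟩
  · rintro ⟨z, hz⟩
    have hz' : ((v⁻¹ : ℤ_[2]ˣ) : ℤ_[2]) = 1 + 8 * z ∨ ((v⁻¹ : ℤ_[2]ˣ) : ℤ_[2]) = 5 + 8 * z :=
      hz.imp (fun e => Subtype.ext (by rw [← hu, e]; push_cast; rfl))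
        (fun e => Subtype.ext (by rw [← hu, e]; push_cast; rfl))
    have h1 : PadicInt.toZModPow 2 (((v⁻¹ : ℤ_[2]ˣ) : ℤ_[2]) * (v : ℤ_[2])) = 1 := by
      rw [Units.inv_mul, map_one]
    rcases hz' with e | e
    · rw [e, map_mul, map_add, map_mul, toZModPow_two_eight, map_one, zero_mul, add_zero,
        one_mul] at h1
      exact h1
    · rw [e, map_mul, map_add, map_mul, toZModPow_two_eight, h5, zero_mul, add_zero,
        one_mul] at h1
      exact h1
  · obtain ⟨r, hr, w, hw⟩ := exists_odd_rep v⁻¹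
    have h1 : PadicInt.toZModPow 2 (((v⁻¹ : ℤ_[2]ˣ) : ℤ_[2]) * (v : ℤ_[2])) = 1 := by
      rw [Units.inv_mul, map_one]
    rw [hw] at h1
    simp only [map_mul, map_add, map_one, toZModPow_two_eight, hv, zero_mul, add_zero,
      mul_one, map_natCast] at h1
    simp only [List.mem_cons, List.not_mem_nil, or_false] at hr
    rw [hu, hw]
    rcases hr with rfl | rfl | rfl | rfl
    · exact ⟨w, Or.inl (by push_cast; rw [one_mul]; rfl)⟩
    · exact absurd h1 (by decide)
    · refine ⟨5 * w, Or.inr ?_⟩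
      push_cast
      change (5 : ℚ_[2]) * (1 + 8 * w) = 5 + 8 * (5 * w)
      ring
    · exact absurd h1 (by decide)

theorem rho_of_eq {A : SL2} (h : A 1 0 = 0) : rho A = 0 := by
  unfold rho; rw [dif_neg (by simp [h])]

theorem rho_of_ne {A : SL2} {c d m : ℚ_[2]ˣ} (hc : A 1 0 = c) (hd : A 1 1 = d)
    (hm : (m : ℚ_[2]) = -1) : rho A = hilb m d + hilb c d := by
  unfold rho
  have hc0 : A 1 0 ≠ 0 := by rw [hc]; exact c.ne_zero
  have hd0 : A 1 1 ≠ 0 := by rw [hd]; exact d.ne_zero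
  rw [dif_pos ⟨hc0, hd0⟩, ← hilb_mul_left]
  congr 1
  · exact Units.ext (by simp [hm, hc])
  · exact Units.ext (by simp [hd])

theorem alpha_add_rho {A B : SL2} {d1 d2 d3 q : ℚ_[2]ˣ} (h1 : A 1 1 = d1) (h2 : B 1 1 = d2)
    (h3 : (A * B) 1 1 = d3) (hB : B 0 0 = d2 * q ^ 2)
    (H : ∀ x, hilb x d3 = hilb x d1 + hilb x d2) :
    alpha A B + rho (A * B) = rho A + rho B + hilb d1 d2 := by
  obtain ⟨m, hm, hself⟩ : ∃ m : ℚ_[2]ˣ, (m : ℚ_[2]) = -1 ∧ ∀ a, hilb a a = hilb a m :=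
    ⟨-1, by simp, hilb_self⟩
  have c3 := mul_10 A B
  unfold alpha
  by_cases hA0 : A 1 0 = 0
  · have t1 : tauU A = d1 := tauU_of_eq hA0 h1
    have t3 : tauU (A * B) = d1 * tauU B :=
      Units.ext (by simp [tauU, tau_mul_of_left hA0, h1])
    rw [hA0, zero_mul, zero_add, h1] at c3
    by_cases hB0 : B 1 0 = 0
    · rw [hB0, mul_zero] at c3
      have t2 : tauU B = d2 := tauU_of_eq hB0 h2
      rw [rho_of_eq hA0, rho_of_eq hB0, rho_of_eq c3, t3, t1, t2]
      simp only [hilb_mul_left, hilb_mul_right]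
      grind [hilb_comm]
    · obtain ⟨y, hy⟩ : ∃ y : ℚ_[2]ˣ, B 1 0 = y := ⟨Units.mk0 _ hB0, rfl⟩
      have t2 : tauU B = y := tauU_of_ne hy
      rw [hy, ← Units.val_mul] at c3
      rw [rho_of_eq hA0, rho_of_ne hy h2 hm, rho_of_ne c3 h3 hm, t3, t1, t2]
      simp only [hilb_mul_left, hilb_mul_right, H]
      grind [hilb_comm]
  obtain ⟨x, hx⟩ : ∃ x : ℚ_[2]ˣ, A 1 0 = x := ⟨Units.mk0 _ hA0, rfl⟩
  have t1 : tauU A = x := tauU_of_ne hx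
  by_cases hB0 : B 1 0 = 0
  · rw [hB0, hx, hB, mul_zero, add_zero] at c3
    have c3' : (A * B) 1 0 = ((x * (d2 * q ^ 2) : ℚ_[2]ˣ) : ℚ_[2]) := by rw [c3]; push_cast; rfl
    have t2 : tauU B = d2 := tauU_of_eq hB0 h2
    have t3 : tauU (A * B) = x * (d2 * q ^ 2) := tauU_of_ne c3'
    rw [rho_of_eq hB0, rho_of_ne hx h1 hm, rho_of_ne c3' h3 hm, t3, t1, t2]
    simp only [pow_two, hilb_mul_left, hilb_mul_right, H]
    grind [hilb_comm]
  obtain ⟨y, hy⟩ : ∃ y : ℚ_[2]ˣ, B 1 0 = y := ⟨Units.mk0 _ hB0, rfl⟩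
  have t2 : tauU B = y := tauU_of_ne hy
  rw [hx, hy, h1, hB] at c3
  by_cases hAB : (A * B) 1 0 = 0
  · have t3 : tauU (A * B) = m * (x * y⁻¹) :=
      Units.ext (by simp [tauU, hm, tau_mul_of_mul hB0 hAB, hx, hy, div_eq_mul_inv])
    have e : d2 = m * d1 * y * x⁻¹ * (q ^ 2)⁻¹ := by
      rw [eq_mul_inv_iff_mul_eq, eq_mul_inv_iff_mul_eq]
      refine Units.ext ?_
      push_cast
      rw [hm]
      rw [hAB] at c3
      linear_combination -c3
    rw [rho_of_eq hAB, rho_of_ne hx h1 hm, rho_of_ne hy h2 hm, t3, t1, t2, e]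
    simp only [pow_two, hilb_mul_left, hilb_mul_right, hilb_inv_left, hilb_inv_right]
    grind [hilb_comm]
  · obtain ⟨z, hz⟩ : ∃ z : ℚ_[2]ˣ, (A * B) 1 0 = z := ⟨Units.mk0 _ hAB, rfl⟩
    have t3 : tauU (A * B) = z := tauU_of_ne hz
    have key : hilb (z * x * d2) (z * y * d1) = 0 :=
      hilb_eq_zero (hilbertSym_eq_one_of (q : ℚ_[2]) 1 z q.ne_zero (by
        rw [hz] at c3
        push_cast
        linear_combination (z : ℚ_[2]) * c3))
    rw [rho_of_ne hx h1 hm, rho_of_ne hy h2 hm, rho_of_ne hz h3 hm, t3, t1, t2]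
    simp only [hilb_mul_left, hilb_mul_right, H] at key ⊢
    grind [hilb_comm]

/- the lower right entry as a unit of `ℤ₂` -/
theorem exists_unit_lowerRight {A : SL2} (hA : A ∈ K0 3) :
    ∃ v : ℤ_[2]ˣ, A 1 1 = ((v : ℤ_[2]) : ℚ_[2]) := by
  obtain ⟨a, b, c, d, h1, h2, h3, h4⟩ := hA
  obtain ⟨-, w, hw⟩ := sq_eq_of_mem h1 h2 h3 h4
  obtain ⟨t, ht⟩ := exists_sq_of_sub_one w
  obtain ⟨s, hs⟩ := eight_dvd_of_toZModPow (x := d * d) (y := 1) (by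
    have h8 : ((8 : ℕ) : ZMod (2 ^ 3)) = 0 := by decide
    rw [hw, map_add, map_mul, show (8 : ℤ_[2]) = ((8 : ℕ) : ℤ_[2]) by norm_num, map_natCast, h8,
      zero_mul, add_zero])
  have hu : IsUnit d := by
    rw [PadicInt.isUnit_iff]
    by_contra hne
    have hlt := lt_of_le_of_ne (PadicInt.norm_le_one d) hne
    rw [PadicInt.norm_lt_one_iff_dvd] at hlt
    obtain ⟨y, hy⟩ := hlt
    have h1 := congrArg (PadicInt.toZModPow 1) hw
    have h2 : PadicInt.toZModPow (p := 2) 1 ((2 : ℕ) : ℤ_[2]) = 0 := by rw [map_natCast]; decide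
    have h8 : PadicInt.toZModPow (p := 2) 1 8 = 0 := by
      rw [show (8 : ℤ_[2]) = ((8 : ℕ) : ℤ_[2]) by norm_num, map_natCast]; decide
    rw [hy, map_add, map_mul, map_mul, map_mul, h2, h8, zero_mul, zero_mul, zero_mul, add_zero,
      map_one] at h1
    exact absurd h1 (by decide)
  exact ⟨hu.unit, by rw [h4]; rfl⟩

/-- The genuine character `χ₁` of the inverse image of `K₀(8)`, where `ξ` is the value at
`(-I, 1)`, a primitive fourth root of unity: it is trivial on `(x(s), 1)` and `(y(t), 1)`, takes
the value `1` or `ξ` at `(h(u), 1)`, and the value `e` at `(I, e)`. -/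
noncomputable def chi1 (ξ : ℂ) (hξ : ξ ^ 2 = -1) : K0bar 3 →* ℂ where
  toFun g := torusChar ξ (lowerRight g)⁻¹ * ((triSgn g : ℤ) : ℂ)
  map_one' := by
    have h : triSgn 1 = 1 := by
      rw [triSgn_eq]
      simp [one_def, sfun_of_c (g := 1), rho_of_eq (A := 1), sgnZ_zero]
    have h' : torusChar ξ (lowerRight 1)⁻¹ = 1 := by
      rw [torusChar_eq ξ _ 1]
      · simp
      · simp [lowerRight, one_def]
    rw [h, h']; simp
  map_mul' := by
    intro g h
    obtain ⟨v1, hv1⟩ := exists_unit_lowerRight g.2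
    obtain ⟨v2, hv2⟩ := exists_unit_lowerRight h.2
    obtain ⟨v3, hv3⟩ := exists_unit_lowerRight (g * h).2
    obtain ⟨a1, b1, c1, d1, ha1, hb1, hc1, hd1⟩ := g.2
    obtain ⟨a2, b2, c2, d2, ha2, hb2, hc2, hd2⟩ := h.2
    obtain ⟨-, w1, hw1⟩ := sq_eq_of_mem ha1 hb1 hc1 hd1
    obtain ⟨had2, w2, hw2⟩ := sq_eq_of_mem ha2 hb2 hc2 hd2
    change (g : Mp2).mat 1 1 = _ at hv1
    change (h : Mp2).mat 1 1 = _ at hv2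
    change ((g : Mp2).mat * (h : Mp2).mat) 1 1 = _ at hv3
    change (g : Mp2).mat 0 0 = _ at ha1
    change (g : Mp2).mat 0 1 = _ at hb1
    change (g : Mp2).mat 1 0 = _ at hc1
    change (g : Mp2).mat 1 1 = _ at hd1
    change (h : Mp2).mat 0 0 = _ at ha2
    change (h : Mp2).mat 0 1 = _ at hb2
    change (h : Mp2).mat 1 0 = _ at hc2
    change (h : Mp2).mat 1 1 = _ at hd2
    have e1 : d1 = v1 := Subtype.ext (hd1.symm.trans hv1)
    have e2 : d2 = v2 := Subtype.ext (hd2.symm.trans hv2)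
    have e3 : (v3 : ℤ_[2]) = d1 * d2 + 8 * (c1 * b2) := by
      refine Subtype.ext ?_
      rw [← hv3, mul_11, hc1, hb2, hd1, hd2]
      push_cast
      change (2 : ℚ_[2]) ^ 3 * c1 * b2 + d1 * d2 = d1 * d2 + 8 * (c1 * b2)
      ring
    have l1 : ((lowerRight g : ℚ_[2]ˣ) : ℚ_[2]) = (v1 : ℤ_[2]) := hv1
    have l2 : ((lowerRight h : ℚ_[2]ˣ) : ℚ_[2]) = (v2 : ℤ_[2]) := hv2
    have l3 : ((lowerRight (g * h) : ℚ_[2]ˣ) : ℚ_[2]) = (v3 : ℤ_[2]) := hv3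
    -- the product of the three entries is a square
    have H : ∀ x, hilb x (lowerRight (g * h)) =
        hilb x (lowerRight g) + hilb x (lowerRight h) := by
      intro x
      obtain ⟨t, ht⟩ := exists_sq_of_sub_one (w1 + w2 + 8 * w1 * w2 + c1 * b2 * d1 * d2)
      have hsq : t ^ 2 = d1 * d2 * v3 := by
        rw [ht, e3]
        linear_combination (-d2 * d2) * hw1 - (1 + 8 * w1) * hw2
      have ht0 : (t : ℚ_[2]) ≠ 0 := by
        intro h0
        have : t = 0 := Subtype.ext h0
        exact one_add_eight_ne_zero _ (by rw [← ht, this]; simp)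
      have hu : (Units.mk0 _ ht0) * (Units.mk0 _ ht0) =
          lowerRight g * lowerRight h * lowerRight (g * h) := by
        refine Units.ext ?_
        push_cast
        rw [l1, l2, l3, ← e1, ← e2, Units.val_mk0]
        have := congrArg (fun z : ℤ_[2] => (z : ℚ_[2])) hsq
        push_cast at this
        rw [← this, pow_two]
      have h0 := congrArg (hilb x) hu
      simp only [hilb_mul_right] at h0
      grind
    obtain ⟨r, hr⟩ := exists_sq_of_sub_one (b2 * c2)
    rw [← had2] at hr
    have hr0 : (r : ℚ_[2]) ≠ 0 := by
      intro h0
      have : r = 0 := Subtype.ext h0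
      exact one_add_eight_ne_zero (b2 * c2) (by rw [← had2, ← hr, this]; simp)
    have hq : (h : Mp2).mat 0 0 =
        lowerRight h * (((Units.mk0 _ hr0) * (lowerRight h)⁻¹ : ℚ_[2]ˣ) : ℚ_[2]) ^ 2 := by
      have hr' : (r : ℚ_[2]) ^ 2 = a2 * d2 := by
        have := congrArg (fun z : ℤ_[2] => (z : ℚ_[2])) hr
        push_cast at this
        exact this
      have hne := (lowerRight h).ne_zero
      push_cast
      rw [Units.val_mk0, mul_pow, hr', ha2]
      have : ((lowerRight h : ℚ_[2]ˣ) : ℚ_[2]) = d2 := hd2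
      rw [this] at hne ⊢
      field_simp
    have K := alpha_add_rho (A := (g : Mp2).mat) (B := (h : Mp2).mat) (d1 := lowerRight g)
      (d2 := lowerRight h) (d3 := lowerRight (g * h)) rfl rfl rfl hq H
    have S : triSgn (g * h) =
        triSgn g * triSgn h * sgnZ (hilb (lowerRight g) (lowerRight h)) := by
      rw [triSgn_eq, triSgn_eq, triSgn_eq]
      have hm : ((g * h : K0bar 3) : Mp2).mat = (g : Mp2).mat * (h : Mp2).mat := rfl
      have hs : ((g * h : K0bar 3) : Mp2).sgn =
        (g : Mp2).sgn * (h : Mp2).sgn * sigma (g : Mp2).mat (h : Mp2).mat := rfl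
      rw [hm, hs, sigma_eq]
      have K' := congrArg sgnZ K
      rw [sgnZ_add, sgnZ_add, sgnZ_add] at K'
      set A := (g : Mp2).mat
      set B := (h : Mp2).mat
      calc _ = (g : Mp2).sgn * (h : Mp2).sgn * (sfun A * sfun B) *
            (sgnZ (alpha A B) * sgnZ (rho (A * B))) * (sfun (A * B) * sfun (A * B)) := by ac_rfl
        _ = (g : Mp2).sgn * (h : Mp2).sgn * (sfun A * sfun B) *
            (sgnZ (rho A) * sgnZ (rho B) * sgnZ (hilb (lowerRight g) (lowerRight h))) * 1 := by
            rw [K', Int.units_mul_self]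
        _ = _ := by rw [mul_one]; ac_rfl
    have T : torusChar ξ (lowerRight (g * h))⁻¹ *
        ((sgnZ (hilb (lowerRight g) (lowerRight h)) : ℤ) : ℂ) =
        torusChar ξ (lowerRight g)⁻¹ * torusChar ξ (lowerRight h)⁻¹ := by
      rw [torusChar_eq ξ (lowerRight g)⁻¹ v1 (by rw [← l1]; simp), torusChar_eq ξ (lowerRight h)⁻¹ v2 (by rw [← l2]; simp),
        torusChar_eq ξ (lowerRight (g * h))⁻¹ v3 (by rw [← l3]; simp), ← hilbertSym_eq_sgnZ, l1, l2, e3, map_add,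
        map_mul, map_mul, toZModPow_two_eight, zero_mul, add_zero, e1, e2]
      have n31 : ¬ (3 : ZMod (2 ^ 2)) = 1 := by decide
      have n33 : (3 : ZMod (2 ^ 2)) * 3 = 1 := by decide
      rcases toZModPow_unit v1 with m1 | m1 <;> rcases toZModPow_unit v2 with m2 | m2
      · rw [hilbertSym_of_one m1, m1, m2]; simp
      · rw [hilbertSym_of_one m1, m1, m2]; simp
      · rw [hilbertSym_comm, hilbertSym_of_one m2, m1, m2]; simp
      · rw [hilbertSym_three m1 m2, m1, m2, n33, if_pos rfl, if_neg n31, ← pow_two, hξ]; simp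
    have hsq : ((sgnZ (hilb (lowerRight g) (lowerRight h)) : ℤ) : ℂ) ^ 2 = 1 := by
      rcases Int.units_eq_one_or (sgnZ (hilb (lowerRight g) (lowerRight h))) with e | e <;>
      rw [e] <;> simp
    rw [S]
    push_cast
    linear_combination ((triSgn g : ℤ) : ℂ) * ((triSgn h : ℤ) : ℂ) * T

open MeasureTheory ComplexConjugate

/-- The Hecke algebra `H(S, γ)`: the functions `f` in `C_c^∞` (locally constant of compact
support) on the double cover with `f(k g k') = conj γ(k) conj γ(k') f(g)` for `k, k' ∈ S`. Its
multiplication is the convolution `conv`. -/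
noncomputable def heckeSpace (S : Subgroup Mp2) (γ : S →* ℂ) : Submodule ℂ (Mp2 → ℂ) where
  carrier := {f | IsLocallyConstant f ∧ HasCompactSupport f ∧
    ∀ (k k' : S) (g : Mp2), f (k * g * k') = conj (γ k) * conj (γ k') * f g}
  zero_mem' := ⟨IsLocallyConstant.const 0, HasCompactSupport.zero, fun _ _ _ => by simp⟩
  add_mem' := by
    rintro f f' ⟨h1, h2, h3⟩ ⟨h1', h2', h3'⟩
    refine ⟨h1.add h1', h2.add h2', fun k k' g => ?_⟩
    rw [Pi.add_apply, Pi.add_apply, h3, h3']; ring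
  smul_mem' := by
    rintro c f ⟨h1, h2, h3⟩
    refine ⟨h1.comp (fun z => c • z), h2.mono fun g hg h0 => hg (by simp [h0]), fun k k' g => ?_⟩
    rw [Pi.smul_apply, Pi.smul_apply, h3, smul_eq_mul, smul_eq_mul]; ring

/-- The convolution `(f₁ * f₂)(h) = ∫ f₁(g) f₂(g⁻¹ h) dg`. -/
noncomputable def conv (μ : Measure Mp2) (f₁ f₂ : Mp2 → ℂ) : Mp2 → ℂ :=
  fun h => ∫ g, f₁ g * f₂ (g⁻¹ * h) ∂μ

open Classical in
/-- The function supported on the double coset `S x S` with value `conj γ(k) z conj γ(k')` at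
`k x k'`, for `k, k' ∈ S`. -/
noncomputable def doubleCosetFun {S : Subgroup Mp2} (γ : S →* ℂ) (x : Mp2) (z : ℂ) : Mp2 → ℂ :=
  fun g => if h : ∃ p : S × S, g = p.1 * x * p.2 then
    conj (γ h.choose.1) * z * conj (γ h.choose.2) else 0

/-- `ζ₈ = (1 + ξ) / √2`, the value at `(w(1), 1)` of the character extended to the normalizer of
the torus by the value `1` at all `(h(2ⁿ), 1)`; it is also the value at `(w(2⁻ⁿ), 1)`, since
`(w(2⁻ⁿ), 1) = (h(2⁻ⁿ), 1)(w(1), 1)`. -/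
noncomputable def zeta8 (ξ : ℂ) : ℂ := (1 + ξ) / (Real.sqrt 2 : ℂ)

/-- `2ⁿ` as an element of `ℚ₂ˣ` -/
noncomputable def twoPow (n : ℤ) : ℚ_[2]ˣ := Units.mk0 2 two_ne_zero ^ n

/-- The check behind the value of the extended character at `(w(2ⁿ), 1)`. -/
theorem bar_wMat (n : ℤ) : bar (wMat (twoPow n)) = bar (hMat (twoPow n)) * bar (wMat 1) := by
  have hm : hMat (twoPow n) * wMat 1 = wMat (twoPow n) := by
    apply SL2_ext
    · rw [mul_00]; simp [hMat, wMat]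
    · rw [mul_01]; simp [hMat, wMat]
    · rw [mul_10]; simp [hMat, wMat]
    · rw [mul_11]; simp [hMat, wMat]
  have h2 : hilb (-1) (Units.mk0 2 two_ne_zero) = 0 :=
    hilb_eq_zero (hilbertSym_eq_one_of 1 1 1 one_ne_zero (by simp; norm_num))
  have hpow : ∀ k : ℤ, hilb (-1) (twoPow k) = 0 := by
    have hadd : ∀ i : ℤ, hilb (-1) (twoPow (i + 1)) = hilb (-1) (twoPow i) := by
      intro i
      have : twoPow (i + 1) = twoPow i * Units.mk0 2 two_ne_zero := zpow_add_one _ _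
      rw [this, hilb_mul_right, h2, add_zero]
    intro k
    induction k using Int.induction_on with
    | zero => simpa [twoPow] using hilb_one_right (-1)
    | succ i ih => rw [hadd, ih]
    | pred i ih => rw [← ih, ← hadd]; congr 2; ring
  have t1 : tauU (hMat (twoPow n)) = (twoPow n)⁻¹ :=
    tauU_of_eq (by simp [hMat]) (by simp [hMat])
  have t2 : tauU (wMat 1) = -1 := tauU_of_ne (by simp [wMat])
  have t3 : tauU (wMat (twoPow n)) = (-1) * (twoPow n)⁻¹ := tauU_of_ne (by simp [wMat])
  have s1 : ∀ t, sfun (wMat t) = 1 := fun t => by simp [sfun, wMat]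
  have hs : sigma (hMat (twoPow n)) (wMat 1) = 1 := by
    rw [sigma_eq, hm, s1, s1, sfun_of_c (by simp [hMat])]
    unfold alpha
    rw [hm, t1, t2, t3]
    have h3 : ∀ x : ZMod 2, x + x = 0 := by decide
    have hh := hpow n
    have h4 := hilb_self (twoPow n)
    rw [hilb_comm (twoPow n) (-1), hh] at h4
    simp only [hilb_mul_left, hilb_mul_right, hilb_inv_left, hilb_inv_right, h4,
      hilb_comm (twoPow n) (-1), hh, add_zero, h3]
    rfl
  rw [mul_def]
  simp only [bar, hm, hs, mul_one]

/-- The element `𝒰ₙ`, supported on the double coset of `(w(2⁻ⁿ), 1)`. -/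
noncomputable def heckeU (ξ : ℂ) (hξ : ξ ^ 2 = -1) (n : ℤ) : Mp2 → ℂ :=
  doubleCosetFun (chi1 ξ hξ) (bar (wMat (twoPow (-n)))) (conj (zeta8 ξ))

/-- The element `𝒱`, supported on the double coset of `(y(4), 1)` with value `1` there. -/
noncomputable def heckeV (ξ : ℂ) (hξ : ξ ^ 2 = -1) : Mp2 → ℂ :=
  doubleCosetFun (chi1 ξ hξ) (bar (yMat 4)) 1

/-- Three symbols for the generators. -/
inductive Gen
  | u₁
  | u₂
  | v

open FreeAlgebra in
/-- The defining relations, in the free `ℂ`-algebra on the three generators. -/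
inductive HeckeRel : FreeAlgebra ℂ Gen → FreeAlgebra ℂ Gen → Prop
  | u₁_sq : HeckeRel (ι ℂ Gen.u₁ ^ 2) (1 + ι ℂ Gen.v)
  | u₂_sq : HeckeRel (ι ℂ Gen.u₂ ^ 2) 1
  | u₁_v : HeckeRel (ι ℂ Gen.u₁ * ι ℂ Gen.v) (ι ℂ Gen.u₁)
  | v_u₁ : HeckeRel (ι ℂ Gen.v * ι ℂ Gen.u₁) (ι ℂ Gen.u₁)
  | braid : HeckeRel (ι ℂ Gen.u₂ * ι ℂ Gen.v * ι ℂ Gen.u₂) (ι ℂ Gen.v * ι ℂ Gen.u₂ * ι ℂ Gen.v)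

/-- The `ℂ`-algebra with the three generators and the defining relations. -/
abbrev PresentedAlg : Type := RingQuot HeckeRel

/-- The image of a generator in the presented algebra. -/
noncomputable def gen (i : Gen) : PresentedAlg :=
  RingQuot.mkAlgHom ℂ HeckeRel (FreeAlgebra.ι ℂ i)

end Metaplectic

open Metaplectic MeasureTheory

/-! A function in the Hecke algebra is determined on a double coset `S x S` by its value at `x`, and
this value can be nonzero only if `χ₁(k) = χ₁(k')` whenever `k x = x k'` with `k, k' ∈ S`. So the
algebra has a basis indexed by the double cosets that satisfy this condition. The theorem holds
because these double cosets correspond one to one to the reduced words in the generators.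

Relations. Since `S` is open and compact, convolution is a finite sum over left cosets of `S`
(`mem_heckeSpace_iff`, `integral_eq_sum`). The element `y(4)` normalizes `S` and preserves `χ₁`
(`bar_yMat_four_conj`), so `𝒱` lives on one left coset, while `𝒰₁` and `𝒰₂` live on two left cosets
each. This gives explicit operators `heckeV_conv`, `heckeU₁_conv` and `heckeU₂_conv`. Both sides of
a relation turn out to be supported on the same one or two double cosets, and it remains to compare
one value on each, with `uVal = (1 - ξ) / 2`. In `𝒰₂ * 𝒰₂` a further double coset could occur, that
of `x(t)` with `t ∈ (1/2)ℤ₂ˣ`. It supports no function, because `χ₁` takes the value `-1` at the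
conjugate of `x(2)` by `y(2)` (`chiExt_yMat_two_conj`); behind this is the symbol `(2, 5) = -1`.

The map. The left convolutions by the three functions satisfy the relations in the ring of
endomorphisms of the Hecke space, so the presented algebra acts on that space. Applying the action
to the identity function gives `heckeMap`, which is multiplicative by associativity of convolution.

Bijectivity. In the presented algebra `v² = 1` follows, and every word reduces to a combination of
`(u₁u₂)^m v^b`, `v^a u₂(u₁u₂)^m u₁`, `(u₁u₂)^m u₁` and `v^a u₂(u₁u₂)^m v^b` with `a, b ∈ {0, 1}`
(`span_elt`). The image of each of these is nonzero and supported on a single double coset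
(`supportedOn_elt`): multiplication by `u₂` and `v` is invertible, and multiplication by `u₁` cannot
kill `F` if `F` and `v F` have disjoint supports, because `u₁² = 1 + v`. The double cosets of the
normal forms are distinct (`NormalForm.eq_of_inDC`), as the relative positions of the lattices `ℤ₂ ⊕
2ⁱℤ₂` show. No other double coset supports a nonzero function (`classified`). Hence the images of
the normal forms are a basis of the Hecke algebra, and a spanning set is carried to a basis only by
a bijection. -/

namespace Metaplectic

open Mp2 MeasureTheory ComplexConjugate

/-! ### Matrices -/

theorem norm_two : ‖(2 : ℚ_[2])‖ = 2⁻¹ := by simpa using Padic.norm_p (p := 2)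

theorem norm_four : ‖(4 : ℚ_[2])‖ = 4⁻¹ := by
  rw [show (4 : ℚ_[2]) = 2 ^ 2 by norm_num, norm_pow, norm_two]; norm_num

theorem norm_eight : ‖(8 : ℚ_[2])‖ = 8⁻¹ := by
  rw [show (8 : ℚ_[2]) = 2 ^ 3 by norm_num, norm_pow, norm_two]; norm_num

theorem norm_two_zpow (n : ℤ) : ‖(2 : ℚ_[2]) ^ n‖ = (2 : ℝ) ^ (-n) := by
  rw [norm_zpow, norm_two, inv_zpow, zpow_neg]

theorem mem_K0_iff {A : SL2} : A ∈ K0 3 ↔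
    ‖A 0 0‖ ≤ 1 ∧ ‖A 0 1‖ ≤ 1 ∧ ‖A 1 0‖ ≤ 1 / 8 ∧ ‖A 1 1‖ ≤ 1 := by
  constructor
  · rintro ⟨a, b, c, d, h1, h2, h3, h4⟩
    rw [h1, h2, h3, h4]
    refine ⟨a.2, b.2, ?_, d.2⟩
    rw [norm_mul, norm_pow, norm_two]
    have := c.2
    norm_num at this ⊢
    linarith
  · rintro ⟨h1, h2, h3, h4⟩
    have h : ‖A 1 0 / 8‖ ≤ 1 := by
      rw [norm_div, norm_eight, div_inv_eq_mul]; linarith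
    exact ⟨⟨_, h1⟩, ⟨_, h2⟩, ⟨_, h⟩, ⟨_, h4⟩, rfl, rfl, by
      change A 1 0 = 2 ^ 3 * (A 1 0 / 8); norm_num; ring, rfl⟩

/-- The determinant is `1` and the product of the off-diagonal entries has norm less than `1`, so
the diagonal entries have product of norm `1`, and neither norm exceeds `1`. -/
theorem norm_diag_of_mem {A : SL2} (hA : A ∈ K0 3) : ‖A 0 0‖ = 1 ∧ ‖A 1 1‖ = 1 := by
  obtain ⟨h1, h2, h3, h4⟩ := mem_K0_iff.1 hA
  have hd := det_eq A
  have hbc : ‖A 0 1 * A 1 0‖ < 1 := by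
    rw [norm_mul]
    nlinarith [norm_nonneg (A 0 1), norm_nonneg (A 1 0)]
  have had : ‖A 0 0‖ * ‖A 1 1‖ = 1 := by
    rw [← norm_mul, show A 0 0 * A 1 1 = 1 + A 0 1 * A 1 0 by linear_combination hd]
    rw [Padic.add_eq_max_of_ne (by rw [norm_one]; exact hbc.ne'), norm_one]
    exact max_eq_left hbc.le
  constructor <;> nlinarith [norm_nonneg (A 0 0), norm_nonneg (A 1 1)]

theorem coe_twoPow (n : ℤ) : ((twoPow n : ℚ_[2]ˣ) : ℚ_[2]) = 2 ^ n := by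
  simp [twoPow]

@[simp] theorem xMat_00 (s : ℚ_[2]) : xMat s 0 0 = 1 := by simp [xMat]
@[simp] theorem xMat_01 (s : ℚ_[2]) : xMat s 0 1 = s := by simp [xMat]
@[simp] theorem xMat_10 (s : ℚ_[2]) : xMat s 1 0 = 0 := by simp [xMat]
@[simp] theorem xMat_11 (s : ℚ_[2]) : xMat s 1 1 = 1 := by simp [xMat]
@[simp] theorem yMat_00 (s : ℚ_[2]) : yMat s 0 0 = 1 := by simp [yMat]
@[simp] theorem yMat_01 (s : ℚ_[2]) : yMat s 0 1 = 0 := by simp [yMat]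
@[simp] theorem yMat_10 (s : ℚ_[2]) : yMat s 1 0 = s := by simp [yMat]
@[simp] theorem yMat_11 (s : ℚ_[2]) : yMat s 1 1 = 1 := by simp [yMat]
@[simp] theorem wMat_00 (t : ℚ_[2]ˣ) : wMat t 0 0 = 0 := by simp [wMat]
@[simp] theorem wMat_01 (t : ℚ_[2]ˣ) : wMat t 0 1 = t := by simp [wMat]
@[simp] theorem wMat_10 (t : ℚ_[2]ˣ) : wMat t 1 0 = -(t : ℚ_[2])⁻¹ := by simp [wMat]
@[simp] theorem wMat_11 (t : ℚ_[2]ˣ) : wMat t 1 1 = 0 := by simp [wMat]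
@[simp] theorem hMat_00 (t : ℚ_[2]ˣ) : hMat t 0 0 = t := by simp [hMat]
@[simp] theorem hMat_01 (t : ℚ_[2]ˣ) : hMat t 0 1 = 0 := by simp [hMat]
@[simp] theorem hMat_10 (t : ℚ_[2]ˣ) : hMat t 1 0 = 0 := by simp [hMat]
@[simp] theorem hMat_11 (t : ℚ_[2]ˣ) : hMat t 1 1 = (t : ℚ_[2])⁻¹ := by simp [hMat]
@[simp] theorem SL2_one_00 : (1 : SL2) 0 0 = 1 := by simp
@[simp] theorem SL2_one_01 : (1 : SL2) 0 1 = 0 := by simp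
@[simp] theorem SL2_one_10 : (1 : SL2) 1 0 = 0 := by simp
@[simp] theorem SL2_one_11 : (1 : SL2) 1 1 = 1 := by simp
@[simp] theorem SL2_neg_apply (A : SL2) (i j) : (-A) i j = -A i j := by simp

theorem inv_00 (A : SL2) : A⁻¹ 0 0 = A 1 1 := by simp [Matrix.adjugate_fin_two]
theorem inv_01 (A : SL2) : A⁻¹ 0 1 = -A 0 1 := by simp [Matrix.adjugate_fin_two]
theorem inv_10 (A : SL2) : A⁻¹ 1 0 = -A 1 0 := by simp [Matrix.adjugate_fin_two]
theorem inv_11 (A : SL2) : A⁻¹ 1 1 = A 0 0 := by simp [Matrix.adjugate_fin_two]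

theorem xMat_add (s t : ℚ_[2]) : xMat (s + t) = xMat s * xMat t := by
  apply SL2_ext <;> simp [mul_00, mul_01, mul_10, mul_11, add_comm]

theorem yMat_add (s t : ℚ_[2]) : yMat (s + t) = yMat s * yMat t := by
  apply SL2_ext <;> simp [mul_00, mul_01, mul_10, mul_11]

theorem xMat_zero : xMat 0 = 1 := by apply SL2_ext <;> simp
theorem yMat_zero : yMat 0 = 1 := by apply SL2_ext <;> simp

theorem xMat_neg (s : ℚ_[2]) : xMat (-s) = (xMat s)⁻¹ := by
  rw [eq_inv_iff_mul_eq_one, ← xMat_add, neg_add_cancel, xMat_zero]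

theorem yMat_neg (s : ℚ_[2]) : yMat (-s) = (yMat s)⁻¹ := by
  rw [eq_inv_iff_mul_eq_one, ← yMat_add, neg_add_cancel, yMat_zero]

theorem xMat_mem {s : ℚ_[2]} (h : ‖s‖ ≤ 1) : xMat s ∈ K0 3 := by
  rw [mem_K0_iff]; simp [h]

theorem yMat_mem {s : ℚ_[2]} (h : ‖s‖ ≤ 1 / 8) : yMat s ∈ K0 3 := by
  rw [mem_K0_iff]; simpa using h

theorem hMat_mem {u : ℚ_[2]ˣ} (h : ‖(u : ℚ_[2])‖ = 1) : hMat u ∈ K0 3 := by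
  rw [mem_K0_iff]; simp [h]

theorem neg_one_mem : (-1 : SL2) ∈ K0 3 := by
  rw [mem_K0_iff]; simp

/-! ### Signs in the double cover -/

theorem zmod_two_add_self (x : ZMod 2) : x + x = 0 := by revert x; decide

/-- Left multiplication by `x(s)` does not change the lower row, on which `τ` and `s₂` depend. -/
theorem sigma_xMat_left (s : ℚ_[2]) (g : SL2) : sigma (xMat s) g = 1 := by
  have h1 : tauU (xMat s) = 1 := tauU_of_eq (by simp) (by simp)
  have h2 : tauU (xMat s * g) = tauU g :=
    Units.ext (by simp [tauU, tau_mul_of_left (g := xMat s) (h := g) (by simp)])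
  have h3 : sfun (xMat s * g) = sfun g := by
    have e1 : (xMat s * g) 1 0 = g 1 0 := by simp [mul_10]
    have e2 : (xMat s * g) 1 1 = g 1 1 := by simp [mul_11]
    unfold sfun; rw [e1, e2]
  rw [sigma_eq, sfun_of_c (g := xMat s) (by simp), h3, one_mul, Int.units_mul_self, mul_one,
    alpha, h2, h1, mul_one, hilb_mul_right, zmod_two_add_self, sgnZ_zero]

theorem hilbertSym_one_right {F : Type*} [Field F] (a : F) : hilbertSym a 1 = 1 := by
  rw [hilbertSym_comm]; exact hilbertSym_eq_one_of 1 0 1 one_ne_zero (by ring)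

theorem sfun_of_d_one {g : SL2} (h : g 1 1 = 1) : sfun g = 1 := by
  unfold sfun
  rw [h, hilbertSym_one_right]; simp

theorem sfun_of_d_zero {g : SL2} (h : g 1 1 = 0) : sfun g = 1 := by simp [sfun, h]

/-- The cover splits over the lower unipotent group: for `s + t = 0` the symbol has the form `(a,
-a)`, and for nonzero `s`, `t`, `s + t` it is trivial by the three-term relation `hilb_add`. -/
theorem sigma_yMat (s t : ℚ_[2]) : sigma (yMat s) (yMat t) = 1 := by
  rw [sigma_eq, ← yMat_add, sfun_of_d_one (by simp), sfun_of_d_one (by simp),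
    sfun_of_d_one (by simp), one_mul, one_mul, mul_one, alpha, ← yMat_add]
  by_cases hs : s = 0
  · subst hs
    have h1 : tauU (yMat 0) = 1 := tauU_of_eq (by simp) (by simp)
    rw [zero_add, h1, mul_one, hilb_mul_right, zmod_two_add_self, sgnZ_zero]
  by_cases ht : t = 0
  · subst ht
    have h1 : tauU (yMat 0) = 1 := tauU_of_eq (by simp) (by simp)
    rw [add_zero, h1, mul_one, hilb_mul_left, zmod_two_add_self, sgnZ_zero]
  have e1 : tauU (yMat s) = Units.mk0 s hs := tauU_of_ne (by simp)
  have e2 : tauU (yMat t) = Units.mk0 t ht := tauU_of_ne (by simp)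
  by_cases hst : s + t = 0
  · have e3 : tauU (yMat (s + t)) = 1 := tauU_of_eq (by simp [hst]) (by simp)
    have e4 : Units.mk0 t ht = -Units.mk0 s hs := Units.ext (by simp; linear_combination hst)
    rw [e1, e2, e3, one_mul, one_mul, e4, hilb_neg_self, sgnZ_zero]
  · have e3 : tauU (yMat (s + t)) = Units.mk0 _ hst := tauU_of_ne (by simp)
    rw [e1, e2, e3, mul_comm, mul_comm _ (Units.mk0 t ht), hilb_add (by simp; ring), sgnZ_zero]

theorem bar_mul {g h : SL2} (hs : sigma g h = 1) : bar g * bar h = bar (g * h) := by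
  simp [mul_def, bar, hs]

@[simp] theorem bar_mat (g : SL2) : (bar g).mat = g := rfl
@[simp] theorem mat_mul (g h : Mp2) : (g * h).mat = g.mat * h.mat := rfl
@[simp] theorem mat_inv (g : Mp2) : (g⁻¹).mat = g.mat⁻¹ := rfl
@[simp] theorem mat_one : (1 : Mp2).mat = 1 := rfl

theorem bar_xMat_mul (s : ℚ_[2]) (g : SL2) : bar (xMat s) * bar g = bar (xMat s * g) :=
  bar_mul (sigma_xMat_left s g)

theorem bar_xMat_add (s t : ℚ_[2]) : bar (xMat (s + t)) = bar (xMat s) * bar (xMat t) := by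
  rw [bar_xMat_mul, xMat_add]

theorem bar_yMat_add (s t : ℚ_[2]) : bar (yMat (s + t)) = bar (yMat s) * bar (yMat t) := by
  rw [bar_mul (sigma_yMat s t), yMat_add]

theorem bar_xMat_zero : bar (xMat 0) = 1 := by rw [xMat_zero]; rfl
theorem bar_yMat_zero : bar (yMat 0) = 1 := by rw [yMat_zero]; rfl

theorem bar_xMat_neg (s : ℚ_[2]) : bar (xMat (-s)) = (bar (xMat s))⁻¹ := by
  rw [eq_inv_iff_mul_eq_one, ← bar_xMat_add, neg_add_cancel, bar_xMat_zero]

theorem bar_yMat_neg (s : ℚ_[2]) : bar (yMat (-s)) = (bar (yMat s))⁻¹ := by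
  rw [eq_inv_iff_mul_eq_one, ← bar_yMat_add, neg_add_cancel, bar_yMat_zero]

/-- The central element `(I, ε)`. -/
noncomputable def cen (ε : ℤˣ) : Mp2 := ⟨1, ε⟩

theorem cen_mul (ε : ℤˣ) (g : Mp2) : cen ε * g = ⟨g.mat, ε * g.sgn⟩ := by
  simp [mul_def, cen, sigma_one_left]

theorem mul_cen (ε : ℤˣ) (g : Mp2) : g * cen ε = ⟨g.mat, ε * g.sgn⟩ := by
  simp [mul_def, cen, sigma_one_right, mul_comm]

theorem cen_comm (ε : ℤˣ) (g : Mp2) : g * cen ε = cen ε * g := by rw [cen_mul, mul_cen]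

theorem cen_mul_cen (ε : ℤˣ) : cen ε * cen ε = 1 := by
  rw [cen_mul]; simp [cen, one_def, Int.units_mul_self]

theorem exists_cen_of_mat_eq {g h : Mp2} (e : g.mat = h.mat) : ∃ ε, g = cen ε * h :=
  ⟨g.sgn * h.sgn, by
    rw [cen_mul]
    ext1
    · exact e
    · simp [mul_assoc, Int.units_mul_self]⟩

/-- Squares in the double cover depend only on the image in `SL₂`. -/
theorem mul_self_eq_of_mat_eq {g h : Mp2} (e : g.mat = h.mat) : g * g = h * h := by
  obtain ⟨ε, rfl⟩ := exists_cen_of_mat_eq e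
  rw [mul_assoc, ← mul_assoc h, cen_comm, mul_assoc, ← mul_assoc, cen_mul_cen, one_mul]

/-- A square has a well-defined lift, so a conjugation relation in `SL₂` lifts to the squares
without a sign. Unipotent elements are squares, as `x(s) = x(s/2)²` and `y(s) = y(s/2)²`; their
conjugations in the cover therefore need no cocycle computation. -/
theorem conj_sq {p a b : Mp2} (e : a.mat * p.mat = p.mat * b.mat) :
    (a * a) * p = p * (b * b) := by
  have : (p⁻¹ * a * p).mat = b.mat := by
    simp only [mat_mul, mat_inv]; rw [mul_assoc, e, inv_mul_cancel_left]
  have h := mul_self_eq_of_mat_eq this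
  rw [← h]; group

theorem bar_xMat_half (s : ℚ_[2]) : bar (xMat s) = bar (xMat (s / 2)) * bar (xMat (s / 2)) := by
  rw [← bar_xMat_add, add_halves]

theorem bar_yMat_half (s : ℚ_[2]) : bar (yMat s) = bar (yMat (s / 2)) * bar (yMat (s / 2)) := by
  rw [← bar_yMat_add, add_halves]

theorem xMat_mul_wMat (s : ℚ_[2]) (t : ℚ_[2]ˣ) :
    xMat s * wMat t = wMat t * yMat (-(s / t ^ 2)) := by
  have := t.ne_zero
  apply SL2_ext <;> simp [mul_00, mul_01, mul_10, mul_11]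
  field_simp

theorem yMat_mul_wMat (s : ℚ_[2]) (t : ℚ_[2]ˣ) :
    yMat s * wMat t = wMat t * xMat (-(s * t ^ 2)) := by
  have := t.ne_zero
  apply SL2_ext <;> simp [mul_00, mul_01, mul_10, mul_11]
  field_simp

theorem xMat_mul_hMat (s : ℚ_[2]) (t : ℚ_[2]ˣ) :
    xMat s * hMat t = hMat t * xMat (s / t ^ 2) := by
  have := t.ne_zero
  apply SL2_ext <;> simp [mul_00, mul_01, mul_10, mul_11]
  field_simp

theorem yMat_mul_hMat (s : ℚ_[2]) (t : ℚ_[2]ˣ) :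
    yMat s * hMat t = hMat t * yMat (s * t ^ 2) := by
  have := t.ne_zero
  apply SL2_ext <;> simp [mul_00, mul_01, mul_10, mul_11]
  field_simp

theorem bar_xMat_conj {p : Mp2} {s t : ℚ_[2]}
    (h : xMat (s / 2) * p.mat = p.mat * xMat (t / 2)) :
    bar (xMat s) * p = p * bar (xMat t) := by
  rw [bar_xMat_half s, bar_xMat_half t]; exact conj_sq h

theorem bar_xMat_conj_yMat {p : Mp2} {s t : ℚ_[2]}
    (h : xMat (s / 2) * p.mat = p.mat * yMat (t / 2)) :
    bar (xMat s) * p = p * bar (yMat t) := by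
  rw [bar_xMat_half s, bar_yMat_half t]; exact conj_sq h

theorem bar_yMat_conj {p : Mp2} {s t : ℚ_[2]}
    (h : yMat (s / 2) * p.mat = p.mat * yMat (t / 2)) :
    bar (yMat s) * p = p * bar (yMat t) := by
  rw [bar_yMat_half s, bar_yMat_half t]; exact conj_sq h

theorem bar_yMat_conj_xMat {p : Mp2} {s t : ℚ_[2]}
    (h : yMat (s / 2) * p.mat = p.mat * xMat (t / 2)) :
    bar (yMat s) * p = p * bar (xMat t) := by
  rw [bar_yMat_half s, bar_xMat_half t]; exact conj_sq h

theorem bar_xMat_mul_wMat (s : ℚ_[2]) (t : ℚ_[2]ˣ) :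
    bar (xMat s) * bar (wMat t) = bar (wMat t) * bar (yMat (-(s / t ^ 2))) := by
  apply bar_xMat_conj_yMat
  rw [bar_mat, xMat_mul_wMat]; congr 2; ring

theorem bar_yMat_mul_wMat (s : ℚ_[2]) (t : ℚ_[2]ˣ) :
    bar (yMat s) * bar (wMat t) = bar (wMat t) * bar (xMat (-(s * t ^ 2))) := by
  apply bar_yMat_conj_xMat
  rw [bar_mat, yMat_mul_wMat]; congr 2; ring

theorem bar_yMat_mul_hMat (s : ℚ_[2]) (t : ℚ_[2]ˣ) :
    bar (yMat s) * bar (hMat t) = bar (hMat t) * bar (yMat (s * t ^ 2)) := by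
  apply bar_yMat_conj
  rw [bar_mat, yMat_mul_hMat]; congr 2; ring

/-- Torus elements need not be squares, so `conj_sq` does not apply. The cocycle values of the two
products are compared directly, by bilinearity and `(a, a) = (a, -1)`. -/
theorem bar_hMat_mul_wMat (u t : ℚ_[2]ˣ) :
    bar (hMat u) * bar (wMat t) = bar (wMat t) * bar (hMat u⁻¹) := by
  have hm : hMat u * wMat t = wMat t * hMat u⁻¹ := by
    apply SL2_ext <;> simp [mul_00, mul_01, mul_10, mul_11, mul_comm]
  have t1 : ∀ u, tauU (hMat u) = u⁻¹ := fun u => tauU_of_eq (by simp) (by simp)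
  have t2 : tauU (wMat t) = (-1) * t⁻¹ := tauU_of_ne (by simp)
  have t3 : tauU (hMat u * wMat t) = (-1) * (t⁻¹ * u⁻¹) := tauU_of_ne (by simp [mul_10, mul_comm])
  have s1 : sigma (hMat u) (wMat t) = sigma (wMat t) (hMat u⁻¹) := by
    rw [sigma_eq, sigma_eq, ← hm, alpha, alpha, ← hm, t1, t1, t2, t3,
      sfun_of_d_zero (g := wMat t) (by simp), sfun_of_c (g := hMat u) (by simp),
      sfun_of_c (g := hMat u⁻¹) (by simp)]
    congr 2
    simp only [hilb_mul_left, hilb_mul_right, hilb_inv_left, hilb_inv_right]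
    grind [hilb_comm, hilb_self]
  simp only [mul_def, bar, hm, s1]

/-- `w(t)² = (-I, 1)` if `(t, -1) = 1`. -/
theorem bar_wMat_sq {t : ℚ_[2]ˣ} (ht : hilb t (-1) = 0) :
    bar (wMat t) * bar (wMat t) = bar (-1) := by
  have hm : wMat t * wMat t = -1 := by
    apply SL2_ext <;> simp [mul_00, mul_01, mul_10, mul_11]
  have t2 : tauU (wMat t) = (-1) * t⁻¹ := tauU_of_ne (by simp)
  have t3 : tauU (-1) = -1 := tauU_of_eq (by simp) (by simp)
  rw [bar_mul, hm]
  rw [sigma_eq, alpha, hm, t2, t3, sfun_of_d_zero (g := wMat t) (by simp),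
    sfun_of_c (g := -1) (by simp)]
  rw [show (-1 : ℚ_[2]ˣ) * (-1 * t⁻¹) = t⁻¹ by simp, hilb_inv_left, hilb_inv_right,
    hilb_self, ht, sgnZ_zero]
  simp

/-- The factorization `x(t) = y(1/t) w(t) y(1/t)`. -/
theorem xMat_eq (t : ℚ_[2]ˣ) : xMat t = yMat (t : ℚ_[2])⁻¹ * wMat t * yMat (t : ℚ_[2])⁻¹ := by
  have := t.ne_zero
  apply SL2_ext <;> simp [mul_00, mul_01, mul_10, mul_11]

/-- The factorization lifts without a sign, since both cocycle values are of the form `(a, -a)`. -/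
theorem bar_xMat_eq (t : ℚ_[2]ˣ) : bar (xMat t) =
    bar (yMat (t : ℚ_[2])⁻¹) * bar (wMat t) * bar (yMat (t : ℚ_[2])⁻¹) := by
  have t1 : tauU (yMat (t : ℚ_[2])⁻¹) = t⁻¹ := tauU_of_ne (by simp)
  have t2 : tauU (wMat t) = -t⁻¹ := tauU_of_ne (by simp)
  have t3 : tauU (yMat (t : ℚ_[2])⁻¹ * wMat t) = -t⁻¹ := tauU_of_ne (by simp [mul_10])
  have t4 : tauU (xMat t) = 1 := tauU_of_eq (by simp) (by simp)
  have s3 : sfun (yMat (t : ℚ_[2])⁻¹ * wMat t) = 1 := sfun_of_d_one (by simp [mul_11])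
  have s1 : sfun (yMat (t : ℚ_[2])⁻¹) = 1 := sfun_of_d_one (by simp)
  have s2 : sfun (wMat t) = 1 := sfun_of_d_zero (by simp)
  have s4 : sfun (xMat t) = 1 := sfun_of_c (by simp)
  have h1 : sigma (yMat (t : ℚ_[2])⁻¹) (wMat t) = 1 := by
    rw [sigma_eq, alpha, t1, t2, t3, s1, s2, s3, neg_mul, neg_mul_neg, hilb_comm, hilb_neg_self,
      sgnZ_zero]
    simp
  have h2 : sigma (yMat (t : ℚ_[2])⁻¹ * wMat t) (yMat (t : ℚ_[2])⁻¹) = 1 := by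
    rw [sigma_eq, alpha, ← xMat_eq, t1, t3, t4, s1, s3, s4, one_mul, one_mul, hilb_comm,
      hilb_neg_self, sgnZ_zero]
    simp
  rw [bar_mul h1, bar_mul h2, ← xMat_eq]

/-! ### Norms in `ℚ₂` -/

theorem norm_le_half_of_lt_one {s : ℚ_[2]} (hs : ‖s‖ < 1) : ‖s‖ ≤ 1 / 2 := by
  have h := (PadicInt.norm_lt_one_iff_dvd (p := 2) ⟨s, hs.le⟩).1 hs
  obtain ⟨z, hz⟩ := h
  have : s = 2 * z := congrArg (fun z : ℤ_[2] => (z : ℚ_[2])) hz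
  rw [this, norm_mul, norm_two]
  have := z.2
  linarith

/-- A 2-adic integer is even or odd. -/
theorem even_or_odd_of_norm_le {s : ℚ_[2]} (hs : ‖s‖ ≤ 1) : ‖s‖ ≤ 1 / 2 ∨ ‖s - 1‖ ≤ 1 / 2 := by
  set x : ℤ_[2] := ⟨s, hs⟩
  have key : ∀ y : ℤ_[2], PadicInt.toZMod y = 0 → ‖(y : ℚ_[2])‖ ≤ 1 / 2 := by
    intro y hy
    have : y ∈ RingHom.ker (PadicInt.toZMod (p := 2)) := hy
    rw [PadicInt.ker_toZMod, IsLocalRing.mem_maximalIdeal, PadicInt.mem_nonunits] at this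
    exact norm_le_half_of_lt_one this
  have h01 : ∀ z : ZMod 2, z = 0 ∨ z - 1 = 0 := by decide
  rcases h01 (PadicInt.toZMod x) with h | h
  · exact Or.inl (key x h)
  · exact Or.inr (key (x - 1) (by rw [map_sub, map_one]; exact h))

theorem norm_add_le_of_le {a b : ℚ_[2]} {r : ℝ} (ha : ‖a‖ ≤ r) (hb : ‖b‖ ≤ r) : ‖a + b‖ ≤ r :=
  (Padic.nonarchimedean a b).trans (max_le ha hb)

theorem norm_sub_le_of_le {a b : ℚ_[2]} {r : ℝ} (ha : ‖a‖ ≤ r) (hb : ‖b‖ ≤ r) : ‖a - b‖ ≤ r := by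
  rw [sub_eq_add_neg]; exact norm_add_le_of_le ha (by rwa [norm_neg])

/-- The dichotomy of `even_or_odd_of_norm_le` after scaling by a nonzero number. -/
theorem even_or_odd_scaled {s c : ℚ_[2]} (hc : c ≠ 0) (hs : ‖s‖ ≤ ‖c‖) :
    ‖s‖ ≤ ‖c‖ / 2 ∨ ‖s - c‖ ≤ ‖c‖ / 2 := by
  have hc' : 0 < ‖c‖ := norm_pos_iff.2 hc
  have h : ‖s / c‖ ≤ 1 := by rw [norm_div, div_le_one hc']; exact hs
  have e : s / c - 1 = (s - c) / c := by field_simp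
  rcases even_or_odd_of_norm_le h with h | h
  · rw [norm_div, div_le_iff₀ hc'] at h; left; linarith
  · rw [e, norm_div, div_le_iff₀ hc'] at h; right; linarith

/-! ### The character of the torus -/

/-- The classes of `1` and `5` modulo `8` together form `1 + 4ℤ₂`, so the condition is a bound on
one norm. -/
theorem torusChar_eq_norm (ξ : ℂ) {u : ℚ_[2]ˣ} :
    torusChar ξ u = if ‖(u : ℚ_[2]) - 1‖ ≤ 1 / 4 then 1 else ξ := by
  unfold torusChar
  congr 1
  refine propext ⟨?_, fun h => ?_⟩
  · rintro ⟨z, h | h⟩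
    · rw [h, add_sub_cancel_left, norm_mul, norm_eight]
      have := z.2; linarith
    · rw [h, show (5 : ℚ_[2]) + 8 * z - 1 = 4 * (1 + 2 * z) by ring, norm_mul, norm_four]
      have : ‖(1 : ℚ_[2]) + 2 * z‖ ≤ 1 := by
        refine norm_add_le_of_le norm_one.le ?_
        rw [norm_mul, norm_two]
        have := z.2; linarith
      linarith
  · have h4 : ‖((u : ℚ_[2]) - 1)‖ ≤ ‖(4 : ℚ_[2])‖ := by rw [norm_four]; linarith
    have key : ∀ y : ℚ_[2], ‖y‖ ≤ ‖(4 : ℚ_[2])‖ / 2 → ∃ z : ℤ_[2], y = 8 * z := by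
      intro y hy
      refine ⟨⟨y / 8, ?_⟩, ?_⟩
      · rw [norm_div, norm_eight, div_inv_eq_mul]; rw [norm_four] at hy; linarith
      · change y = 8 * (y / 8); ring
    rcases even_or_odd_scaled (by norm_num) h4 with h' | h'
    · obtain ⟨z, hz⟩ := key _ h'
      exact ⟨z, Or.inl (by linear_combination hz)⟩
    · obtain ⟨z, hz⟩ := key _ h'
      exact ⟨z, Or.inr (by linear_combination hz)⟩

theorem torusChar_inv (ξ : ℂ) {u : ℚ_[2]ˣ} (hu : ‖(u : ℚ_[2])‖ = 1) :
    torusChar ξ u⁻¹ = torusChar ξ u := by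
  rw [torusChar_eq_norm, torusChar_eq_norm]
  have : ‖((u⁻¹ : ℚ_[2]ˣ) : ℚ_[2]) - 1‖ = ‖(u : ℚ_[2]) - 1‖ := by
    rw [Units.val_inv_eq_inv_val, show ((u : ℚ_[2])⁻¹ - 1) = -((u : ℚ_[2]) - 1) / u by
      have := u.ne_zero; field_simp; ring, norm_div, hu, norm_neg, div_one]
  rw [this]

theorem torusChar_eq_one (ξ : ℂ) {u : ℚ_[2]ˣ} (hu : ‖(u : ℚ_[2]) - 1‖ ≤ 1 / 4) :
    torusChar ξ u = 1 := by rw [torusChar_eq_norm, if_pos hu]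

theorem torusChar_neg_one (ξ : ℂ) : torusChar ξ (-1) = ξ := by
  rw [torusChar_eq_norm, if_neg]
  rw [show ((-1 : ℚ_[2]ˣ) : ℚ_[2]) - 1 = -2 by push_cast; norm_num, norm_neg, norm_two]
  norm_num

/-! ### Values of `χ₁` -/

theorem norm_xi {ξ : ℂ} (hξ : ξ ^ 2 = -1) : ‖ξ‖ = 1 := by
  have h := congrArg norm hξ
  rw [norm_pow, norm_neg, norm_one] at h
  nlinarith [norm_nonneg ξ]

theorem conj_xi {ξ : ℂ} (hξ : ξ ^ 2 = -1) : conj ξ = -ξ := by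
  have h1 : ξ * conj ξ = 1 := by
    rw [Complex.mul_conj, Complex.normSq_eq_norm_sq, norm_xi hξ]; simp
  have h2 : ξ * (conj ξ + ξ) = 0 := by linear_combination h1 + hξ
  have h3 : ξ ≠ 0 := by rintro rfl; simp at hξ
  have := (mul_eq_zero.1 h2).resolve_left h3
  linear_combination this

section Chi

variable (ξ : ℂ) (hξ : ξ ^ 2 = -1)

open Classical in
/-- `χ₁`, extended by zero. -/
noncomputable def chiExt (g : Mp2) : ℂ :=
  if h : g ∈ K0bar 3 then chi1 ξ hξ ⟨g, h⟩ else 0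

theorem chiExt_coe (k : K0bar 3) : chiExt ξ hξ k = chi1 ξ hξ k := by
  unfold chiExt; rw [dif_pos k.2]

theorem chiExt_mul {g h : Mp2} (hg : g.mat ∈ K0 3) (hh : h.mat ∈ K0 3) :
    chiExt ξ hξ (g * h) = chiExt ξ hξ g * chiExt ξ hξ h := by
  have := map_mul (chi1 ξ hξ) ⟨g, hg⟩ ⟨h, hh⟩
  rwa [← chiExt_coe, ← chiExt_coe, ← chiExt_coe] at this

theorem chiExt_one : chiExt ξ hξ 1 = 1 := by
  have := map_one (chi1 ξ hξ)
  rwa [← chiExt_coe] at this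

/-- The rule by which `χ₁` is evaluated at explicit matrices, without the triangular decomposition.
The decomposition has `u = d⁻¹`, but `torusChar` does not distinguish a unit from its inverse. -/
theorem chiExt_eq {g : Mp2} (hg : g.mat ∈ K0 3) {d : ℚ_[2]ˣ} (hd : g.mat 1 1 = d) :
    chiExt ξ hξ g = torusChar ξ d *
      (((g.sgn * sfun g.mat * sgnZ (rho g.mat) : ℤˣ) : ℤ) : ℂ) := by
  have e : lowerRight ⟨g, hg⟩ = d := Units.ext hd
  have hd1 : ‖(d : ℚ_[2])‖ = 1 := by rw [← hd]; exact (norm_diag_of_mem hg).2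
  have : chiExt ξ hξ g = chi1 ξ hξ ⟨g, hg⟩ := chiExt_coe ξ hξ ⟨g, hg⟩
  rw [this]
  change torusChar ξ (lowerRight ⟨g, hg⟩)⁻¹ * ((triSgn ⟨g, hg⟩ : ℤ) : ℂ) = _
  rw [e, triSgn_eq, torusChar_inv ξ hd1]

theorem chiExt_xMat {s : ℚ_[2]} (hs : ‖s‖ ≤ 1) : chiExt ξ hξ (bar (xMat s)) = 1 := by
  rw [chiExt_eq ξ hξ (xMat_mem hs) (d := 1) (by simp), torusChar_eq_one ξ (by simp)]
  simp [sfun_of_c (g := xMat s), rho_of_eq (A := xMat s), sgnZ_zero, bar]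

theorem rho_of_d_one {A : SL2} (h : A 1 1 = 1) : rho A = 0 := by
  unfold rho
  split_ifs with h'
  · refine hilb_eq_zero ?_
    rw [Units.val_mk0, h, hilbertSym_one_right]
  · rfl

theorem chiExt_yMat {s : ℚ_[2]} (hs : ‖s‖ ≤ 1 / 8) : chiExt ξ hξ (bar (yMat s)) = 1 := by
  rw [chiExt_eq ξ hξ (yMat_mem hs) (d := 1) (by simp), torusChar_eq_one ξ (by simp)]
  simp [sfun_of_d_one (g := yMat s), rho_of_d_one (A := yMat s), sgnZ_zero, bar]

theorem chiExt_hMat {u : ℚ_[2]ˣ} (hu : ‖(u : ℚ_[2])‖ = 1) :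
    chiExt ξ hξ (bar (hMat u)) = torusChar ξ u := by
  rw [chiExt_eq ξ hξ (hMat_mem hu) (d := u⁻¹) (by simp), torusChar_inv ξ hu]
  simp [sfun_of_c (g := hMat u), rho_of_eq (A := hMat u), sgnZ_zero, bar]

theorem cen_mem (ε : ℤˣ) : (cen ε).mat ∈ K0 3 := one_mem _

theorem chiExt_cen (ε : ℤˣ) : chiExt ξ hξ (cen ε) = ((ε : ℤ) : ℂ) := by
  rw [chiExt_eq ξ hξ (cen_mem ε) (d := 1) (by simp [cen]), torusChar_eq_one ξ (by simp)]
  simp [cen, sfun_of_c (g := 1), rho_of_eq (A := 1), sgnZ_zero]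

theorem chiExt_neg_one : chiExt ξ hξ (bar (-1)) = ξ := by
  rw [chiExt_eq ξ hξ neg_one_mem (d := -1) (by simp), torusChar_neg_one]
  simp [sfun_of_c (g := -1), rho_of_eq (A := -1), sgnZ_zero, bar]

/-- The triangular decomposition in the inverse image of `K₀(8)`. -/
theorem exists_triangular {g : Mp2} (hg : g.mat ∈ K0 3) : ∃ (s t : ℚ_[2]) (u : ℚ_[2]ˣ) (ε : ℤˣ),
    ‖s‖ ≤ 1 ∧ ‖t‖ ≤ 1 / 8 ∧ ‖(u : ℚ_[2])‖ = 1 ∧ s = g.mat 0 1 / g.mat 1 1 ∧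
    t = g.mat 1 0 / g.mat 1 1 ∧
    g = cen ε * (bar (xMat s) * bar (hMat u) * bar (yMat t)) := by
  obtain ⟨-, h2, h3, -⟩ := mem_K0_iff.1 hg
  have hd := (norm_diag_of_mem hg).2
  obtain ⟨ε, hε⟩ := exists_cen_of_mat_eq (g := g) (h := triPart ⟨g, hg⟩) (triPart_mat ⟨g, hg⟩).symm
  refine ⟨_, _, (lowerRight ⟨g, hg⟩)⁻¹, ε, ?_, ?_, ?_, rfl, rfl, hε⟩
  · rw [norm_div, hd, div_one]; exact h2
  · rw [norm_div, hd, div_one]; exact h3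
  · have : ((lowerRight ⟨g, hg⟩ : ℚ_[2]ˣ) : ℚ_[2]) = g.mat 1 1 := rfl
    rw [Units.val_inv_eq_inv_val, norm_inv, this, hd, inv_one]

theorem chiExt_triangular {s t : ℚ_[2]} {u : ℚ_[2]ˣ} (ε : ℤˣ) (hs : ‖s‖ ≤ 1) (ht : ‖t‖ ≤ 1 / 8)
    (hu : ‖(u : ℚ_[2])‖ = 1) :
    chiExt ξ hξ (cen ε * (bar (xMat s) * bar (hMat u) * bar (yMat t))) =
      ((ε : ℤ) : ℂ) * torusChar ξ u := by
  rw [chiExt_mul _ _ (cen_mem ε) (mul_mem (mul_mem (xMat_mem hs) (hMat_mem hu)) (yMat_mem ht)),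
    chiExt_mul _ _ (mul_mem (xMat_mem hs) (hMat_mem hu)) (yMat_mem ht),
    chiExt_mul _ _ (xMat_mem hs) (hMat_mem hu), chiExt_cen, chiExt_xMat _ _ hs,
    chiExt_yMat _ _ ht, chiExt_hMat _ _ hu, one_mul, mul_one]

theorem chiExt_mul_conj {g : Mp2} (hg : g.mat ∈ K0 3) :
    chiExt ξ hξ g * conj (chiExt ξ hξ g) = 1 := by
  have hd := norm_diag_of_mem hg
  have h0 : g.mat 1 1 ≠ 0 := by intro h; rw [h] at hd; simp at hd
  rw [chiExt_eq ξ hξ hg (d := Units.mk0 _ h0) rfl, torusChar_eq_norm, Complex.mul_conj,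
    Complex.normSq_eq_norm_sq]
  have hx := norm_xi hξ
  rw [norm_mul]
  rcases Int.units_eq_one_or (g.sgn * sfun g.mat * sgnZ (rho g.mat)) with e | e <;> rw [e] <;>
  split_ifs <;> simp [hx]

theorem chiExt_ne_zero {g : Mp2} (hg : g.mat ∈ K0 3) : chiExt ξ hξ g ≠ 0 :=
  left_ne_zero_of_mul (chiExt_mul_conj ξ hξ hg ▸ one_ne_zero)

end Chi

/-! ### The symbol `(2, 5)` -/

/-- Descent modulo `8`: there is no solution for `n = 0`, and a solution for `n + 1` has `x` and `y`
even, so that halving both gives one for `n`. The factor `4 ^ n` allows for the denominators of a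
solution in `ℚ₂`. -/
theorem norm_form_five (n : ℕ) : ∀ x y : ℤ_[2], 2 * 4 ^ n ≠ x ^ 2 - 5 * y ^ 2 := by
  have hc : ∀ m : ℕ, PadicInt.toZModPow (p := 2) 3 ((m : ℕ) : ℤ_[2]) = (m : ZMod (2 ^ 3)) :=
    fun m => map_natCast _ m
  have h2 : PadicInt.toZModPow (p := 2) 3 2 = 2 := by simpa using hc 2
  have h4 : PadicInt.toZModPow (p := 2) 3 4 = 4 := by simpa using hc 4
  have h5 : PadicInt.toZModPow (p := 2) 3 5 = 5 := by simpa using hc 5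
  have ev : ∀ z : ℤ_[2], (∃ r : ZMod (2 ^ 3), PadicInt.toZModPow 3 z = 2 * r) →
      ∃ z', z = 2 * z' := by
    rintro z ⟨r, hr⟩
    obtain ⟨r', rfl⟩ : ∃ r' : ℕ, r = (r' : ZMod (2 ^ 3)) := ⟨r.val, by simp⟩
    obtain ⟨w, hw⟩ := eight_dvd_of_toZModPow (x := z) (y := 2 * (r' : ℤ_[2]))
      (by rw [hr, map_mul, h2, hc])
    exact ⟨r' + 4 * w, by rw [hw]; ring⟩
  induction n with
  | zero =>
    intro x y h
    have h' := congrArg (PadicInt.toZModPow 3) h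
    simp only [pow_zero, mul_one, map_sub, map_mul, map_pow, h2, h5] at h'
    have : ∀ a b : ZMod (2 ^ 3), 2 ≠ a ^ 2 - 5 * b ^ 2 := by decide
    exact this _ _ h'
  | succ n ih =>
    intro x y h
    have h' := congrArg (PadicInt.toZModPow 3) h
    simp only [pow_succ, map_sub, map_mul, map_pow, h2, h4, h5] at h'
    have h0 : ∀ q : ZMod (2 ^ 3), 2 * (q * 4) = 0 := by decide
    rw [h0] at h'
    have : ∀ a b : ZMod (2 ^ 3), 0 = 1 * a * a - 5 * (1 * b * b) →
        (∃ r, a = 2 * r) ∧ ∃ r, b = 2 * r := by decide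
    obtain ⟨hx, hy⟩ := this _ _ (by simpa using h')
    obtain ⟨x', rfl⟩ := ev x hx
    obtain ⟨y', rfl⟩ := ev y hy
    refine ih x' y' (mul_left_cancel₀ (show (4 : ℤ_[2]) ≠ 0 by norm_num) ?_)
    linear_combination h

/-- The extension `ℚ₂(√5)` is unramified, so `2`, having odd valuation, is not a norm from it. Here
a representation of `2` by the norm form is multiplied by a common denominator and excluded by
`norm_form_five`. -/
theorem hilbertSym_two_five : hilbertSym (2 : ℚ_[2]) 5 = -1 := by
  refine (Int.units_eq_one_or _).resolve_left fun h => ?_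
  obtain ⟨u, v, huv⟩ := (hilbertSym_eq_one_iff (by norm_num)).1 h
  obtain ⟨n1, hn1⟩ := exists_pow_mul u
  obtain ⟨n2, hn2⟩ := exists_pow_mul v
  obtain ⟨x, hx⟩ := hn1 (max n1 n2) (le_max_left _ _)
  obtain ⟨y, hy⟩ := hn2 (max n1 n2) (le_max_right _ _)
  refine norm_form_five (max n1 n2) x y (Subtype.ext ?_)
  push_cast
  rw [← hx, ← hy, show ((4 : ℤ_[2]) : ℚ_[2]) = 2 ^ 2 by norm_num; rfl,
    show ((5 : ℤ_[2]) : ℚ_[2]) = 5 from rfl, show ((2 : ℤ_[2]) : ℚ_[2]) = 2 from rfl]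
  rw [← pow_mul, mul_comm 2 (max n1 n2), pow_mul]
  linear_combination ((2 : ℚ_[2]) ^ max n1 n2) ^ 2 * huv

/-! ### Conjugation and `χ₁` -/

section Conj

variable (ξ : ℂ) (hξ : ξ ^ 2 = -1)

/-- Conjugation by `w(t)` exchanges the two unipotent groups, on whose parts in `S` the character is
trivial, and inverts the torus, where `torusChar` takes the same value at `u` and `u⁻¹`. -/
theorem chiExt_conj_wMat {t : ℚ_[2]ˣ} {k k' : Mp2} (hk : k.mat ∈ K0 3) (hk' : k'.mat ∈ K0 3)
    (h : k * bar (wMat t) = bar (wMat t) * k') : chiExt ξ hξ k = chiExt ξ hξ k' := by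
  obtain ⟨s, r, u, ε, hs, hr, hu, es, er, e⟩ := exists_triangular hk
  have hd := (norm_diag_of_mem hk).2
  have hm : k.mat * wMat t = wMat t * k'.mat := congrArg Mp2.mat h
  have t0 := t.ne_zero
  have e01 : k.mat 0 1 = -((t : ℚ_[2]) ^ 2 * k'.mat 1 0) := by
    have := congrArg (fun A : SL2 => A 0 0) hm
    simp [mul_00] at this
    field_simp at this
    linear_combination -this
  have e10 : k.mat 1 0 * t ^ 2 = -k'.mat 0 1 := by
    have := congrArg (fun A : SL2 => A 1 1) hm
    simp [mul_11] at this
    field_simp at this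
    linear_combination this
  obtain ⟨-, b1, b2, -⟩ := mem_K0_iff.1 hk'
  -- Up to sign and a unit, the parameters of the conjugated unipotent factors are entries of `k'`;
  -- this is why they lie in `S` for every `t`.
  have n1 : ‖-(s / (t : ℚ_[2]) ^ 2)‖ ≤ 1 / 8 := by
    have : s / (t : ℚ_[2]) ^ 2 = -k'.mat 1 0 / k.mat 1 1 := by
      rw [es, e01]; field_simp
    rw [norm_neg, this, norm_div, norm_neg, hd, div_one]; exact b2
  have n2 : ‖-(r * (t : ℚ_[2]) ^ 2)‖ ≤ 1 := by
    rw [er, div_mul_eq_mul_div, e10, norm_neg, norm_div, norm_neg, hd, div_one]; exact b1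
  have hu' : ‖((u⁻¹ : ℚ_[2]ˣ) : ℚ_[2])‖ = 1 := by
    rw [Units.val_inv_eq_inv_val, norm_inv, hu, inv_one]
  have ek : k' = cen ε * (bar (yMat (-(s / (t : ℚ_[2]) ^ 2))) * bar (hMat u⁻¹) *
      bar (xMat (-(r * (t : ℚ_[2]) ^ 2)))) := by
    have h1 := bar_xMat_mul_wMat s t
    have h2 := bar_hMat_mul_wMat u t
    have h3 := bar_yMat_mul_wMat r t
    apply mul_left_cancel (a := bar (wMat t))
    rw [← h, e, ← mul_assoc (bar (wMat t)), cen_comm]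
    simp only [mul_assoc]
    rw [h3, ← mul_assoc (bar (hMat u)), h2, ← mul_assoc (bar (xMat s)), ← mul_assoc (bar (xMat s)),
      h1]
    simp only [mul_assoc]
  rw [e, chiExt_triangular ξ hξ ε hs hr hu, ek,
    chiExt_mul _ _ (cen_mem ε) (mul_mem (mul_mem (yMat_mem n1) (hMat_mem hu')) (xMat_mem n2)),
    chiExt_mul _ _ (mul_mem (yMat_mem n1) (hMat_mem hu')) (xMat_mem n2),
    chiExt_mul _ _ (yMat_mem n1) (hMat_mem hu'), chiExt_cen, chiExt_xMat _ _ n2,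
    chiExt_yMat _ _ n1, chiExt_hMat _ _ hu', one_mul, mul_one, torusChar_inv ξ hu]

theorem sfun_of_even {g : SL2} (h : ¬ Odd (g 1 0).valuation) : sfun g = 1 := by
  unfold sfun; rw [if_neg (fun h' => h h'.2)]

theorem padic_valuation_neg (x : ℚ_[2]) : (-x).valuation = x.valuation := by
  by_cases hx : x = 0
  · simp [hx]
  have h : (-1 : ℚ_[2]).valuation = 0 := by
    have := Padic.valuation_intCast (p := 2) (-1)
    simpa [padicValInt] using this
  rw [← neg_one_mul, Padic.valuation_mul (by norm_num) hx, h, zero_add]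

theorem valuation_neg_four : ¬ Odd (-4 : ℚ_[2]).valuation := by
  rw [padic_valuation_neg, show (4 : ℚ_[2]) = 2 ^ 2 by norm_num, Padic.valuation_pow]
  simp [parity_simps]

/-- The product has lower row `(-16s, 1 - 4s)`. Its torus character is trivial because `1 - 4s ∈ 1 +
4ℤ₂`, and the symbol `(16s, 1 - 4s)` is trivial because `16s · (1/2)² + (1 - 4s) = 1`. -/
theorem chiExt_yMat_xMat_yMat {s : ℚ_[2]} (hs : ‖s‖ ≤ 1) :
    (bar (yMat (-4)) * bar (xMat s) * bar (yMat 4)).mat ∈ K0 3 ∧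
    chiExt ξ hξ (bar (yMat (-4)) * bar (xMat s) * bar (yMat 4)) = 1 := by
  have h00 : (yMat (-4) * xMat s * yMat 4) 0 0 = 1 + 4 * s := by
    simp [mul_00, mul_01]; ring
  have h01 : (yMat (-4) * xMat s * yMat 4) 0 1 = s := by simp [mul_00, mul_01]
  have h10 : (yMat (-4) * xMat s * yMat 4) 1 0 = -(16 * s) := by
    simp [mul_10, mul_11]; ring
  have h11 : (yMat (-4) * xMat s * yMat 4) 1 1 = 1 - 4 * s := by
    simp [mul_10, mul_11]; ring
  have n16 : ‖(16 : ℚ_[2])‖ = 16⁻¹ := by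
    rw [show (16 : ℚ_[2]) = 2 ^ 4 by norm_num, norm_pow, norm_two]; norm_num
  have n4s : ‖4 * s‖ ≤ 1 / 4 := by rw [norm_mul, norm_four]; linarith
  have hmem : (bar (yMat (-4)) * bar (xMat s) * bar (yMat 4)).mat ∈ K0 3 := by
    rw [mem_K0_iff]
    simp only [mat_mul, bar_mat, h00, h01, h10, h11]
    refine ⟨norm_add_le_of_le norm_one.le (by linarith), hs, ?_,
      norm_sub_le_of_le norm_one.le (by linarith)⟩
    rw [norm_neg, norm_mul, n16]; linarith
  refine ⟨hmem, ?_⟩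
  by_cases s0 : s = 0
  · rw [s0, bar_xMat_zero, mul_one, ← bar_yMat_add, neg_add_cancel, bar_yMat_zero, chiExt_one]
  have d0 : 1 - 4 * s ≠ 0 := by
    intro h
    have : 4 * s = 1 := by linear_combination -h
    rw [this, norm_one] at n4s; norm_num at n4s
  obtain ⟨f, hf⟩ : ∃ f : ℚ_[2]ˣ, (f : ℚ_[2]) = 4 := ⟨Units.mk0 4 (by norm_num), rfl⟩
  have t1 : tauU (yMat (-4)) = -f := tauU_of_ne (by simp [hf])
  have t2 : tauU (xMat s) = 1 := tauU_of_eq (by simp) (by simp)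
  have t3 : tauU (yMat (-4) * xMat s) = -f := tauU_of_ne (by simp [hf, mul_10])
  have t4 : tauU (yMat 4) = f := tauU_of_ne (by simp [hf])
  have t5 : tauU (yMat (-4) * xMat s * yMat 4) = -(f * f * Units.mk0 s s0) :=
    tauU_of_ne (by rw [h10]; simp [hf]; norm_num)
  have s1 : sfun (yMat (-4) * xMat s) = 1 :=
    sfun_of_even (by simpa [mul_10] using valuation_neg_four)
  have g1 : sigma (yMat (-4)) (xMat s) = 1 := by
    rw [sigma_eq, alpha, t1, t2, t3, s1, sfun_of_d_one (g := yMat (-4)) (by simp),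
      sfun_of_d_one (g := xMat s) (by simp), mul_one, hilb_mul_left, zmod_two_add_self, sgnZ_zero]
    simp
  have g2 : sigma (yMat (-4) * xMat s) (yMat 4) = sfun (yMat (-4) * xMat s * yMat 4) := by
    rw [sigma_eq, alpha, t3, t4, t5, s1, sfun_of_d_one (g := yMat 4) (by simp), neg_mul_neg,
      neg_mul, hilb_neg_self, sgnZ_zero, one_mul, one_mul, one_mul]
  have r1 : rho (yMat (-4) * xMat s * yMat 4) = 0 := by
    unfold rho
    split_ifs with h
    · refine hilb_eq_zero (hilbertSym_eq_one_of (1 / 2) 1 1 (by norm_num) ?_)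
      push_cast
      rw [Units.val_mk0, Units.val_mk0, h10, h11]; ring
    · rfl
  rw [chiExt_eq ξ hξ hmem (d := Units.mk0 _ d0) (by simp only [mat_mul, bar_mat, h11, Units.val_mk0]),
    torusChar_eq_one ξ (by
      rw [Units.val_mk0, show 1 - 4 * s - 1 = -(4 * s) by ring, norm_neg]; exact n4s)]
  simp only [mat_mul, bar_mat, r1, sgnZ_zero]
  -- The factor `s₂` of the product enters twice, once through the cocycle and once through the
  -- formula for `χ₁`, and so cancels.
  have e2 : (bar (yMat (-4)) * bar (xMat s) * bar (yMat 4)).sgn =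
      sfun (yMat (-4) * xMat s * yMat 4) := by
    rw [← g2, bar_mul g1]
    simp [mul_def, bar]
  rw [e2, Int.units_mul_self]; simp

theorem norm_sub_one_le_half {u : ℚ_[2]} (hu : ‖u‖ = 1) : ‖u - 1‖ ≤ 1 / 2 := by
  rcases even_or_odd_of_norm_le hu.le with h | h
  · rw [hu] at h; norm_num at h
  · exact h

theorem norm_one_sub_sq_le {u : ℚ_[2]} (hu : ‖u‖ = 1) : ‖1 - u ^ 2‖ ≤ 1 / 4 := by
  have h1 := norm_sub_one_le_half hu
  have h2 : ‖u + 1‖ ≤ 1 / 2 := by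
    rw [show u + 1 = u - 1 + 2 by ring]
    exact norm_add_le_of_le h1 (by rw [norm_two]; norm_num)
  rw [show 1 - u ^ 2 = -((u - 1) * (u + 1)) by ring, norm_neg, norm_mul]
  nlinarith [norm_nonneg (u - 1), norm_nonneg (u + 1)]

/-- By the triangular decomposition three conjugations suffice. That of `x(s)` is
`chiExt_yMat_xMat_yMat`, `y(r)` commutes with `y(4)`, and `h(u)` becomes `h(u) y(4(1 - u²))`, where
`1 - u² ∈ 4ℤ₂` because `u` is odd. -/
theorem bar_yMat_four_conj {k : Mp2} (hk : k.mat ∈ K0 3) :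
    (bar (yMat (-4)) * k * bar (yMat 4)).mat ∈ K0 3 ∧
    chiExt ξ hξ (bar (yMat (-4)) * k * bar (yMat 4)) = chiExt ξ hξ k := by
  obtain ⟨s, r, u, ε, hs, hr, hu, es, er, e⟩ := exists_triangular hk
  obtain ⟨m1, c1⟩ := chiExt_yMat_xMat_yMat ξ hξ hs
  have n1 : ‖4 * (1 - (u : ℚ_[2]) ^ 2)‖ ≤ 1 / 8 := by
    rw [norm_mul, norm_four]
    have := norm_one_sub_sq_le hu
    linarith
  have eh : bar (yMat (-4)) * bar (hMat u) * bar (yMat 4) =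
      bar (hMat u) * bar (yMat (4 * (1 - (u : ℚ_[2]) ^ 2))) := by
    rw [bar_yMat_mul_hMat, mul_assoc, ← bar_yMat_add]; congr 3; ring
  have ey : bar (yMat (-4)) * bar (yMat r) * bar (yMat 4) = bar (yMat r) := by
    rw [← bar_yMat_add, ← bar_yMat_add]; congr 2; ring
  have ek : bar (yMat (-4)) * k * bar (yMat 4) =
      cen ε * ((bar (yMat (-4)) * bar (xMat s) * bar (yMat 4)) *
        (bar (hMat u) * bar (yMat (4 * (1 - (u : ℚ_[2]) ^ 2)))) * bar (yMat r)) := by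
    rw [← eh, ← ey, e, bar_yMat_neg 4, ← mul_assoc _ (cen ε), cen_comm]
    group
  have m2 := mul_mem (hMat_mem hu) (yMat_mem n1)
  rw [ek]
  refine ⟨mul_mem (cen_mem ε) (mul_mem (mul_mem m1 m2) (yMat_mem hr)), ?_⟩
  rw [chiExt_mul _ _ (cen_mem ε) (mul_mem (mul_mem m1 m2) (yMat_mem hr)),
    chiExt_mul _ _ (mul_mem m1 m2) (yMat_mem hr), chiExt_mul _ _ m1 m2, c1,
    chiExt_mul _ _ (hMat_mem hu) (yMat_mem n1), chiExt_yMat _ _ n1, chiExt_yMat _ _ hr,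
    chiExt_hMat _ _ hu, chiExt_cen, e, chiExt_triangular ξ hξ ε hs hr hu]
  ring

theorem hilbertSym_mul_sq {a b t : ℚ_[2]} (ha : a ≠ 0) (hb : b ≠ 0) (ht : t ≠ 0) :
    hilbertSym (a * t ^ 2) b = hilbertSym a b := by
  rw [hilbertSym_mul_left ha (pow_ne_zero 2 ht) hb, pow_two, hilbertSym_mul_left ht ht hb,
    Int.units_mul_self, mul_one]

theorem hilbertSym_neg_eight_five : hilbertSym (-8 : ℚ_[2]) 5 = -1 := by
  have h1 : hilbertSym (-1 : ℚ_[2]) 5 = 1 :=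
    hilbertSym_eq_one_of 1 1 2 one_ne_zero (by norm_num)
  rw [show (-8 : ℚ_[2]) = (-1 * 2) * 2 ^ 2 by norm_num,
    hilbertSym_mul_sq (by norm_num) (by norm_num) (by norm_num),
    hilbertSym_mul_left (by norm_num) (by norm_num) (by norm_num), h1, hilbertSym_two_five, one_mul]

/-- The source of all vanishing statements. The product has lower row `(-8, 5)`, and three signs
equal `-1`: the sign of the product in the cover, its `s₂`, and the symbol `(8, 5)`. Each of them
comes down to `(2, 5) = -1`. -/
theorem chiExt_yMat_two_conj :
    (bar (yMat 2) * bar (xMat 2) * bar (yMat (-2))).mat ∈ K0 3 ∧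
    chiExt ξ hξ (bar (yMat 2) * bar (xMat 2) * bar (yMat (-2))) = -1 := by
  have h00 : (yMat 2 * xMat 2 * yMat (-2)) 0 0 = -3 := by
    simp [mul_00, mul_01]; norm_num
  have h01 : (yMat 2 * xMat 2 * yMat (-2)) 0 1 = 2 := by simp [mul_00, mul_01]
  have h10 : (yMat 2 * xMat 2 * yMat (-2)) 1 0 = -8 := by
    simp [mul_10, mul_11]; norm_num
  have h11 : (yMat 2 * xMat 2 * yMat (-2)) 1 1 = 5 := by
    simp [mul_10, mul_11]; norm_num
  have hmem : (bar (yMat 2) * bar (xMat 2) * bar (yMat (-2))).mat ∈ K0 3 := by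
    rw [mem_K0_iff]
    simp only [mat_mul, bar_mat, h00, h01, h10, h11]
    refine ⟨?_, ?_, ?_, ?_⟩
    · rw [show (-3 : ℚ_[2]) = 1 - 4 by norm_num]
      exact norm_sub_le_of_le norm_one.le (by rw [norm_four]; norm_num)
    · rw [norm_two]; norm_num
    · rw [norm_neg, norm_eight]; norm_num
    · rw [show (5 : ℚ_[2]) = 1 + 4 by norm_num]
      exact norm_add_le_of_le norm_one.le (by rw [norm_four]; norm_num)
  refine ⟨hmem, ?_⟩
  obtain ⟨f, hf⟩ : ∃ f : ℚ_[2]ˣ, (f : ℚ_[2]) = 2 := ⟨Units.mk0 2 (by norm_num), rfl⟩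
  obtain ⟨v, hv⟩ : ∃ f : ℚ_[2]ˣ, (f : ℚ_[2]) = 5 := ⟨Units.mk0 5 (by norm_num), rfl⟩
  have t1 : tauU (yMat 2) = f := tauU_of_ne (by simp [hf])
  have t2 : tauU (xMat 2) = 1 := tauU_of_eq (by simp) (by simp)
  have t3 : tauU (yMat 2 * xMat 2) = f := tauU_of_ne (by simp [hf, mul_10])
  have t4 : tauU (yMat (-2)) = -f := tauU_of_ne (by simp [hf])
  have t5 : tauU (yMat 2 * xMat 2 * yMat (-2)) = -(f * f * f) :=
    tauU_of_ne (by rw [h10]; simp [hf]; norm_num)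
  have v2 : (2 : ℚ_[2]).valuation = 1 := by exact_mod_cast Padic.valuation_p (p := 2)
  have s3 : sfun (yMat 2 * xMat 2) = -1 := by
    have e1 : (yMat 2 * xMat 2) 1 0 = 2 := by simp [mul_10]
    have e2 : (yMat 2 * xMat 2) 1 1 = 5 := by simp [mul_11]; norm_num
    unfold sfun
    rw [e1, e2, hilbertSym_two_five, if_pos]
    exact ⟨by norm_num, by rw [v2]; exact odd_one⟩
  have s5 : sfun (yMat 2 * xMat 2 * yMat (-2)) = -1 := by
    unfold sfun
    rw [h10, h11, hilbertSym_neg_eight_five, if_pos]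
    refine ⟨by norm_num, ?_⟩
    rw [padic_valuation_neg, show (8 : ℚ_[2]) = 2 ^ 3 by norm_num, Padic.valuation_pow, v2]
    decide
  have g1 : sigma (yMat 2) (xMat 2) = -1 := by
    rw [sigma_eq, alpha, t1, t2, t3, s3, sfun_of_d_one (g := yMat 2) (by simp),
      sfun_of_d_one (g := xMat 2) (by simp), mul_one, hilb_mul_left, zmod_two_add_self, sgnZ_zero]
    simp
  have g2 : sigma (yMat 2 * xMat 2) (yMat (-2)) = 1 := by
    rw [sigma_eq, alpha, t3, t4, t5, s3, s5, sfun_of_d_one (g := yMat (-2)) (by simp), neg_mul,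
      neg_mul_neg, hilb_comm, hilb_neg_self, sgnZ_zero]
    simp
  have r1 : sgnZ (rho (yMat 2 * xMat 2 * yMat (-2))) = -1 := by
    unfold rho
    rw [dif_pos (by rw [h10, h11]; norm_num), ← hilbertSym_eq_sgnZ]
    push_cast
    rw [Units.val_mk0, Units.val_mk0, h10, h11, show -(-8 : ℚ_[2]) = 2 * 2 ^ 2 by norm_num,
      hilbertSym_mul_sq (by norm_num) (by norm_num) (by norm_num), hilbertSym_two_five]
  have e2 : (bar (yMat 2) * bar (xMat 2) * bar (yMat (-2))).sgn = -1 := by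
    simp [mul_def, bar, g1, g2]
  rw [chiExt_eq ξ hξ hmem (d := v) (by simp only [mat_mul, bar_mat, h11, hv]),
    torusChar_eq_one ξ (by
      rw [hv, show (5 : ℚ_[2]) - 1 = 4 by norm_num, norm_four]; norm_num)]
  simp only [mat_mul, bar_mat, r1, e2, s5]
  simp

/-- For `t` odd, `χ₁` is `-1` on the conjugate of `(x(2), 1)` by `(y(2t), 1)`. -/
theorem chiExt_yMat_odd_conj {r : ℚ_[2]} (hr : ‖r‖ = 1 / 2) :
    (bar (yMat r) * bar (xMat 2) * bar (yMat (-r))).mat ∈ K0 3 ∧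
    chiExt ξ hξ (bar (yMat r) * bar (xMat 2) * bar (yMat (-r))) = -1 := by
  obtain ⟨m0, c0⟩ := chiExt_yMat_two_conj ξ hξ
  -- the case of `2 - q` with `q` in `8ℤ₂` or `4 + 8ℤ₂`
  have key : ∀ k q, ‖q‖ ≤ 1 / 8 → k.mat ∈ K0 3 → (bar (yMat q) * k * bar (yMat (-q))).mat ∈ K0 3 ∧
      chiExt ξ hξ (bar (yMat q) * k * bar (yMat (-q))) = chiExt ξ hξ k := by
    intro k q hq hk
    have hq' : ‖-q‖ ≤ 1 / 8 := by rwa [norm_neg]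
    refine ⟨mul_mem (mul_mem (yMat_mem hq) hk) (yMat_mem hq'), ?_⟩
    rw [chiExt_mul ξ hξ (mul_mem (yMat_mem hq) hk) (yMat_mem hq'), chiExt_mul ξ hξ (yMat_mem hq) hk,
      chiExt_yMat _ _ hq, chiExt_yMat _ _ hq', one_mul, mul_one]
  have h2 : ‖r - 2‖ ≤ ‖(2 : ℚ_[2])‖ / 2 := by
    rcases even_or_odd_scaled (s := r) (c := 2) (by norm_num) (by rw [hr, norm_two]; norm_num)
      with h | h
    · rw [hr, norm_two] at h; norm_num at h
    · exact h
  have h3 : ‖r - 2‖ ≤ ‖(-4 : ℚ_[2])‖ := by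
    rw [norm_neg, norm_four]; rw [norm_two] at h2; linarith
  -- Now `r` is `2` or `2 - 4` modulo `8`. A remainder in `8ℤ₂` only conjugates by an element of `S`
  -- with `χ₁ = 1`; the summand `-4` is harmless because conjugation by `y(-4)` preserves `χ₁`.
  rcases even_or_odd_scaled (by norm_num) h3 with h | h
  · obtain ⟨m1, c1⟩ := key _ (r - 2) (by rw [norm_neg, norm_four] at h; linarith) m0
    have e : bar (yMat r) * bar (xMat 2) * bar (yMat (-r)) = bar (yMat (r - 2)) *
        (bar (yMat 2) * bar (xMat 2) * bar (yMat (-2))) * bar (yMat (-(r - 2))) := by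
      rw [show r = (r - 2) + 2 by ring, bar_yMat_add, neg_add_rev, bar_yMat_add, add_sub_cancel_right]
      simp only [mul_assoc]
    rw [e]
    exact ⟨m1, c1.trans c0⟩
  · obtain ⟨m1, c1⟩ := bar_yMat_four_conj ξ hξ m0
    obtain ⟨m2, c2⟩ := key _ (r - 2 - -4) (by rw [norm_neg, norm_four] at h; linarith) m1
    have e : bar (yMat r) * bar (xMat 2) * bar (yMat (-r)) = bar (yMat (r - 2 - -4)) *
        (bar (yMat (-4)) * (bar (yMat 2) * bar (xMat 2) * bar (yMat (-2))) * bar (yMat 4)) *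
          bar (yMat (-(r - 2 - -4))) := by
      have e1 : bar (yMat r) = bar (yMat (r - 2 - -4)) * (bar (yMat (-4)) * bar (yMat 2)) := by
        rw [← bar_yMat_add, ← bar_yMat_add]; congr 2; ring
      have e2 : bar (yMat (-r)) = bar (yMat (-2)) * (bar (yMat 4) * bar (yMat (-(r - 2 - -4)))) := by
        rw [← bar_yMat_add, ← bar_yMat_add]; congr 2; ring
      rw [e1, e2]
      simp only [mul_assoc]
    rw [e]
    exact ⟨m2, (c2.trans c1).trans c0⟩

end Conj

/-! ### A congruence subgroup over which the cover splits -/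

theorem continuous_entry (i j : Fin 2) : Continuous fun A : SL2 => A i j :=
  (continuous_subtype_val (p := fun A : Matrix (Fin 2) (Fin 2) ℚ_[2] => A.det = 1)).matrix_elem i j

/-- `K₁(8)` -/
def K1 : Set SL2 := {A | A ∈ K0 3 ∧ ‖A 1 1 - 1‖ ≤ 1 / 8}

theorem inv_mul_mem_K1 {A B : SL2} (hA : A ∈ K1) (hB : B ∈ K1) : A⁻¹ * B ∈ K1 := by
  refine ⟨mul_mem (inv_mem hA.1) hB.1, ?_⟩
  obtain ⟨a1, a2, a3, a4⟩ := mem_K0_iff.1 hA.1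
  obtain ⟨b1, b2, b3, b4⟩ := mem_K0_iff.1 hB.1
  have hd := det_eq A
  have hA00 : ‖A 0 0 - 1‖ ≤ 1 / 8 := by
    have e : A 0 0 - 1 = -(A 0 0 * (A 1 1 - 1)) + A 0 1 * A 1 0 := by linear_combination hd
    rw [e]
    refine norm_add_le_of_le ?_ ?_
    · rw [norm_neg, norm_mul]
      nlinarith [hA.2, norm_nonneg (A 0 0), norm_nonneg (A 1 1 - 1)]
    · rw [norm_mul]
      nlinarith [norm_nonneg (A 0 1), norm_nonneg (A 1 0)]
  rw [mul_11, inv_10, inv_11, show -A 1 0 * B 0 1 + A 0 0 * B 1 1 - 1 =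
    -(A 1 0 * B 0 1) + (A 0 0 * (B 1 1 - 1) + (A 0 0 - 1)) by ring]
  refine norm_add_le_of_le ?_ (norm_add_le_of_le ?_ hA00)
  · rw [norm_neg, norm_mul]
    nlinarith [norm_nonneg (A 1 0), norm_nonneg (B 0 1)]
  · rw [norm_mul]
    nlinarith [hB.2, norm_nonneg (A 0 0), norm_nonneg (B 1 1 - 1)]

theorem one_mem_K1 : (1 : SL2) ∈ K1 := ⟨one_mem _, by simp⟩

theorem exists_sq_of_norm {d : ℚ_[2]} (hd : ‖d - 1‖ ≤ 1 / 8) : ∃ t : ℚ_[2], t ≠ 0 ∧ d = t ^ 2 := by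
  obtain ⟨t, ht⟩ := exists_sq_of_sub_one ⟨(d - 1) / 8, by
    rw [norm_div, norm_eight, div_inv_eq_mul]; linarith⟩
  have e : d = (t : ℚ_[2]) ^ 2 := by
    have := congrArg (fun z : ℤ_[2] => (z : ℚ_[2])) ht
    push_cast at this
    rw [this]
    change d = 1 + 8 * ((d - 1) / 8)
    ring
  refine ⟨t, ?_, e⟩
  rintro h
  rw [e, h] at hd
  norm_num at hd

theorem hilbertSym_sq_right (a : ℚ_[2]) (t : ℚ_[2]) : hilbertSym a (t ^ 2) = 1 := by
  rw [hilbertSym_comm]; exact hilbertSym_eq_one_of 1 0 t one_ne_zero (by ring)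

section

variable (ξ : ℂ) (hξ : ξ ^ 2 = -1)

/-- Here `d ∈ 1 + 8ℤ₂` is a square, so every Hilbert symbol with entry `d` is trivial. -/
theorem chiExt_bar_of_mem_K1 {A : SL2} (hA : A ∈ K1) : chiExt ξ hξ (bar A) = 1 := by
  obtain ⟨t, ht, e⟩ := exists_sq_of_norm hA.2
  have h1 : sfun A = 1 := by
    unfold sfun
    rw [e, hilbertSym_sq_right _ t]; simp
  have h2 : rho A = 0 := by
    unfold rho
    split_ifs with h
    · refine hilb_eq_zero ?_
      rw [Units.val_mk0, e, hilbertSym_sq_right _ t]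
    · rfl
  have h0 : A 1 1 ≠ 0 := by rw [e]; exact pow_ne_zero 2 ht
  rw [chiExt_eq ξ hξ (g := bar A) hA.1 (d := Units.mk0 _ h0) rfl, torusChar_eq_one ξ (by
    rw [Units.val_mk0]; exact hA.2.trans (by norm_num))]
  simp [h1, h2, sgnZ_zero, bar]

end

/-- The two sides differ by a central sign, and the character `χ₁`, taken for `ξ = i`, detects that
sign: it is `1` on `bar` of all three matrices and equals `ε` at `(I, ε)`. -/
theorem bar_mul_of_mem_K1 {A B : SL2} (hA : A ∈ K1) (hB : B ∈ K1) (hAB : A * B ∈ K1) :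
    bar A * bar B = bar (A * B) := by
  have hI : Complex.I ^ 2 = -1 := Complex.I_sq
  obtain ⟨ε, hε⟩ := exists_cen_of_mat_eq (g := bar A * bar B) (h := bar (A * B)) rfl
  have h := congrArg (chiExt _ hI) hε
  rw [chiExt_mul _ _ (g := bar A) (h := bar B) hA.1 hB.1,
    chiExt_mul _ _ (cen_mem ε) (h := bar (A * B)) hAB.1, chiExt_bar_of_mem_K1 _ _ hA,
    chiExt_bar_of_mem_K1 _ _ hB, chiExt_bar_of_mem_K1 _ _ hAB, chiExt_cen] at h
  rcases Int.units_eq_one_or ε with rfl | rfl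
  · rw [hε, cen_mul, one_mul]
  · norm_num at h

/-! ### Topology of the double cover -/

theorem isOpen_K1 : IsOpen K1 := by
  have h : K1 = ({A : SL2 | A 0 0 ∈ Metric.closedBall 0 1} ∩ {A | A 0 1 ∈ Metric.closedBall 0 1}) ∩
      ({A | A 1 0 ∈ Metric.closedBall 0 (1 / 8)} ∩ {A | A 1 1 ∈ Metric.closedBall 1 (1 / 8)}) := by
    ext A
    simp only [K1, mem_K0_iff, Set.mem_inter_iff, Set.mem_ofPred_eq, Metric.mem_closedBall,
      dist_eq_norm, sub_zero]
    constructor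
    · rintro ⟨⟨h1, h2, h3, -⟩, h5⟩
      exact ⟨⟨h1, h2⟩, h3, h5⟩
    · rintro ⟨⟨h1, h2⟩, h3, h5⟩
      refine ⟨⟨h1, h2, h3, ?_⟩, h5⟩
      have := norm_add_le_of_le (r := 1) (h5.trans (by norm_num)) norm_one.le
      simpa using this
  rw [h]
  refine IsOpen.inter (IsOpen.inter ?_ ?_) (IsOpen.inter ?_ ?_) <;>
  exact (IsUltrametricDist.isOpen_closedBall _ (by norm_num)).preimage (continuous_entry _ _)

theorem isCompact_K1 : IsCompact K1 := by
  have hcl : Topology.IsClosedEmbedding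
      (Subtype.val : SL2 → Matrix (Fin 2) (Fin 2) ℚ_[2]) :=
    IsClosed.isClosedEmbedding_subtypeVal (isClosed_eq (by fun_prop) continuous_const)
  have hc : IsCompact (X := Matrix (Fin 2) (Fin 2) ℚ_[2]) (Set.univ.pi fun _ : Fin 2 =>
      Set.univ.pi fun _ : Fin 2 => Metric.closedBall (0 : ℚ_[2]) 1) :=
    isCompact_univ_pi fun _ => isCompact_univ_pi fun _ => isCompact_closedBall 0 1
  refine (hcl.isCompact_preimage hc).of_isClosed_subset ?_ ?_
  · have h : K1 = ({A : SL2 | A 0 0 ∈ Metric.closedBall 0 1} ∩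
        {A | A 0 1 ∈ Metric.closedBall 0 1}) ∩
        (({A | A 1 0 ∈ Metric.closedBall 0 (1 / 8)} ∩ {A | A 1 1 ∈ Metric.closedBall 0 1}) ∩
          {A | A 1 1 ∈ Metric.closedBall 1 (1 / 8)}) := by
      ext A
      simp only [K1, mem_K0_iff, Set.mem_inter_iff, Set.mem_ofPred_eq, Metric.mem_closedBall,
        dist_eq_norm, sub_zero]
      tauto
    rw [h]
    refine IsClosed.inter (IsClosed.inter ?_ ?_) (IsClosed.inter (IsClosed.inter ?_ ?_) ?_) <;>
    exact Metric.isClosed_closedBall.preimage (continuous_entry _ _)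
  · intro A hA
    obtain ⟨h1, h2, h3, h4⟩ := mem_K0_iff.1 hA.1
    intro i _ j _
    rw [mem_closedBall_zero_iff]
    fin_cases i <;> fin_cases j
    · exact h1
    · exact h2
    · exact h3.trans (by norm_num)
    · exact h4

theorem isOpen_iff {U : Set Mp2} :
    IsOpen U ↔ ∀ g ∈ U, ∀ᶠ k in nhds (1 : SL2), g * bar k ∈ U := Iff.rfl

theorem continuous_mul_left_Mp2 (g : Mp2) : Continuous (g * ·) := by
  refine ⟨fun U hU => isOpen_iff.2 fun x hx => ?_⟩
  refine (isOpen_iff.1 hU _ hx).mono fun k hk => ?_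
  rw [mul_assoc] at hk
  exact hk

/-- Left translation as a homeomorphism. -/
noncomputable def leftHomeo (g : Mp2) : Mp2 ≃ₜ Mp2 where
  toEquiv := Equiv.mulLeft g
  continuous_toFun := continuous_mul_left_Mp2 g
  continuous_invFun := continuous_mul_left_Mp2 g⁻¹

theorem isOpen_of_mul_mem {U : Set Mp2} (h : ∀ g ∈ U, ∀ k : Mp2, k.mat ∈ K0 3 → g * k ∈ U) :
    IsOpen U :=
  isOpen_iff.2 fun g hg => Filter.mem_of_superset (isOpen_K1.mem_nhds one_mem_K1) fun k hk =>
    h g hg (bar k) hk.1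

/-- The topology is defined by translating the section near `1`. The section is multiplicative on
`K1`, so its continuity at `A` reduces to that at `1`. -/
theorem continuousOn_bar_K1 : ContinuousOn bar K1 := by
  intro A hA
  rw [ContinuousWithinAt, tendsto_nhds]
  intro U hU hAU
  have h1 := isOpen_iff.1 hU _ hAU
  have h2 : Filter.Tendsto (fun B : SL2 => A⁻¹ * B) (nhds A) (nhds 1) := by
    have : Continuous fun B : SL2 => A⁻¹ * B := continuous_const.mul continuous_id
    simpa using this.tendsto A
  filter_upwards [mem_nhdsWithin_of_mem_nhds (h2.eventually h1), self_mem_nhdsWithin] with B hB hB1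
  rw [bar_mul_of_mem_K1 hA (inv_mul_mem_K1 hA hB1) (by simpa using hB1)] at hB
  simpa using hB

/-- The group is covered by eight translates of the compact set `bar '' K1`, one for each sign and
each class of `d` modulo `8`: if `d = u(1 + 8w)` with `u ∈ {1, 3, 5, 7}`, then multiplication by
`h(u)` moves the matrix into `K1`. -/
theorem isCompact_K0bar : IsCompact (K0bar 3 : Set Mp2) := by
  have h1 : IsCompact (bar '' K1) := isCompact_K1.image_of_continuousOn continuousOn_bar_K1
  have hne : ∀ i : Fin 4, (2 * (i : ℕ) + 1 : ℚ_[2]) ≠ 0 := fun i => by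
    exact_mod_cast (Nat.succ_ne_zero (2 * (i : ℕ)))
  have h2 : IsCompact (⋃ p : ℤˣ × Fin 4,
      ((cen p.1 * bar (hMat (Units.mk0 _ (hne p.2))⁻¹)) * ·) '' (bar '' K1)) :=
    isCompact_iUnion fun p => h1.image (continuous_mul_left_Mp2 _)
  refine h2.of_isClosed_subset ?_ ?_
  · rw [← isOpen_compl_iff]
    refine isOpen_of_mul_mem fun g hg k hk hgk => hg ?_
    exact ((K0bar 3).mul_mem_cancel_right (show k ∈ K0bar 3 from hk)).1 hgk
  · intro g hg
    obtain ⟨v, hv⟩ := exists_unit_lowerRight (A := g.mat) hg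
    obtain ⟨r, hr, w, hw⟩ := exists_odd_rep v
    obtain ⟨i, rfl⟩ : ∃ i : Fin 4, r = 2 * i + 1 := by
      simp only [List.mem_cons, List.not_mem_nil, or_false] at hr
      rcases hr with rfl | rfl | rfl | rfl
      exacts [⟨0, rfl⟩, ⟨1, rfl⟩, ⟨2, rfl⟩, ⟨3, rfl⟩]
    set u : ℚ_[2]ˣ := Units.mk0 _ (hne i) with hu
    have hd : g.mat 1 1 = u * (1 + 8 * (w : ℚ_[2])) := by
      rw [hv, hw]; push_cast; rfl
    have hw8 : ‖8 * (w : ℚ_[2])‖ ≤ 1 / 8 := by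
      rw [norm_mul, norm_eight]; have := w.2; linarith
    have hun : ‖(u : ℚ_[2])‖ = 1 := by
      have h := (norm_diag_of_mem (A := g.mat) hg).2
      have h' : ‖1 + 8 * (w : ℚ_[2])‖ = 1 := by
        rw [Padic.add_eq_max_of_ne (by rw [norm_one]; intro h; rw [← h] at hw8; norm_num at hw8),
          norm_one]
        exact max_eq_left (hw8.trans (by norm_num))
      rwa [hd, norm_mul, h', mul_one] at h
    have hB : hMat u * g.mat ∈ K1 := by
      refine ⟨mul_mem (hMat_mem hun) hg, ?_⟩
      rw [mul_11, hMat_10, hMat_11, hd, zero_mul, zero_add, inv_mul_cancel_left₀ u.ne_zero,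
        add_sub_cancel_left]
      exact hw8
    have hm : hMat u⁻¹ * hMat u = 1 := by
      apply SL2_ext <;> simp [mul_00, mul_01, mul_10, mul_11]
    obtain ⟨ε, hε⟩ := exists_cen_of_mat_eq (g := g) (h := bar (hMat u⁻¹) * bar (hMat u * g.mat)) (by
      simp only [mat_mul, bar_mat]; rw [← mul_assoc, hm, one_mul])
    refine Set.mem_iUnion.2 ⟨(ε, i), bar (hMat u * g.mat), ⟨_, hB, rfl⟩, ?_⟩
    change (cen ε * bar (hMat u⁻¹)) * bar (hMat u * g.mat) = g
    rw [mul_assoc]; exact hε.symm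

theorem isOpen_coset (i : Mp2) : IsOpen {g : Mp2 | (i⁻¹ * g).mat ∈ K0 3} :=
  isOpen_of_mul_mem fun g hg k hk => by
    change (i⁻¹ * (g * k)).mat ∈ K0 3
    rw [← mul_assoc]; exact mul_mem hg hk

theorem isClosed_coset (i : Mp2) : IsClosed {g : Mp2 | (i⁻¹ * g).mat ∈ K0 3} := by
  rw [← isOpen_compl_iff]
  refine isOpen_of_mul_mem fun g hg k hk hgk => hg ?_
  change (i⁻¹ * (g * k)).mat ∈ K0 3 at hgk
  rw [← mul_assoc] at hgk
  exact ((K0 3).mul_mem_cancel_right hk).1 hgk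

theorem isCompact_coset (i : Mp2) : IsCompact {g : Mp2 | (i⁻¹ * g).mat ∈ K0 3} :=
  (leftHomeo i⁻¹).isClosedEmbedding.isCompact_preimage isCompact_K0bar

/-- The topological conditions become combinatorial. As `S` is open and compact, compact support
means support in finitely many left cosets, and local constancy follows from right equivariance
because `χ₁` is trivial on the section over `K1`. -/
theorem mem_heckeSpace_iff (ξ : ℂ) (hξ : ξ ^ 2 = -1) {f : Mp2 → ℂ} :
    f ∈ heckeSpace (K0bar 3) (chi1 ξ hξ) ↔
      (∀ k g : Mp2, k.mat ∈ K0 3 → f (k * g) = conj (chiExt ξ hξ k) * f g) ∧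
      (∀ g k : Mp2, k.mat ∈ K0 3 → f (g * k) = conj (chiExt ξ hξ k) * f g) ∧
      ∃ s : Finset Mp2, ∀ g, f g ≠ 0 → ∃ i ∈ s, (i⁻¹ * g).mat ∈ K0 3 := by
  constructor
  · rintro ⟨-, h2, h3⟩
    refine ⟨fun k g hk => ?_, fun g k hk => ?_, ?_⟩
    · have := h3 ⟨k, hk⟩ 1 g
      simpa [← chiExt_coe, chiExt_one] using this
    · have := h3 1 ⟨k, hk⟩ g
      simpa [← chiExt_coe, chiExt_one] using this
    · obtain ⟨s, hs⟩ := h2.elim_finite_subcover (fun i : Mp2 => {g | (i⁻¹ * g).mat ∈ K0 3})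
        isOpen_coset (fun g _ => Set.mem_iUnion.2 ⟨g, by
          change (g⁻¹ * g).mat ∈ K0 3; rw [inv_mul_cancel]; exact one_mem _⟩)
      refine ⟨s, fun g hg => ?_⟩
      have := hs (subset_tsupport f hg)
      simpa only [Set.mem_iUnion, exists_prop, Set.mem_ofPred_eq] using this
  · rintro ⟨h1, h2, s, hs⟩
    refine ⟨?_, ?_, ?_⟩
    · rw [IsLocallyConstant]
      refine fun V => isOpen_iff.2 fun g hg => ?_
      filter_upwards [isOpen_K1.mem_nhds one_mem_K1] with k hk
      change f (g * bar k) ∈ V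
      rw [h2 g (bar k) hk.1, chiExt_bar_of_mem_K1 ξ hξ hk, map_one, one_mul]
      exact hg
    · have hc : IsCompact (⋃ i ∈ s, {g : Mp2 | (i⁻¹ * g).mat ∈ K0 3}) :=
        s.isCompact_biUnion fun i _ => isCompact_coset i
      have hcl : IsClosed (⋃ i ∈ s, {g : Mp2 | (i⁻¹ * g).mat ∈ K0 3}) :=
        isClosed_biUnion_finset fun i _ => isClosed_coset i
      refine hc.of_isClosed_subset (isClosed_tsupport f) (closure_minimal (fun g hg => ?_) hcl)
      simpa only [Set.mem_iUnion, exists_prop, Set.mem_ofPred_eq] using hs g hg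
    · intro k k' g
      rw [h2 _ _ k'.2, h1 _ _ k.2, chiExt_coe, chiExt_coe]; ring

/-! ### Integration of functions invariant under `K₀(8)` -/

section Integral

variable (μ : Measure Mp2) [μ.IsHaarMeasure] (hμ : μ (K0bar 3 : Set Mp2) = 1)

theorem integral_mul_left_Mp2 (φ : Mp2 → ℂ) (g : Mp2) : ∫ x, φ (g * x) ∂μ = ∫ x, φ x ∂μ := by
  have h : MeasurableEmbedding fun x => g * x := (leftHomeo g).isClosedEmbedding.measurableEmbedding
  rw [← h.integral_map, map_mul_left_eq_self]

include hμ in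
theorem measure_coset (i : Mp2) : μ {g : Mp2 | (i⁻¹ * g).mat ∈ K0 3} = 1 := by
  have h : MeasurableEmbedding fun x => i⁻¹ * x :=
    (leftHomeo i⁻¹).isClosedEmbedding.measurableEmbedding
  have h2 := h.map_apply μ (K0bar 3 : Set Mp2)
  rw [map_mul_left_eq_self, hμ] at h2
  exact h2.symm

include hμ in
/-- The integral of a function invariant under right translation by `K₀(8)` is the sum over
representatives of the cosets in its support. -/
theorem integral_eq_sum {φ : Mp2 → ℂ} (hφ : ∀ g k : Mp2, k.mat ∈ K0 3 → φ (g * k) = φ g)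
    {s : Finset Mp2} (hs : ∀ i ∈ s, ∀ j ∈ s, (i⁻¹ * j).mat ∈ K0 3 → i = j)
    (hsupp : ∀ g, φ g ≠ 0 → ∃ i ∈ s, (i⁻¹ * g).mat ∈ K0 3) :
    Integrable φ μ ∧ ∫ x, φ x ∂μ = ∑ i ∈ s, φ i := by
  have hval : ∀ i g : Mp2, (i⁻¹ * g).mat ∈ K0 3 → φ g = φ i := fun i g h => by
    rw [← hφ i _ h, mul_inv_cancel_left]
  have hφ' : φ = fun g => ∑ i ∈ s, {g : Mp2 | (i⁻¹ * g).mat ∈ K0 3}.indicator (fun _ => φ i) g := by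
    funext g
    by_cases h : ∃ i ∈ s, (i⁻¹ * g).mat ∈ K0 3
    · obtain ⟨i, hi, hg⟩ := h
      rw [Finset.sum_eq_single i, Set.indicator_of_mem (by exact hg), hval i g hg]
      · intro j hj hji
        refine Set.indicator_of_notMem (fun hjg => hji ?_) _
        refine hs j hj i hi ?_
        rw [show j⁻¹ * i = (j⁻¹ * g) * (i⁻¹ * g)⁻¹ by group]
        exact mul_mem hjg (inv_mem hg)
      · exact fun h => absurd hi h
    · have h0 : φ g = 0 := by
        by_contra h0
        exact h (hsupp g h0)
      rw [h0, Finset.sum_eq_zero]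
      exact fun i hi => Set.indicator_of_notMem (s := {g : Mp2 | (i⁻¹ * g).mat ∈ K0 3})
        (fun hg => h ⟨i, hi, hg⟩) _
  have hm : ∀ i : Mp2, MeasurableSet {g : Mp2 | (i⁻¹ * g).mat ∈ K0 3} :=
    fun i => (isOpen_coset i).measurableSet
  have hint : ∀ i ∈ s, Integrable ({g : Mp2 | (i⁻¹ * g).mat ∈ K0 3}.indicator fun _ => φ i) μ := by
    intro i _
    rw [integrable_indicator_iff (hm i)]
    exact integrableOn_const (by rw [measure_coset μ hμ]; exact ENNReal.one_ne_top)
  refine ⟨by rw [hφ']; exact integrable_finsetSum s hint, ?_⟩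
  conv_lhs => rw [hφ']
  rw [integral_finsetSum s hint]
  refine Finset.sum_congr rfl fun i _ => ?_
  rw [integral_indicator (hm i), setIntegral_const, measureReal_def, measure_coset μ hμ]
  simp

theorem exists_disjoint_cosets (s : Finset Mp2) : ∃ s' : Finset Mp2,
    (∀ i ∈ s', ∀ j ∈ s', (i⁻¹ * j).mat ∈ K0 3 → i = j) ∧
    ∀ g, (∃ i ∈ s, (i⁻¹ * g).mat ∈ K0 3) → ∃ i ∈ s', (i⁻¹ * g).mat ∈ K0 3 := by
  classical
  refine ⟨s.image fun g => (QuotientGroup.mk g : Mp2 ⧸ K0bar 3).out, ?_, ?_⟩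
  · simp only [Finset.mem_image]
    rintro _ ⟨a, -, rfl⟩ _ ⟨b, -, rfl⟩ h
    have : (QuotientGroup.mk (QuotientGroup.mk a : Mp2 ⧸ K0bar 3).out : Mp2 ⧸ K0bar 3) =
      QuotientGroup.mk (QuotientGroup.mk b : Mp2 ⧸ K0bar 3).out := QuotientGroup.eq.2 h
    rw [QuotientGroup.out_eq', QuotientGroup.out_eq'] at this
    rw [this]
  · rintro g ⟨i, hi, hg⟩
    refine ⟨_, Finset.mem_image_of_mem _ hi, ?_⟩
    have h1 : (QuotientGroup.mk i : Mp2 ⧸ K0bar 3) = QuotientGroup.mk g := QuotientGroup.eq.2 hg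
    have h2 : (QuotientGroup.mk (QuotientGroup.mk i : Mp2 ⧸ K0bar 3).out : Mp2 ⧸ K0bar 3) =
      QuotientGroup.mk g := by rw [QuotientGroup.out_eq', h1]
    exact (QuotientGroup.eq (s := K0bar 3)).1 h2

end Integral

/-! ### Convolution -/

section Conv

theorem conv_smul_left (μ : Measure Mp2) (c : ℂ) (f₁ f₂ : Mp2 → ℂ) :
    conv μ (c • f₁) f₂ = c • conv μ f₁ f₂ := by
  funext h
  rw [Pi.smul_apply, smul_eq_mul]
  unfold conv
  rw [← integral_const_mul]
  congr 1; funext g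
  rw [Pi.smul_apply, smul_eq_mul]; ring

theorem conv_smul_right (μ : Measure Mp2) (c : ℂ) (f₁ f₂ : Mp2 → ℂ) :
    conv μ f₁ (c • f₂) = c • conv μ f₁ f₂ := by
  funext h
  rw [Pi.smul_apply, smul_eq_mul]
  unfold conv
  rw [← integral_const_mul]
  congr 1; funext g
  rw [Pi.smul_apply, smul_eq_mul]; ring

variable {ξ : ℂ} {hξ : ξ ^ 2 = -1}

theorem hecke_left {f : Mp2 → ℂ} (hf : f ∈ heckeSpace (K0bar 3) (chi1 ξ hξ)) {k : Mp2} (g : Mp2)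
    (hk : k.mat ∈ K0 3) : f (k * g) = conj (chiExt ξ hξ k) * f g :=
  ((mem_heckeSpace_iff ξ hξ).1 hf).1 k g hk

theorem hecke_right {f : Mp2 → ℂ} (hf : f ∈ heckeSpace (K0bar 3) (chi1 ξ hξ)) (g : Mp2) {k : Mp2}
    (hk : k.mat ∈ K0 3) : f (g * k) = conj (chiExt ξ hξ k) * f g :=
  ((mem_heckeSpace_iff ξ hξ).1 hf).2.1 g k hk

theorem hecke_support {f : Mp2 → ℂ} (hf : f ∈ heckeSpace (K0bar 3) (chi1 ξ hξ)) :
    ∃ s : Finset Mp2, (∀ i ∈ s, ∀ j ∈ s, (i⁻¹ * j).mat ∈ K0 3 → i = j) ∧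
      ∀ g, f g ≠ 0 → ∃ i ∈ s, (i⁻¹ * g).mat ∈ K0 3 := by
  obtain ⟨s, hs⟩ := ((mem_heckeSpace_iff ξ hξ).1 hf).2.2
  obtain ⟨s', h1, h2⟩ := exists_disjoint_cosets s
  exact ⟨s', h1, fun g hg => h2 g (hs g hg)⟩

theorem conj_chiExt_mul_inv {k : Mp2} (hk : k.mat ∈ K0 3) :
    conj (chiExt ξ hξ k) * conj (chiExt ξ hξ k⁻¹) = 1 := by
  rw [← map_mul, ← chiExt_mul ξ hξ hk (inv_mem hk), mul_inv_cancel, chiExt_one, map_one]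

/-- The factors `conj χ₁(k)` and `conj χ₁(k⁻¹)` cancel. The integrand is thus constant on left
cosets of `S`, so the convolution is a finite sum. -/
theorem hecke_integrand_right {f₁ f₂ : Mp2 → ℂ} (h₁ : f₁ ∈ heckeSpace (K0bar 3) (chi1 ξ hξ))
    (h₂ : f₂ ∈ heckeSpace (K0bar 3) (chi1 ξ hξ)) (h g k : Mp2) (hk : k.mat ∈ K0 3) :
    f₁ (g * k) * f₂ ((g * k)⁻¹ * h) = f₁ g * f₂ (g⁻¹ * h) := by
  rw [mul_inv_rev, mul_assoc k⁻¹, hecke_left h₂ (k := k⁻¹) _ (inv_mem hk), hecke_right h₁ g hk]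
  linear_combination (f₁ g * f₂ (g⁻¹ * h)) * conj_chiExt_mul_inv (hξ := hξ) hk

variable (μ : Measure Mp2) [μ.IsHaarMeasure] (hμ : μ (K0bar 3 : Set Mp2) = 1)

include hμ in
theorem conv_eq_sum {f₁ f₂ : Mp2 → ℂ} (h₁ : f₁ ∈ heckeSpace (K0bar 3) (chi1 ξ hξ))
    (h₂ : f₂ ∈ heckeSpace (K0bar 3) (chi1 ξ hξ)) {s : Finset Mp2}
    (hs : ∀ i ∈ s, ∀ j ∈ s, (i⁻¹ * j).mat ∈ K0 3 → i = j)
    (hsupp : ∀ g, f₁ g ≠ 0 → ∃ i ∈ s, (i⁻¹ * g).mat ∈ K0 3) (h : Mp2) :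
    Integrable (fun g => f₁ g * f₂ (g⁻¹ * h)) μ ∧
    conv μ f₁ f₂ h = ∑ i ∈ s, f₁ i * f₂ (i⁻¹ * h) :=
  integral_eq_sum μ hμ (hecke_integrand_right h₁ h₂ h) hs
    fun g hg => hsupp g (left_ne_zero_of_mul hg)

theorem conv_translate (f₁ f₂ : Mp2 → ℂ) (i h : Mp2) :
    conv μ f₁ f₂ (i⁻¹ * h) = ∫ g, f₁ (i⁻¹ * g) * f₂ (g⁻¹ * h) ∂μ := by
  unfold conv
  rw [← integral_mul_left_Mp2 μ (fun g => f₁ (i⁻¹ * g) * f₂ (g⁻¹ * h)) i]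
  congr 1; funext g
  rw [inv_mul_cancel_left, mul_inv_rev, mul_assoc]

include hμ in
theorem conv_mem {f₁ f₂ : Mp2 → ℂ} (h₁ : f₁ ∈ heckeSpace (K0bar 3) (chi1 ξ hξ))
    (h₂ : f₂ ∈ heckeSpace (K0bar 3) (chi1 ξ hξ)) :
    conv μ f₁ f₂ ∈ heckeSpace (K0bar 3) (chi1 ξ hξ) := by
  classical
  obtain ⟨s, hs, hs'⟩ := hecke_support h₁
  obtain ⟨t, ht, ht'⟩ := hecke_support h₂
  refine (mem_heckeSpace_iff ξ hξ).2 ⟨fun k g hk => ?_, fun g k hk => ?_, ?_⟩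
  · have := conv_translate μ f₁ f₂ k⁻¹ g
    rw [inv_inv] at this
    rw [this]
    unfold conv
    rw [← integral_const_mul]
    congr 1; funext x
    rw [hecke_left h₁ _ hk]; ring
  · unfold conv
    rw [← integral_const_mul]
    congr 1; funext x
    rw [← mul_assoc, hecke_right h₂ _ hk]; ring
  · refine ⟨(s ×ˢ t).image fun p => p.1 * p.2, fun g hg => ?_⟩
    rw [(conv_eq_sum μ hμ h₁ h₂ hs hs' g).2] at hg
    obtain ⟨i, hi, hne⟩ := Finset.exists_ne_zero_of_sum_ne_zero hg
    obtain ⟨j, hj, hij⟩ := ht' _ (right_ne_zero_of_mul hne)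
    refine ⟨i * j, Finset.mem_image.2 ⟨(i, j), Finset.mem_product.2 ⟨hi, hj⟩, rfl⟩, ?_⟩
    rw [mul_inv_rev, mul_assoc]; exact hij

include hμ in
-- Only the sum over the cosets in the support of `f₁` is interchanged with an integral; after
-- translation by `conv_translate` this is additivity of the integral, and no double integral
-- occurs.
theorem conv_assoc {f₁ f₂ f₃ : Mp2 → ℂ} (h₁ : f₁ ∈ heckeSpace (K0bar 3) (chi1 ξ hξ))
    (h₂ : f₂ ∈ heckeSpace (K0bar 3) (chi1 ξ hξ)) (h₃ : f₃ ∈ heckeSpace (K0bar 3) (chi1 ξ hξ)) :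
    conv μ (conv μ f₁ f₂) f₃ = conv μ f₁ (conv μ f₂ f₃) := by
  obtain ⟨s, hs, hs'⟩ := hecke_support h₁
  obtain ⟨t, ht, ht'⟩ := hecke_support h₂
  funext h
  rw [(conv_eq_sum μ hμ h₁ (conv_mem μ hμ h₂ h₃) hs hs' h).2]
  have e : ∀ i ∈ s, f₁ i * conv μ f₂ f₃ (i⁻¹ * h) =
      ∫ g, f₁ i * (f₂ (i⁻¹ * g) * f₃ (g⁻¹ * h)) ∂μ := fun i _ => by
    rw [conv_translate, integral_const_mul]
  have hint : ∀ i ∈ s, Integrable (fun g => f₁ i * (f₂ (i⁻¹ * g) * f₃ (g⁻¹ * h))) μ := by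
    intro i _
    refine Integrable.const_mul ?_ _
    -- The function `g ↦ f₂(i⁻¹ g)` is supported on the translates by `i` of the cosets that carry
    -- `f₂`.
    obtain ⟨t', h1, h2⟩ := exists_disjoint_cosets (t.map (Equiv.mulLeft i).toEmbedding)
    refine (integral_eq_sum μ hμ (φ := fun g => f₂ (i⁻¹ * g) * f₃ (g⁻¹ * h)) (s := t') ?_ h1 ?_).1
    · intro g k hk
      simp only [mul_inv_rev, mul_assoc]
      rw [hecke_left h₃ (k := k⁻¹) _ (inv_mem hk), ← mul_assoc i⁻¹, hecke_right h₂ _ hk]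
      linear_combination (f₂ (i⁻¹ * g) * f₃ (g⁻¹ * h)) * conj_chiExt_mul_inv (hξ := hξ) hk
    · intro g hg
      obtain ⟨j, hj, hjg⟩ := ht' _ (left_ne_zero_of_mul hg)
      refine h2 g ⟨i * j, Finset.mem_map.2 ⟨j, hj, rfl⟩, ?_⟩
      rw [mul_inv_rev, mul_assoc]; exact hjg
  rw [Finset.sum_congr rfl e, ← integral_finsetSum s hint]
  unfold conv
  congr 1; funext g
  have := (conv_eq_sum μ hμ h₁ h₂ hs hs' g).2
  unfold conv at this
  rw [this, Finset.sum_mul]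
  exact Finset.sum_congr rfl fun i _ => by ring

include hμ in
theorem conv_add_left {f₁ f₂ f₃ : Mp2 → ℂ} (h₁ : f₁ ∈ heckeSpace (K0bar 3) (chi1 ξ hξ))
    (h₂ : f₂ ∈ heckeSpace (K0bar 3) (chi1 ξ hξ)) (h₃ : f₃ ∈ heckeSpace (K0bar 3) (chi1 ξ hξ)) :
    conv μ (f₁ + f₂) f₃ = conv μ f₁ f₃ + conv μ f₂ f₃ := by
  obtain ⟨s, hs, hs'⟩ := hecke_support h₁
  obtain ⟨t, ht, ht'⟩ := hecke_support h₂
  funext h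
  have := integral_add (conv_eq_sum μ hμ h₁ h₃ hs hs' h).1 (conv_eq_sum μ hμ h₂ h₃ ht ht' h).1
  rw [Pi.add_apply]
  refine Eq.trans ?_ this
  unfold conv
  congr 1; funext g
  rw [Pi.add_apply]; ring

include hμ in
theorem conv_add_right {f₁ f₂ f₃ : Mp2 → ℂ} (h₁ : f₁ ∈ heckeSpace (K0bar 3) (chi1 ξ hξ))
    (h₂ : f₂ ∈ heckeSpace (K0bar 3) (chi1 ξ hξ)) (h₃ : f₃ ∈ heckeSpace (K0bar 3) (chi1 ξ hξ)) :
    conv μ f₁ (f₂ + f₃) = conv μ f₁ f₂ + conv μ f₁ f₃ := by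
  obtain ⟨s, hs, hs'⟩ := hecke_support h₁
  funext h
  rw [Pi.add_apply, (conv_eq_sum μ hμ h₁ h₂ hs hs' h).2, (conv_eq_sum μ hμ h₁ h₃ hs hs' h).2,
    (conv_eq_sum μ hμ h₁ (add_mem h₂ h₃) hs hs' h).2, ← Finset.sum_add_distrib]
  exact Finset.sum_congr rfl fun i _ => by rw [Pi.add_apply]; ring

end Conv

/-! ### Functions supported on one double coset -/

section DoubleCoset

variable {ξ : ℂ} {hξ : ξ ^ 2 = -1}

/-- The hypothesis `hx` is exactly what makes the value independent of the factorization: two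
factorizations of one element differ by some `k`, `k'` in `S` with `k x = x k'`. -/
theorem doubleCosetFun_apply {x : Mp2} (z : ℂ)
    (hx : ∀ k k' : Mp2, k.mat ∈ K0 3 → k'.mat ∈ K0 3 → k * x = x * k' →
      chiExt ξ hξ k = chiExt ξ hξ k') {k k' : Mp2} (hk : k.mat ∈ K0 3) (hk' : k'.mat ∈ K0 3) :
    doubleCosetFun (chi1 ξ hξ) x z (k * x * k') =
      conj (chiExt ξ hξ k) * z * conj (chiExt ξ hξ k') := by
  have h : ∃ p : K0bar 3 × K0bar 3, k * x * k' = p.1 * x * p.2 := ⟨(⟨k, hk⟩, ⟨k', hk'⟩), rfl⟩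
  unfold doubleCosetFun
  rw [dif_pos h, ← chiExt_coe, ← chiExt_coe]
  have e := h.choose_spec
  set p := h.choose.1
  set q := h.choose.2
  have e' : ((p : Mp2)⁻¹ * k) * x = x * ((q : Mp2) * k'⁻¹) := by
    calc _ = (p : Mp2)⁻¹ * (k * x * k') * k'⁻¹ := by group
      _ = _ := by rw [e]; group
  have hp : (p : Mp2).mat ∈ K0 3 := p.2
  have hq : (q : Mp2).mat ∈ K0 3 := q.2
  have h1 := hx _ _ (mul_mem (inv_mem hp) hk) (mul_mem hq (inv_mem hk')) e'
  rw [chiExt_mul ξ hξ (g := (p : Mp2)⁻¹) (inv_mem hp) hk,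
    chiExt_mul ξ hξ (h := k'⁻¹) hq (inv_mem hk')] at h1
  have h2 := congrArg conj h1
  rw [map_mul, map_mul] at h2
  have h3 := conj_chiExt_mul_inv (hξ := hξ) hp
  have h4 := conj_chiExt_mul_inv (hξ := hξ) hk'
  set a := conj (chiExt ξ hξ p)
  set b := conj (chiExt ξ hξ (p : Mp2)⁻¹)
  set c := conj (chiExt ξ hξ k)
  set d := conj (chiExt ξ hξ k')
  set e := conj (chiExt ξ hξ k'⁻¹)
  linear_combination -(a * z * d) * h2 + (z * c * d) * h3 -
    (a * z * conj (chiExt ξ hξ q)) * h4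

theorem doubleCosetFun_support {x : Mp2} {z : ℂ} {g : Mp2}
    (h : doubleCosetFun (chi1 ξ hξ) x z g ≠ 0) :
    ∃ k k' : Mp2, k.mat ∈ K0 3 ∧ k'.mat ∈ K0 3 ∧ g = k * x * k' := by
  unfold doubleCosetFun at h
  split_ifs at h with h'
  · obtain ⟨p, hp⟩ := h'
    exact ⟨p.1, p.2, p.1.2, p.2.2, hp⟩
  · exact absurd rfl h

theorem doubleCosetFun_self {x : Mp2} (z : ℂ)
    (hx : ∀ k k' : Mp2, k.mat ∈ K0 3 → k'.mat ∈ K0 3 → k * x = x * k' →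
      chiExt ξ hξ k = chiExt ξ hξ k') : doubleCosetFun (chi1 ξ hξ) x z x = z := by
  have := doubleCosetFun_apply z hx (one_mem (K0 3)) (one_mem (K0 3)) (k := 1) (k' := 1)
  simpa [chiExt_one] using this

theorem doubleCosetFun_mem {x : Mp2} (z : ℂ)
    (hx : ∀ k k' : Mp2, k.mat ∈ K0 3 → k'.mat ∈ K0 3 → k * x = x * k' →
      chiExt ξ hξ k = chiExt ξ hξ k') (s : Finset Mp2)
    (hs : ∀ k : Mp2, k.mat ∈ K0 3 → ∃ i ∈ s, (i⁻¹ * (k * x)).mat ∈ K0 3) :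
    doubleCosetFun (chi1 ξ hξ) x z ∈ heckeSpace (K0bar 3) (chi1 ξ hξ) := by
  refine (mem_heckeSpace_iff ξ hξ).2 ⟨fun k g hk => ?_, fun g k hk => ?_, s, fun g hg => ?_⟩
  -- A zero value means that `g` lies outside the double coset or that `z = 0`, because `χ₁` has no
  -- zeros on `S`; both properties pass to `k * g`.
  · by_cases h : doubleCosetFun (chi1 ξ hξ) x z g = 0
    · rw [h, mul_zero]
      by_contra h'
      obtain ⟨p, q, hp, hq, e⟩ := doubleCosetFun_support h'
      have eg : g = (k⁻¹ * p) * x * q := by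
        rw [mul_assoc, mul_assoc, ← mul_assoc p, ← e, inv_mul_cancel_left]
      have hp' : (k⁻¹ * p).mat ∈ K0 3 := mul_mem (inv_mem hk) hp
      have hz : z ≠ 0 := by
        rintro rfl
        rw [e, doubleCosetFun_apply 0 hx hp hq] at h'
        simp at h'
      rw [eg, doubleCosetFun_apply z hx hp' hq] at h
      simp [hz, chiExt_ne_zero ξ hξ hp', chiExt_ne_zero ξ hξ hq] at h
    · obtain ⟨p, q, hp, hq, rfl⟩ := doubleCosetFun_support h
      rw [← mul_assoc, ← mul_assoc, doubleCosetFun_apply z hx (k := k * p) (mul_mem hk hp) hq,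
        doubleCosetFun_apply z hx hp hq, chiExt_mul ξ hξ hk hp, map_mul]
      ring
  · by_cases h : doubleCosetFun (chi1 ξ hξ) x z g = 0
    · rw [h, mul_zero]
      by_contra h'
      obtain ⟨p, q, hp, hq, e⟩ := doubleCosetFun_support h'
      have eg : g = p * x * (q * k⁻¹) := by
        rw [← mul_assoc, ← e, mul_inv_cancel_right]
      have hq' : (q * k⁻¹).mat ∈ K0 3 := mul_mem hq (inv_mem hk)
      have hz : z ≠ 0 := by
        rintro rfl
        rw [e, doubleCosetFun_apply 0 hx hp hq] at h'
        simp at h'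
      rw [eg, doubleCosetFun_apply z hx hp hq'] at h
      simp [hz, chiExt_ne_zero ξ hξ hp, chiExt_ne_zero ξ hξ hq'] at h
    · obtain ⟨p, q, hp, hq, rfl⟩ := doubleCosetFun_support h
      rw [mul_assoc _ q, doubleCosetFun_apply z hx (k' := q * k) hp (mul_mem hq hk),
        doubleCosetFun_apply z hx hp hq, chiExt_mul ξ hξ hq hk, map_mul]
      ring
  · obtain ⟨p, q, hp, hq, rfl⟩ := doubleCosetFun_support hg
    obtain ⟨i, hi, h⟩ := hs p hp
    refine ⟨i, hi, ?_⟩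
    rw [← mul_assoc]; exact mul_mem h hq

end DoubleCoset

/-! ### The unit and the generators -/

section Generators

theorem conj_wMat_mem {t : ℚ_[2]ˣ} {A : SL2} (hA : A ∈ K0 3) (h1 : ‖A 1 0 * (t : ℚ_[2]) ^ 2‖ ≤ 1)
    (h2 : ‖A 0 1 / (t : ℚ_[2]) ^ 2‖ ≤ 1 / 8) : (wMat t)⁻¹ * (A * wMat t) ∈ K0 3 := by
  have t0 := t.ne_zero
  obtain ⟨a1, -, -, a4⟩ := mem_K0_iff.1 hA
  have e00 : ((wMat t)⁻¹ * (A * wMat t)) 0 0 = A 1 1 := by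
    simp [mul_00, mul_10, inv_00, inv_01]
    field_simp
  have e01 : ((wMat t)⁻¹ * (A * wMat t)) 0 1 = -(A 1 0 * (t : ℚ_[2]) ^ 2) := by
    simp [mul_01, mul_11, inv_00, inv_01]
    ring
  have e10 : ((wMat t)⁻¹ * (A * wMat t)) 1 0 = -(A 0 1 / (t : ℚ_[2]) ^ 2) := by
    simp [mul_00, mul_10, inv_10, inv_11]
    field_simp
  have e11 : ((wMat t)⁻¹ * (A * wMat t)) 1 1 = A 0 0 := by
    simp [mul_01, mul_11, inv_10, inv_11]
    field_simp
  rw [mem_K0_iff, e00, e01, e10, e11, norm_neg, norm_neg]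
  exact ⟨a4, h1, h2, a1⟩

/-- `(w(1/2), 1)` -/
noncomputable def wHalf : Mp2 := bar (wMat (twoPow (-1)))

/-- `(w(1/4), 1)` -/
noncomputable def wQuarter : Mp2 := bar (wMat (twoPow (-2)))

theorem coe_half : ((twoPow (-1) : ℚ_[2]ˣ) : ℚ_[2]) = 1 / 2 := by rw [coe_twoPow]; norm_num

theorem coe_quarter : ((twoPow (-2) : ℚ_[2]ˣ) : ℚ_[2]) = 1 / 4 := by
  rw [coe_twoPow]; norm_num [zpow_neg]

/-- Representatives of the left cosets in the double coset of `(w(1/2), 1)` -/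
theorem coset_wHalf {k : Mp2} (hk : k.mat ∈ K0 3) : (wHalf⁻¹ * (k * wHalf)).mat ∈ K0 3 ∨
    (wHalf⁻¹ * (bar (xMat (-1)) * k * wHalf)).mat ∈ K0 3 := by
  have key : ∀ A ∈ K0 3, ‖A 0 1‖ ≤ 1 / 2 →
      (wMat (twoPow (-1)))⁻¹ * (A * wMat (twoPow (-1))) ∈ K0 3 := by
    intro A hA h
    refine conj_wMat_mem hA ?_ ?_ <;> rw [coe_half]
    · rw [norm_mul, show (1 / 2 : ℚ_[2]) ^ 2 = 4⁻¹ by norm_num, norm_inv, norm_four]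
      have := (mem_K0_iff.1 hA).2.2.1
      linarith
    · rw [show A 0 1 / (1 / 2 : ℚ_[2]) ^ 2 = 4 * A 0 1 by ring, norm_mul, norm_four]
      linarith
  -- The parity of the upper right entry `b` decides. If `b` is odd, then `x(-1)` replaces it by `b
  -- - d`, which is even since `d` is odd.
  rcases even_or_odd_of_norm_le (mem_K0_iff.1 hk).2.1 with h | h
  · exact Or.inl (key _ hk h)
  · refine Or.inr (key (xMat (-1) * k.mat) (mul_mem (xMat_mem (by simp)) hk) ?_)
    have := norm_sub_one_le_half (norm_diag_of_mem hk).2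
    rw [mul_01, xMat_00, xMat_01, show 1 * k.mat 0 1 + -1 * k.mat 1 1 =
      (k.mat 0 1 - 1) - (k.mat 1 1 - 1) by ring]
    exact norm_sub_le_of_le h this

/-- Representatives of the left cosets in the double coset of `(w(1/4), 1)` -/
theorem coset_wQuarter {k : Mp2} (hk : k.mat ∈ K0 3) : (wQuarter⁻¹ * (k * wQuarter)).mat ∈ K0 3 ∨
    (wQuarter⁻¹ * (bar (yMat (-8)) * k * wQuarter)).mat ∈ K0 3 := by
  have key : ∀ A ∈ K0 3, ‖A 1 0‖ ≤ 1 / 16 →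
      (wMat (twoPow (-2)))⁻¹ * (A * wMat (twoPow (-2))) ∈ K0 3 := by
    intro A hA h
    have n16 : ‖(16 : ℚ_[2])‖ = 16⁻¹ := by
      rw [show (16 : ℚ_[2]) = 4 * 4 by norm_num, norm_mul, norm_four]; norm_num
    refine conj_wMat_mem hA ?_ ?_ <;> rw [coe_quarter]
    · rw [norm_mul, show (1 / 4 : ℚ_[2]) ^ 2 = 16⁻¹ by norm_num, norm_inv, n16]
      linarith
    · rw [show A 0 1 / (1 / 4 : ℚ_[2]) ^ 2 = 16 * A 0 1 by ring, norm_mul, n16]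
      have := (mem_K0_iff.1 hA).2.1
      linarith
  obtain ⟨-, -, h3, -⟩ := mem_K0_iff.1 hk
  -- The parity of `c / 8` decides. If it is odd, then `y(-8)` replaces `c` by `c - 8a ∈ 16ℤ₂`,
  -- since `a` is odd.
  rcases even_or_odd_scaled (c := 8) (by norm_num) (h3.trans (by rw [norm_eight]; norm_num))
    with h | h <;> rw [norm_eight] at h
  · exact Or.inl (key _ hk (by linarith))
  · refine Or.inr (key (yMat (-8) * k.mat)
      (mul_mem (yMat_mem (by rw [norm_neg, norm_eight]; norm_num)) hk) ?_)
    have := norm_sub_one_le_half (norm_diag_of_mem hk).1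
    rw [mul_10, yMat_10, yMat_11, show -8 * k.mat 0 0 + 1 * k.mat 1 0 =
      (k.mat 1 0 - 8) - 8 * (k.mat 0 0 - 1) by ring]
    refine norm_sub_le_of_le (by linarith) ?_
    rw [norm_mul, norm_eight]; linarith

theorem coset_yMat_four {k : Mp2} (hk : k.mat ∈ K0 3) :
    ((bar (yMat 4))⁻¹ * (k * bar (yMat 4))).mat ∈ K0 3 := by
  rw [← bar_yMat_neg, ← mul_assoc]
  exact (bar_yMat_four_conj _ Complex.I_sq hk).1

variable (ξ : ℂ) (hξ : ξ ^ 2 = -1)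

/-- The identity of the Hecke algebra. -/
noncomputable def heckeOne : Mp2 → ℂ := doubleCosetFun (chi1 ξ hξ) 1 1

/-- `𝒰₁ / √2` -/
noncomputable def heckeU₁ : Mp2 → ℂ := (1 / (Real.sqrt 2 : ℂ)) • heckeU ξ hξ 1

/-- `𝒰₂ / √2` -/
noncomputable def heckeU₂ : Mp2 → ℂ := (1 / (Real.sqrt 2 : ℂ)) • heckeU ξ hξ 2

/-- The value of `𝒰₁ / √2` at `(w(1/2), 1)` and of `𝒰₂ / √2` at `(w(1/4), 1)`. -/
noncomputable def uVal : ℂ := conj (zeta8 ξ) / (Real.sqrt 2 : ℂ)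

theorem compat_one (k k' : Mp2) (_ : k.mat ∈ K0 3) (_ : k'.mat ∈ K0 3) (h : k * 1 = 1 * k') :
    chiExt ξ hξ k = chiExt ξ hξ k' := by rw [mul_one, one_mul] at h; rw [h]

theorem compat_wMat (t : ℚ_[2]ˣ) (k k' : Mp2) (hk : k.mat ∈ K0 3) (hk' : k'.mat ∈ K0 3)
    (h : k * bar (wMat t) = bar (wMat t) * k') : chiExt ξ hξ k = chiExt ξ hξ k' :=
  chiExt_conj_wMat ξ hξ hk hk' h

theorem compat_yMat_four (k k' : Mp2) (hk : k.mat ∈ K0 3) (_ : k'.mat ∈ K0 3)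
    (h : k * bar (yMat 4) = bar (yMat 4) * k') : chiExt ξ hξ k = chiExt ξ hξ k' := by
  have e : k' = bar (yMat (-4)) * k * bar (yMat 4) := by
    rw [mul_assoc, h, bar_yMat_neg, inv_mul_cancel_left]
  rw [e, (bar_yMat_four_conj ξ hξ hk).2]

theorem heckeOne_mem : heckeOne ξ hξ ∈ heckeSpace (K0bar 3) (chi1 ξ hξ) :=
  doubleCosetFun_mem 1 (compat_one ξ hξ) {1} fun k hk => ⟨1, by simp, by simpa using hk⟩

theorem heckeV_mem : heckeV ξ hξ ∈ heckeSpace (K0bar 3) (chi1 ξ hξ) :=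
  doubleCosetFun_mem 1 (compat_yMat_four ξ hξ) {bar (yMat 4)}
    fun _ hk => ⟨_, Finset.mem_singleton_self _, coset_yMat_four hk⟩

open Classical in
theorem heckeU₁_mem : heckeU₁ ξ hξ ∈ heckeSpace (K0bar 3) (chi1 ξ hξ) := by
  refine Submodule.smul_mem _ _ (doubleCosetFun_mem _ (compat_wMat ξ hξ _)
    {wHalf, bar (xMat 1) * wHalf} fun k hk => ?_)
  rcases coset_wHalf hk with h | h
  · exact ⟨wHalf, by simp, h⟩
  · refine ⟨bar (xMat 1) * wHalf, by simp, ?_⟩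
    rw [mul_inv_rev, ← bar_xMat_neg, mul_assoc, ← mul_assoc (bar _)]; exact h

open Classical in
theorem heckeU₂_mem : heckeU₂ ξ hξ ∈ heckeSpace (K0bar 3) (chi1 ξ hξ) := by
  refine Submodule.smul_mem _ _ (doubleCosetFun_mem _ (compat_wMat ξ hξ _)
    {wQuarter, bar (yMat 8) * wQuarter} fun k hk => ?_)
  rcases coset_wQuarter hk with h | h
  · exact ⟨wQuarter, by simp, h⟩
  · refine ⟨bar (yMat 8) * wQuarter, by simp, ?_⟩
    rw [mul_inv_rev, ← bar_yMat_neg, mul_assoc, ← mul_assoc (bar _)]; exact h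

theorem heckeU₁_support {g : Mp2} (h : heckeU₁ ξ hξ g ≠ 0) :
    ∃ k k' : Mp2, k.mat ∈ K0 3 ∧ k'.mat ∈ K0 3 ∧ g = k * wHalf * k' := by
  rw [heckeU₁, Pi.smul_apply, smul_eq_mul] at h
  exact doubleCosetFun_support (right_ne_zero_of_mul h)

theorem heckeU₂_support {g : Mp2} (h : heckeU₂ ξ hξ g ≠ 0) :
    ∃ k k' : Mp2, k.mat ∈ K0 3 ∧ k'.mat ∈ K0 3 ∧ g = k * wQuarter * k' := by
  rw [heckeU₂, Pi.smul_apply, smul_eq_mul] at h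
  exact doubleCosetFun_support (right_ne_zero_of_mul h)

theorem heckeOne_one : heckeOne ξ hξ 1 = 1 := doubleCosetFun_self 1 (compat_one ξ hξ)

theorem heckeV_yMat : heckeV ξ hξ (bar (yMat 4)) = 1 :=
  doubleCosetFun_self 1 (compat_yMat_four ξ hξ)

theorem heckeU₁_wHalf : heckeU₁ ξ hξ wHalf = uVal ξ := by
  rw [heckeU₁, Pi.smul_apply, smul_eq_mul, uVal, one_div_mul_eq_div]
  congr 1
  exact doubleCosetFun_self _ (compat_wMat ξ hξ _)

theorem heckeU₂_wQuarter : heckeU₂ ξ hξ wQuarter = uVal ξ := by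
  rw [heckeU₂, Pi.smul_apply, smul_eq_mul, uVal, one_div_mul_eq_div]
  congr 1
  exact doubleCosetFun_self _ (compat_wMat ξ hξ _)

section Translations

variable {ξ hξ} {f : Mp2 → ℂ} (hf : f ∈ heckeSpace (K0bar 3) (chi1 ξ hξ))

include hf

theorem hecke_xMat_mul {s : ℚ_[2]} (hs : ‖s‖ ≤ 1) (g : Mp2) : f (bar (xMat s) * g) = f g := by
  rw [hecke_left hf g (xMat_mem hs), chiExt_xMat ξ hξ hs, map_one, one_mul]

theorem hecke_mul_xMat {s : ℚ_[2]} (hs : ‖s‖ ≤ 1) (g : Mp2) : f (g * bar (xMat s)) = f g := by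
  rw [hecke_right hf g (xMat_mem hs), chiExt_xMat ξ hξ hs, map_one, one_mul]

theorem hecke_yMat_mul {s : ℚ_[2]} (hs : ‖s‖ ≤ 1 / 8) (g : Mp2) : f (bar (yMat s) * g) = f g := by
  rw [hecke_left hf g (yMat_mem hs), chiExt_yMat ξ hξ hs, map_one, one_mul]

theorem hecke_mul_yMat {s : ℚ_[2]} (hs : ‖s‖ ≤ 1 / 8) (g : Mp2) : f (g * bar (yMat s)) = f g := by
  rw [hecke_right hf g (yMat_mem hs), chiExt_yMat ξ hξ hs, map_one, one_mul]

end Translations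

/-! ### Convolution by the identity and the generators as finite sums -/

variable {ξ hξ} (μ : Measure Mp2) [μ.IsHaarMeasure] (hμ : μ (K0bar 3 : Set Mp2) = 1)

include hμ

theorem heckeOne_conv {f : Mp2 → ℂ} (hf : f ∈ heckeSpace (K0bar 3) (chi1 ξ hξ)) :
    conv μ (heckeOne ξ hξ) f = f := by
  funext h
  rw [(conv_eq_sum μ hμ (heckeOne_mem ξ hξ) hf (s := {1}) (by simp) (fun g hg => ?_) h).2]
  · simp [heckeOne_one]
  · obtain ⟨k, k', hk, hk', rfl⟩ := doubleCosetFun_support hg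
    exact ⟨1, by simp, by simpa using mul_mem hk hk'⟩

/-- Here the support of the second factor is used: the integrand vanishes unless `g⁻¹ h ∈ S`, so
only the coset of `h` contributes. -/
theorem conv_heckeOne {f : Mp2 → ℂ} (hf : f ∈ heckeSpace (K0bar 3) (chi1 ξ hξ)) :
    conv μ f (heckeOne ξ hξ) = f := by
  funext h
  have := (integral_eq_sum μ hμ (φ := fun g => f g * heckeOne ξ hξ (g⁻¹ * h)) (s := {h})
    (hecke_integrand_right hf (heckeOne_mem ξ hξ) h) (by simp) (fun g hg => ?_)).2
  · unfold conv
    rw [this]; simp [heckeOne_one]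
  · obtain ⟨k, k', hk, hk', e⟩ := doubleCosetFun_support (right_ne_zero_of_mul hg)
    refine ⟨h, by simp, ?_⟩
    rw [show h⁻¹ * g = (g⁻¹ * h)⁻¹ by group, e]
    simpa using mul_mem (inv_mem hk') (inv_mem hk)

theorem heckeV_conv {f : Mp2 → ℂ} (hf : f ∈ heckeSpace (K0bar 3) (chi1 ξ hξ)) (h : Mp2) :
    conv μ (heckeV ξ hξ) f h = f (bar (yMat (-4)) * h) := by
  rw [(conv_eq_sum μ hμ (heckeV_mem ξ hξ) hf (s := {bar (yMat 4)}) (by simp) (fun g hg => ?_) h).2]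
  · rw [Finset.sum_singleton, heckeV_yMat, one_mul, bar_yMat_neg]
  · obtain ⟨k, k', hk, hk', rfl⟩ := doubleCosetFun_support hg
    refine ⟨_, Finset.mem_singleton_self _, ?_⟩
    rw [← mul_assoc]; exact mul_mem (coset_yMat_four hk) hk'

omit hμ [μ.IsHaarMeasure] in
theorem wHalf_conj_xMat (s : ℚ_[2]) : bar (xMat s) * wHalf = wHalf * bar (yMat (-(4 * s))) := by
  rw [wHalf, bar_xMat_mul_wMat, coe_half]; congr 3; ring

omit hμ [μ.IsHaarMeasure] in
theorem wHalf_conj_yMat (s : ℚ_[2]) : bar (yMat s) * wHalf = wHalf * bar (xMat (-(s / 4))) := by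
  rw [wHalf, bar_yMat_mul_wMat, coe_half]; congr 3; ring

omit hμ [μ.IsHaarMeasure] in
theorem wQuarter_conj_yMat (s : ℚ_[2]) :
    bar (yMat s) * wQuarter = wQuarter * bar (xMat (-(s / 16))) := by
  rw [wQuarter, bar_yMat_mul_wMat, coe_quarter]; congr 3; ring

theorem heckeU₁_conv {f : Mp2 → ℂ} (hf : f ∈ heckeSpace (K0bar 3) (chi1 ξ hξ)) (h : Mp2) :
    conv μ (heckeU₁ ξ hξ) f h =
      uVal ξ * (f (wHalf⁻¹ * h) + f (wHalf⁻¹ * (bar (xMat (-1)) * h))) := by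
  classical
  -- The two representatives differ by `y(-4) ∉ S`, so their cosets are distinct and neither is
  -- counted twice.
  have hinv : wHalf⁻¹ * (bar (xMat 1) * wHalf) = bar (yMat (-4)) := by
    rw [wHalf_conj_xMat, inv_mul_cancel_left, mul_one]
  have hn : (wHalf⁻¹ * (bar (xMat 1) * wHalf)).mat ∉ K0 3 := by
    rw [hinv, mem_K0_iff]
    simp [norm_four]; norm_num
  have hne : wHalf ≠ bar (xMat 1) * wHalf := fun e => hn (by
    rw [← e, inv_mul_cancel]; exact one_mem _)
  have hu := heckeU₁_mem ξ hξ
  rw [(conv_eq_sum μ hμ hu hf (s := {wHalf, bar (xMat 1) * wHalf}) ?_ (fun g hg => ?_) h).2]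
  · rw [Finset.sum_pair hne, hecke_xMat_mul hu (by simp), heckeU₁_wHalf, mul_inv_rev,
      ← bar_xMat_neg, mul_assoc, mul_add]
  · intro i hi j hj hij
    simp only [Finset.mem_insert, Finset.mem_singleton] at hi hj
    rcases hi with rfl | rfl <;> rcases hj with rfl | rfl
    · rfl
    · exact absurd hij hn
    · refine absurd ?_ hn
      have := inv_mem hij
      simpa [mul_assoc] using this
    · rfl
  · obtain ⟨k, k', hk, hk', rfl⟩ := heckeU₁_support ξ hξ hg
    rcases coset_wHalf hk with h | h
    · refine ⟨wHalf, by simp, ?_⟩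
      rw [← mul_assoc]; exact mul_mem h hk'
    · refine ⟨bar (xMat 1) * wHalf, by simp, ?_⟩
      rw [mul_inv_rev, ← bar_xMat_neg]
      have := mul_mem h hk'
      simpa [mul_assoc] using this

theorem heckeU₂_conv {f : Mp2 → ℂ} (hf : f ∈ heckeSpace (K0bar 3) (chi1 ξ hξ)) (h : Mp2) :
    conv μ (heckeU₂ ξ hξ) f h =
      uVal ξ * (f (wQuarter⁻¹ * h) + f (wQuarter⁻¹ * (bar (yMat (-8)) * h))) := by
  classical
  -- As for `w(1/2)`, the two cosets are distinct, now because `x(-1/2) ∉ S`.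
  have hinv : wQuarter⁻¹ * (bar (yMat 8) * wQuarter) = bar (xMat (-(1 / 2))) := by
    rw [wQuarter_conj_yMat, inv_mul_cancel_left]; congr 2; norm_num
  have hn : (wQuarter⁻¹ * (bar (yMat 8) * wQuarter)).mat ∉ K0 3 := by
    rw [hinv, mem_K0_iff]
    simp [norm_two]
  have hne : wQuarter ≠ bar (yMat 8) * wQuarter := fun e => hn (by
    rw [← e, inv_mul_cancel]; exact one_mem _)
  have hu := heckeU₂_mem ξ hξ
  rw [(conv_eq_sum μ hμ hu hf (s := {wQuarter, bar (yMat 8) * wQuarter}) ?_ (fun g hg => ?_) h).2]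
  · rw [Finset.sum_pair hne, hecke_yMat_mul hu (by rw [norm_eight]; norm_num), heckeU₂_wQuarter,
      mul_inv_rev, ← bar_yMat_neg, mul_assoc, mul_add]
  · intro i hi j hj hij
    simp only [Finset.mem_insert, Finset.mem_singleton] at hi hj
    rcases hi with rfl | rfl <;> rcases hj with rfl | rfl
    · rfl
    · exact absurd hij hn
    · refine absurd ?_ hn
      have := inv_mem hij
      simpa [mul_assoc] using this
    · rfl
  · obtain ⟨k, k', hk, hk', rfl⟩ := heckeU₂_support ξ hξ hg
    rcases coset_wQuarter hk with h | h
    · refine ⟨wQuarter, by simp, ?_⟩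
      rw [← mul_assoc]; exact mul_mem h hk'
    · refine ⟨bar (yMat 8) * wQuarter, by simp, ?_⟩
      rw [mul_inv_rev, ← bar_yMat_neg]
      have := mul_mem h hk'
      simpa [mul_assoc] using this

end Generators

/-! ### Double cosets of `K₀(8)` in `SL₂(ℚ₂)` -/

/-- `B ∈ K₀(8) A K₀(8)` -/
def InDC (A B : SL2) : Prop := ∃ k ∈ K0 3, ∃ k' ∈ K0 3, B = k * A * k'

theorem InDC.refl (A : SL2) : InDC A A := ⟨1, one_mem _, 1, one_mem _, by simp⟩

theorem InDC.symm {A B : SL2} (h : InDC A B) : InDC B A := by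
  obtain ⟨k, hk, k', hk', rfl⟩ := h
  exact ⟨k⁻¹, inv_mem hk, k'⁻¹, inv_mem hk', by group⟩

theorem InDC.trans {A B C : SL2} (h : InDC A B) (h' : InDC B C) : InDC A C := by
  obtain ⟨k, hk, k', hk', rfl⟩ := h
  obtain ⟨l, hl, l', hl', rfl⟩ := h'
  exact ⟨l * k, mul_mem hl hk, k' * l', mul_mem hk' hl', by group⟩

theorem InDC.mul_left {A B k : SL2} (h : InDC A B) (hk : k ∈ K0 3) : InDC A (k * B) :=
  h.trans ⟨k, hk, 1, one_mem _, by simp⟩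

theorem InDC.mul_right {A B k : SL2} (h : InDC A B) (hk : k ∈ K0 3) : InDC A (B * k) :=
  h.trans ⟨1, one_mem _, k, hk, by simp⟩

theorem InDC.neg (A : SL2) : InDC A (-A) := ⟨-1, neg_one_mem, 1, one_mem _, by simp⟩

theorem yMat_four_conj_mem {k : SL2} (hk : k ∈ K0 3) : yMat (-4) * k * yMat 4 ∈ K0 3 :=
  (bar_yMat_four_conj _ Complex.I_sq (k := bar k) hk).1

theorem yMat_four_conj_mem' {k : SL2} (hk : k ∈ K0 3) : yMat 4 * k * yMat (-4) ∈ K0 3 := by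
  have h8 : ∀ r : ℚ_[2], ‖r‖ ≤ 1 / 8 → yMat r ∈ K0 3 := fun r hr => yMat_mem hr
  have h := yMat_four_conj_mem hk
  have e : yMat 4 * k * yMat (-4) = yMat 8 * (yMat (-4) * k * yMat 4) * yMat (-8) := by
    have a : yMat 8 * yMat (-4) = yMat 4 := by rw [← yMat_add]; congr 1; norm_num
    have b : yMat 4 * yMat (-8) = yMat (-4) := by rw [← yMat_add]; congr 1; norm_num
    simp only [mul_assoc]
    rw [b, ← mul_assoc (yMat 8), a]
  rw [e]
  exact mul_mem (mul_mem (h8 8 (by rw [norm_eight]; norm_num)) h)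
    (h8 (-8) (by rw [norm_neg, norm_eight]; norm_num))

theorem InDC.yMat_four {A B : SL2} (h : InDC A B) : InDC (yMat 4 * A) (yMat 4 * B) := by
  obtain ⟨k, hk, k', hk', rfl⟩ := h
  refine ⟨_, yMat_four_conj_mem' hk, k', hk', ?_⟩
  rw [yMat_neg]; group

/-- All values of `F` outside `K₀(8) A K₀(8)` vanish. -/
def SuppIn (F : Mp2 → ℂ) (A : SL2) : Prop := ∀ g, F g ≠ 0 → InDC A g.mat

theorem SuppIn.congr {F : Mp2 → ℂ} {A B : SL2} (h : SuppIn F A) (hAB : InDC A B) : SuppIn F B :=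
  fun g hg => hAB.symm.trans (h g hg)

theorem wMat_conj (t : ℚ_[2]ˣ) (A : SL2) :
    wMat t * A * (wMat t)⁻¹ = (wMat t)⁻¹ * (A * wMat t) := by
  have h : (wMat t)⁻¹ = -wMat t := by
    apply SL2_ext <;> simp [inv_00, inv_01, inv_10, inv_11]
  rw [h]; simp [mul_assoc]

/-- Splitting off `x(b/a)` on the right leaves a lower triangular element of `K₀(8)`, which `w(1/2)`
conjugates into `K₀(8)`. So only the parameter `s` survives in a product of double cosets with first
factor that of `w(1/2)`. -/
theorem wHalf_mul {k : SL2} (hk : k ∈ K0 3) : ∃ k' ∈ K0 3, ∃ s : ℚ_[2], ‖s‖ ≤ 1 ∧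
    wHalf.mat * k = k' * wHalf.mat * xMat s := by
  obtain ⟨h1, -⟩ := norm_diag_of_mem hk
  obtain ⟨-, h2, -, -⟩ := mem_K0_iff.1 hk
  have h0 : k 0 0 ≠ 0 := by intro h; rw [h] at h1; simp at h1
  have hs : ‖k 0 1 / k 0 0‖ ≤ 1 := by rw [norm_div, h1, div_one]; exact h2
  have hs' : ‖-(k 0 1 / k 0 0)‖ ≤ 1 := by rwa [norm_neg]
  refine ⟨wHalf.mat * (k * xMat (-(k 0 1 / k 0 0))) * wHalf.mat⁻¹, ?_,
    k 0 1 / k 0 0, hs, ?_⟩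
  · have hk' := mul_mem hk (xMat_mem hs')
    rw [wHalf, bar_mat, wMat_conj]
    refine conj_wMat_mem hk' ?_ ?_ <;> rw [coe_half]
    · rw [norm_mul, show (1 / 2 : ℚ_[2]) ^ 2 = 4⁻¹ by norm_num, norm_inv, norm_four]
      have := (mem_K0_iff.1 hk').2.2.1
      linarith
    · rw [mul_01, xMat_01, xMat_11, mul_neg, mul_div_cancel₀ _ h0]
      simp
  · rw [xMat_neg]; group

/-- Splitting off `y(c/d)` leaves an upper triangular element, which `w(1/4)` conjugates into
`K₀(8)`. -/
theorem wQuarter_mul {k : SL2} (hk : k ∈ K0 3) : ∃ k' ∈ K0 3, ∃ s : ℚ_[2], ‖s‖ ≤ 1 / 8 ∧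
    wQuarter.mat * k = k' * wQuarter.mat * yMat s := by
  obtain ⟨-, h1⟩ := norm_diag_of_mem hk
  obtain ⟨-, -, h2, -⟩ := mem_K0_iff.1 hk
  have h0 : k 1 1 ≠ 0 := by intro h; rw [h] at h1; simp at h1
  have hs : ‖k 1 0 / k 1 1‖ ≤ 1 / 8 := by rw [norm_div, h1, div_one]; exact h2
  have hs' : ‖-(k 1 0 / k 1 1)‖ ≤ 1 / 8 := by rwa [norm_neg]
  refine ⟨wQuarter.mat * (k * yMat (-(k 1 0 / k 1 1))) * wQuarter.mat⁻¹, ?_,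
    k 1 0 / k 1 1, hs, ?_⟩
  · have hk' := mul_mem hk (yMat_mem hs')
    rw [wQuarter, bar_mat, wMat_conj]
    refine conj_wMat_mem hk' ?_ ?_ <;> rw [coe_quarter]
    · rw [mul_10, yMat_00, yMat_10, mul_neg, mul_div_cancel₀ _ h0]
      simp
    · rw [show (k * yMat (-(k 1 0 / k 1 1))) 0 1 / (1 / 4 : ℚ_[2]) ^ 2 =
        2 * 8 * (k * yMat (-(k 1 0 / k 1 1))) 0 1 by ring, norm_mul, norm_mul, norm_two, norm_eight]
      have := (mem_K0_iff.1 hk').2.1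
      linarith
  · rw [yMat_neg]; group

section Support

variable {ξ : ℂ} {hξ : ξ ^ 2 = -1}

/-- By equivariance one value determines a Hecke function above the whole double coset, both lifts
of a matrix included. -/
theorem eq_of_suppIn {F G : Mp2 → ℂ} (hF : F ∈ heckeSpace (K0bar 3) (chi1 ξ hξ))
    (hG : G ∈ heckeSpace (K0bar 3) (chi1 ξ hξ)) {x g : Mp2} (h : F x = G x)
    (hg : InDC x.mat g.mat) : F g = G g := by
  obtain ⟨k, hk, k', hk', e⟩ := hg
  obtain ⟨ε, rfl⟩ := exists_cen_of_mat_eq (g := g) (h := bar k * x * bar k') e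
  rw [hecke_left hF _ (cen_mem ε), hecke_left hG _ (cen_mem ε),
    hecke_right hF _ (k := bar k') hk', hecke_right hG _ (k := bar k') hk',
    hecke_left hF _ (k := bar k) hk, hecke_left hG _ (k := bar k) hk, h]

theorem ext_of_suppIn {F G : Mp2 → ℂ} (hF : F ∈ heckeSpace (K0bar 3) (chi1 ξ hξ))
    (hG : G ∈ heckeSpace (K0bar 3) (chi1 ξ hξ)) {x : Mp2} (h : F x = G x)
    (hF' : SuppIn F x.mat) (hG' : SuppIn G x.mat) : F = G := by
  funext g
  by_cases h1 : F g = 0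
  · by_cases h2 : G g = 0
    · rw [h1, h2]
    · exact eq_of_suppIn hF hG h (hG' g h2)
  · exact eq_of_suppIn hF hG h (hF' g h1)

theorem eq_zero_of_inDC {F : Mp2 → ℂ} (hF : F ∈ heckeSpace (K0bar 3) (chi1 ξ hξ)) {x g : Mp2}
    (h : F x = 0) (hg : InDC x.mat g.mat) : F g = 0 :=
  eq_of_suppIn hF (zero_mem _) h hg

/-- A function of the Hecke algebra vanishes at `(y(r), 1) p` if `r ∈ 2ℤ₂ˣ` and `p` conjugates
`(x(2), 1)` into the kernel of `χ₁`. -/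
theorem hecke_yMat_mul_eq_zero {f : Mp2 → ℂ} (hf : f ∈ heckeSpace (K0bar 3) (chi1 ξ hξ)) {r : ℚ_[2]}
    (hr : ‖r‖ = 1 / 2) {p q : Mp2} (hq : q.mat ∈ K0 3) (hq1 : chiExt ξ hξ q = 1)
    (h : bar (xMat 2) * p = p * q) : f (bar (yMat r) * p) = 0 := by
  obtain ⟨hm, hc⟩ := chiExt_yMat_odd_conj ξ hξ hr
  -- One and the same element is reached by an element of `S` with `χ₁ = -1` on the left and by one
  -- with `χ₁ = 1` on the right, so the value equals its negative.
  have e : (bar (yMat r) * bar (xMat 2) * bar (yMat (-r))) * (bar (yMat r) * p) =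
      (bar (yMat r) * p) * q := by
    rw [mul_assoc, bar_yMat_neg, inv_mul_cancel_left, mul_assoc, h, mul_assoc]
  have e' := congrArg f e
  rw [hecke_left hf _ hm, hecke_right hf _ hq, hc, hq1, map_one, map_neg, map_one] at e'
  linear_combination (-1 / 2 : ℂ) * e'

theorem hecke_mul_yMat_eq_zero {f : Mp2 → ℂ} (hf : f ∈ heckeSpace (K0bar 3) (chi1 ξ hξ)) {r : ℚ_[2]}
    (hr : ‖r‖ = 1 / 2) {p q : Mp2} (hq : q.mat ∈ K0 3) (hq1 : chiExt ξ hξ q = 1)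
    (h : p * bar (xMat 2) = q * p) : f (p * bar (yMat r)) = 0 := by
  obtain ⟨hm, hc⟩ := chiExt_yMat_odd_conj ξ hξ (r := -r) (by rwa [norm_neg])
  rw [neg_neg] at hm hc
  have e : (p * bar (yMat r)) * (bar (yMat (-r)) * bar (xMat 2) * bar (yMat r)) =
      q * (p * bar (yMat r)) := by
    rw [bar_yMat_neg, ← mul_assoc q, ← h]; group
  have e' := congrArg f e
  rw [hecke_right hf _ hm, hecke_left hf _ hq, hc, hq1, map_one, map_neg, map_one] at e'
  linear_combination (-1 / 2 : ℂ) * e'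

theorem suppIn_heckeOne : SuppIn (heckeOne ξ hξ) 1 := fun g hg => by
  obtain ⟨k, k', hk, hk', rfl⟩ := doubleCosetFun_support hg
  exact ⟨k.mat, hk, k'.mat, hk', rfl⟩

theorem suppIn_heckeV : SuppIn (heckeV ξ hξ) (yMat 4) := fun g hg => by
  obtain ⟨k, k', hk, hk', rfl⟩ := doubleCosetFun_support hg
  exact ⟨k.mat, hk, k'.mat, hk', rfl⟩

theorem suppIn_heckeU₁ : SuppIn (heckeU₁ ξ hξ) wHalf.mat := fun g hg => by
  obtain ⟨k, k', hk, hk', rfl⟩ := heckeU₁_support ξ hξ hg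
  exact ⟨k.mat, hk, k'.mat, hk', rfl⟩

theorem suppIn_heckeU₂ : SuppIn (heckeU₂ ξ hξ) wQuarter.mat := fun g hg => by
  obtain ⟨k, k', hk, hk', rfl⟩ := heckeU₂_support ξ hξ hg
  exact ⟨k.mat, hk, k'.mat, hk', rfl⟩

variable (μ : Measure Mp2) [μ.IsHaarMeasure] (hμ : μ (K0bar 3 : Set Mp2) = 1)

include hμ

theorem suppIn_heckeV_conv {F : Mp2 → ℂ} (hF : F ∈ heckeSpace (K0bar 3) (chi1 ξ hξ)) {A : SL2}
    (h : SuppIn F A) : SuppIn (conv μ (heckeV ξ hξ) F) (yMat 4 * A) := by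
  intro g hg
  rw [heckeV_conv μ hμ hF] at hg
  have := (h _ hg).yMat_four
  rwa [mat_mul, bar_mat, yMat_neg, mul_inv_cancel_left] at this

theorem support_heckeU₁_conv {F : Mp2 → ℂ} (hF : F ∈ heckeSpace (K0bar 3) (chi1 ξ hξ)) {A : SL2}
    (h : SuppIn F A) {g : Mp2} (hg : conv μ (heckeU₁ ξ hξ) F g ≠ 0) :
    ∃ s : ℚ_[2], ‖s‖ ≤ 1 ∧ InDC (wHalf.mat * (xMat s * A)) g.mat := by
  have key : ∀ B : SL2, InDC A (wHalf.mat⁻¹ * B) →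
      ∃ s : ℚ_[2], ‖s‖ ≤ 1 ∧ InDC (wHalf.mat * (xMat s * A)) B := by
    rintro B ⟨k, hk, k', hk', e⟩
    obtain ⟨l, hl, s, hs, e'⟩ := wHalf_mul hk
    refine ⟨s, hs, l, hl, k', hk', ?_⟩
    rw [inv_mul_eq_iff_eq_mul, ← mul_assoc, ← mul_assoc, e'] at e
    rw [e]; group
  rw [heckeU₁_conv μ hμ hF] at hg
  by_cases h1 : F (wHalf⁻¹ * g) = 0
  · have h2 : F (wHalf⁻¹ * (bar (xMat (-1)) * g)) ≠ 0 := by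
      rintro h2; rw [h1, h2] at hg; simp at hg
    obtain ⟨s, hs, h3⟩ := key _ (h _ h2)
    refine ⟨s, hs, ?_⟩
    have := h3.mul_left (xMat_mem (s := 1) (by simp))
    rwa [mat_mul, bar_mat, xMat_neg, mul_inv_cancel_left] at this
  · exact key _ (h _ h1)

theorem support_heckeU₂_conv {F : Mp2 → ℂ} (hF : F ∈ heckeSpace (K0bar 3) (chi1 ξ hξ)) {A : SL2}
    (h : SuppIn F A) {g : Mp2} (hg : conv μ (heckeU₂ ξ hξ) F g ≠ 0) :
    ∃ s : ℚ_[2], ‖s‖ ≤ 1 / 8 ∧ InDC (wQuarter.mat * (yMat s * A)) g.mat := by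
  have key : ∀ B : SL2, InDC A (wQuarter.mat⁻¹ * B) →
      ∃ s : ℚ_[2], ‖s‖ ≤ 1 / 8 ∧ InDC (wQuarter.mat * (yMat s * A)) B := by
    rintro B ⟨k, hk, k', hk', e⟩
    obtain ⟨l, hl, s, hs, e'⟩ := wQuarter_mul hk
    refine ⟨s, hs, l, hl, k', hk', ?_⟩
    rw [inv_mul_eq_iff_eq_mul, ← mul_assoc, ← mul_assoc, e'] at e
    rw [e]; group
  rw [heckeU₂_conv μ hμ hF] at hg
  by_cases h1 : F (wQuarter⁻¹ * g) = 0
  · have h2 : F (wQuarter⁻¹ * (bar (yMat (-8)) * g)) ≠ 0 := by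
      rintro h2; rw [h1, h2] at hg; simp at hg
    obtain ⟨s, hs, h3⟩ := key _ (h _ h2)
    refine ⟨s, hs, ?_⟩
    have := h3.mul_left (yMat_mem (s := 8) (by rw [norm_eight]; norm_num))
    rwa [mat_mul, bar_mat, yMat_neg, mul_inv_cancel_left] at this
  · exact key _ (h _ h1)

/-- By `hA` the remaining parameter `s` is absorbed on the right of `A`, so the product of the two
double cosets is a single one. -/
theorem suppIn_heckeU₁_conv {F : Mp2 → ℂ} (hF : F ∈ heckeSpace (K0bar 3) (chi1 ξ hξ)) {A : SL2}
    (h : SuppIn F A) (hA : ∀ s : ℚ_[2], ‖s‖ ≤ 1 → ∃ k ∈ K0 3, xMat s * A = A * k) :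
    SuppIn (conv μ (heckeU₁ ξ hξ) F) (wHalf.mat * A) := by
  intro g hg
  obtain ⟨s, hs, h1⟩ := support_heckeU₁_conv μ hμ hF h hg
  obtain ⟨k, hk, e⟩ := hA s hs
  rw [e, ← mul_assoc] at h1
  exact ((InDC.refl _).mul_right hk).trans h1

theorem suppIn_heckeU₂_conv {F : Mp2 → ℂ} (hF : F ∈ heckeSpace (K0bar 3) (chi1 ξ hξ)) {A : SL2}
    (h : SuppIn F A) (hA : ∀ s : ℚ_[2], ‖s‖ ≤ 1 / 8 → ∃ k ∈ K0 3, yMat s * A = A * k) :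
    SuppIn (conv μ (heckeU₂ ξ hξ) F) (wQuarter.mat * A) := by
  intro g hg
  obtain ⟨s, hs, h1⟩ := support_heckeU₂_conv μ hμ hF h hg
  obtain ⟨k, hk, e⟩ := hA s hs
  rw [e, ← mul_assoc] at h1
  exact ((InDC.refl _).mul_right hk).trans h1

end Support

/-! ### The relations -/

theorem wHalf_mul_self : wHalf * wHalf = bar (-1) := by
  refine bar_wMat_sq (hilb_eq_zero (hilbertSym_eq_one_of 2 1 1 two_ne_zero ?_))
  rw [coe_half]; push_cast; norm_num

theorem wQuarter_mul_self : wQuarter * wQuarter = bar (-1) := by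
  refine bar_wMat_sq (hilb_eq_zero (hilbertSym_eq_one_of 2 0 1 two_ne_zero ?_))
  rw [coe_quarter]; push_cast; norm_num

theorem uVal_eq {ξ : ℂ} (hξ : ξ ^ 2 = -1) : uVal ξ = (1 - ξ) / 2 := by
  have h2 : (Real.sqrt 2 : ℂ) * (Real.sqrt 2 : ℂ) = 2 := by
    rw [← Complex.ofReal_mul, Real.mul_self_sqrt (by norm_num)]; norm_num
  rw [uVal, zeta8, map_div₀, map_add, map_one, conj_xi hξ, Complex.conj_ofReal, div_div, h2,
    sub_eq_add_neg]

/-- The point at which the two sides of the braid relation are compared: the right-hand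
factorization mirrors the word `v u₂ v`. -/
theorem bar_xMat_quarter : bar (xMat (1 / 4)) = bar (yMat 4) * wQuarter * bar (yMat 4) := by
  have := bar_xMat_eq (twoPow (-2))
  rw [coe_quarter] at this
  rw [this, wQuarter]; norm_num

section Relations

variable {ξ : ℂ} {hξ : ξ ^ 2 = -1}

/-- One has `w = (-I, 1) w⁻¹`, and `conj χ₁((-I, 1)) = conj ξ = ξ⁻¹`. -/
theorem hecke_inv_of_mul_self {f : Mp2 → ℂ} (hf : f ∈ heckeSpace (K0bar 3) (chi1 ξ hξ)) {w : Mp2}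
    (hw : w * w = bar (-1)) : f w⁻¹ = ξ * f w := by
  have h := hecke_left hf w⁻¹ (k := bar (-1)) neg_one_mem
  rw [← hw, mul_inv_cancel_right, hw, chiExt_neg_one, conj_xi hξ] at h
  rw [h]
  linear_combination (f w⁻¹) * hξ

theorem yMat_four_notMem : yMat 4 ∉ K0 3 := by
  rw [mem_K0_iff]
  simp [norm_four]; norm_num

theorem not_inDC_one_yMat_four : ¬ InDC 1 (yMat 4) := by
  rintro ⟨k, hk, k', hk', e⟩
  refine yMat_four_notMem ?_
  rw [e, mul_one]; exact mul_mem hk hk'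

theorem heckeV_one : heckeV ξ hξ 1 = 0 := by
  by_contra h
  exact not_inDC_one_yMat_four (suppIn_heckeV 1 h).symm

theorem heckeOne_yMat_four : heckeOne ξ hξ (bar (yMat 4)) = 0 := by
  by_contra h
  exact not_inDC_one_yMat_four (suppIn_heckeOne _ h)

theorem wHalf_mat_mul_yMat_four : wHalf.mat * yMat 4 = xMat (-1) * wHalf.mat := by
  have := congrArg Mp2.mat (wHalf_conj_xMat (-1))
  simp only [mat_mul, bar_mat] at this
  rw [this]; norm_num

theorem yMat_four_mul_wHalf_mat : yMat 4 * wHalf.mat = wHalf.mat * xMat (-1) := by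
  have := congrArg Mp2.mat (wHalf_conj_yMat 4)
  simp only [mat_mul, bar_mat] at this
  rw [this]; norm_num

theorem xMat_mul_yMat_four {s : ℚ_[2]} (hs : ‖s‖ ≤ 1) :
    ∃ k ∈ K0 3, xMat s * yMat 4 = yMat 4 * k :=
  ⟨_, yMat_four_conj_mem (xMat_mem hs), by rw [yMat_neg]; group⟩

variable (μ : Measure Mp2) [μ.IsHaarMeasure] (hμ : μ (K0bar 3 : Set Mp2) = 1)

include hμ

/-- Moving `y(-4)` through `w(1/2)` turns it into `x(1)`, an element of `S` at which `χ₁` is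
trivial. -/
theorem heckeV_conv_heckeU₁ : conv μ (heckeV ξ hξ) (heckeU₁ ξ hξ) = heckeU₁ ξ hξ := by
  have hu := heckeU₁_mem ξ hξ
  refine ext_of_suppIn (x := wHalf) (conv_mem μ hμ (heckeV_mem ξ hξ) hu) hu ?_ ?_ suppIn_heckeU₁
  · rw [heckeV_conv μ hμ hu, wHalf_conj_yMat, hecke_mul_xMat hu (by norm_num)]
  · refine (suppIn_heckeV_conv μ hμ hu suppIn_heckeU₁).congr ?_
    rw [yMat_four_mul_wHalf_mat]
    exact ((InDC.refl _).mul_right (xMat_mem (by simp))).symm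

theorem heckeU₁_conv_heckeV : conv μ (heckeU₁ ξ hξ) (heckeV ξ hξ) = heckeU₁ ξ hξ := by
  have hu := heckeU₁_mem ξ hξ
  have hv := heckeV_mem ξ hξ
  refine ext_of_suppIn (x := wHalf) (conv_mem μ hμ hu hv) hu ?_ ?_ suppIn_heckeU₁
  · rw [heckeU₁_conv μ hμ hv, inv_mul_cancel, heckeV_one, wHalf_conj_xMat, inv_mul_cancel_left,
      show -(4 * (-1 : ℚ_[2])) = 4 by norm_num, heckeV_yMat, heckeU₁_wHalf]
    ring
  · refine (suppIn_heckeU₁_conv μ hμ hv suppIn_heckeV fun s hs => xMat_mul_yMat_four hs).congr ?_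
    rw [wHalf_mat_mul_yMat_four]
    exact ((InDC.refl _).mul_left (xMat_mem (by simp))).symm

/-- The products `w(1/2) x(s) w(1/2) = -y(-4s)` lie in `K₀(4)`, which consists of `K₀(8)` and its
coset of `y(4)`. The values at `1` and at `y(4)` therefore decide. -/
theorem heckeU₁_conv_self : conv μ (heckeU₁ ξ hξ) (heckeU₁ ξ hξ) = heckeOne ξ hξ + heckeV ξ hξ := by
  have hu := heckeU₁_mem ξ hξ
  have hv := heckeV_mem ξ hξ
  have ho := heckeOne_mem ξ hξ
  have hF := conv_mem μ hμ hu hu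
  set F := conv μ (heckeU₁ ξ hξ) (heckeU₁ ξ hξ) with hFdef
  -- Two equal terms give `2 ξ · uVal² = -ξ² = 1`.
  have e1 : F 1 = 1 := by
    have h1 := hecke_inv_of_mul_self hu wHalf_mul_self
    rw [hFdef, heckeU₁_conv μ hμ hu, mul_one, mul_one, hecke_mul_xMat hu (by simp), h1,
      heckeU₁_wHalf, uVal_eq hξ]
    linear_combination (ξ / 2 - 1) * hξ
  -- Since `𝒱 * 𝒰₁ = 𝒰₁`, the square is invariant under left translation by `y(-4)`, and its value
  -- at `y(4)` is that at `1`.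
  have hvF : ∀ h, F (bar (yMat (-4)) * h) = F h := by
    intro h
    rw [← heckeV_conv μ hμ hF, hFdef, ← conv_assoc μ hμ hv hu hu, heckeV_conv_heckeU₁ μ hμ]
  have e4 : F (bar (yMat 4)) = 1 := by
    rw [← hvF, ← bar_yMat_add, neg_add_cancel, bar_yMat_zero, e1]
  -- the support lies in `K₀(4)`
  have hsupp : ∀ g, F g ≠ 0 → InDC 1 g.mat ∨ InDC (yMat 4) g.mat := by
    intro g hg
    obtain ⟨s, hs, h⟩ := support_heckeU₁_conv μ hμ hu suppIn_heckeU₁ hg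
    have em : wHalf.mat * (xMat s * wHalf.mat) = -yMat (-(4 * s)) := by
      have h1 := congrArg Mp2.mat (wHalf_conj_xMat s)
      have h2 := congrArg Mp2.mat wHalf_mul_self
      simp only [mat_mul, bar_mat] at h1 h2
      rw [h1, ← mul_assoc, h2, neg_one_mul]
    rw [em] at h
    have h := (InDC.neg _).trans h
    have h4 : ‖-(4 * s)‖ ≤ ‖(4 : ℚ_[2])‖ := by
      rw [norm_neg, norm_mul]; nlinarith [norm_nonneg (4 : ℚ_[2])]
    rcases even_or_odd_scaled (by norm_num) h4 with h' | h' <;> rw [norm_four] at h'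
    · left
      refine InDC.trans ?_ h
      simpa using (InDC.refl 1).mul_left (yMat_mem (by linarith : ‖-(4 * s)‖ ≤ 1 / 8))
    · right
      refine InDC.trans ?_ h
      have := (InDC.refl (yMat 4)).mul_left (yMat_mem (by linarith : ‖-(4 * s) - 4‖ ≤ 1 / 8))
      rwa [← yMat_add, sub_add_cancel] at this
  have hG := add_mem ho hv
  have q1 : F 1 = (heckeOne ξ hξ + heckeV ξ hξ) 1 := by
    rw [Pi.add_apply, heckeOne_one, heckeV_one, e1, add_zero]
  have q4 : F (bar (yMat 4)) = (heckeOne ξ hξ + heckeV ξ hξ) (bar (yMat 4)) := by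
    rw [Pi.add_apply, heckeOne_yMat_four, heckeV_yMat, e4, zero_add]
  have hcase : ∀ g, InDC 1 g.mat ∨ InDC (yMat 4) g.mat → F g = (heckeOne ξ hξ + heckeV ξ hξ) g := by
    rintro g (h | h)
    · exact eq_of_suppIn hF hG q1 h
    · exact eq_of_suppIn hF hG q4 h
  funext g
  by_cases h1 : F g = 0
  · by_cases h2 : (heckeOne ξ hξ + heckeV ξ hξ) g = 0
    · rw [h1, h2]
    · apply hcase
      by_cases h3 : heckeOne ξ hξ g = 0
      · right
        rw [Pi.add_apply, h3, zero_add] at h2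
        exact suppIn_heckeV g h2
      · exact Or.inl (suppIn_heckeOne g h3)
  · exact hcase g (hsupp g h1)

omit hμ [μ.IsHaarMeasure] in
/-- Functions of the Hecke algebra vanish at `(x(t), 1)` if `t ∈ (1/2)ℤ₂ˣ`. -/
theorem hecke_xMat_eq_zero {f : Mp2 → ℂ} (hf : f ∈ heckeSpace (K0bar 3) (chi1 ξ hξ)) {t : ℚ_[2]}
    (ht : ‖t‖ = 2) : f (bar (xMat t)) = 0 := by
  have t0 : t ≠ 0 := by rintro rfl; norm_num at ht
  have n : ‖-(2 / t ^ 2)‖ ≤ 1 / 8 := by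
    rw [norm_neg, norm_div, norm_pow, ht, norm_two]; norm_num
  have e := bar_xMat_eq (Units.mk0 t t0)
  rw [Units.val_mk0] at e
  -- In `x(t) = y(1/t) w(t) y(1/t)` the parameter `1/t` has norm `1/2`, and `x(2)` passes through
  -- `w(t)` as `y(-2/t²)`, where `2/t² ∈ 8ℤ₂`; so `hecke_yMat_mul_eq_zero` applies.
  rw [e, mul_assoc]
  refine hecke_yMat_mul_eq_zero hf (by rw [norm_inv, ht]; norm_num) (yMat_mem n)
    (chiExt_yMat ξ hξ n) ?_
  have h := bar_xMat_mul_wMat 2 (Units.mk0 t t0)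
  rw [Units.val_mk0] at h
  rw [← mul_assoc, h, mul_assoc, mul_assoc, ← bar_yMat_add, ← bar_yMat_add, add_comm]

/-- The products are `-x(-s/16)` with `s ∈ 8ℤ₂`. They lie in `S` if `s ∈ 16ℤ₂`; otherwise the
parameter is in `(1/2)ℤ₂ˣ`, where Hecke functions vanish. The value at `1` is again `2 ξ · uVal²`.
-/
theorem heckeU₂_conv_self : conv μ (heckeU₂ ξ hξ) (heckeU₂ ξ hξ) = heckeOne ξ hξ := by
  have hu := heckeU₂_mem ξ hξ
  have hF := conv_mem μ hμ hu hu
  refine ext_of_suppIn (x := 1) hF (heckeOne_mem ξ hξ) ?_ ?_ suppIn_heckeOne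
  · have h1 := hecke_inv_of_mul_self hu wQuarter_mul_self
    rw [heckeU₂_conv μ hμ hu, mul_one, mul_one,
      hecke_mul_yMat hu (by rw [norm_neg, norm_eight]; norm_num), h1,
      heckeU₂_wQuarter, uVal_eq hξ, heckeOne_one]
    linear_combination (ξ / 2 - 1) * hξ
  · intro g hg
    obtain ⟨s, hs, h⟩ := support_heckeU₂_conv μ hμ hu suppIn_heckeU₂ hg
    have em : wQuarter.mat * (yMat s * wQuarter.mat) = -xMat (-(s / 16)) := by
      have h1 := congrArg Mp2.mat (wQuarter_conj_yMat s)
      have h2 := congrArg Mp2.mat wQuarter_mul_self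
      simp only [mat_mul, bar_mat] at h1 h2
      rw [h1, ← mul_assoc, h2, neg_one_mul]
    rw [em] at h
    have h := (InDC.neg _).trans h
    have h16 : ‖-(s / 16)‖ = 16 * ‖s‖ := by
      rw [norm_neg, norm_div, show (16 : ℚ_[2]) = 2 * 8 by norm_num, norm_mul, norm_two, norm_eight]
      ring
    rcases even_or_odd_scaled (s := s) (c := 8) (by norm_num) (by rw [norm_eight]; linarith)
      with h' | h' <;> rw [norm_eight] at h'
    · refine InDC.trans ?_ h
      simpa using (InDC.refl 1).mul_left (xMat_mem (by rw [h16]; linarith : ‖-(s / 16)‖ ≤ 1))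
    · refine absurd (eq_zero_of_inDC hF (x := bar (xMat (-(s / 16)))) ?_ h) hg
      refine hecke_xMat_eq_zero hF ?_
      rw [h16]
      have : ‖s‖ = 1 / 8 := by
        rw [show s = 8 + (s - 8) by ring, Padic.add_eq_max_of_ne, norm_eight, max_eq_left] <;>
        [norm_num; linarith; (rw [norm_eight]; intro h; rw [← h] at h'; norm_num at h')]
      rw [this]; norm_num

/-- Both sides live on the double coset of `x(1/4)`. At `x(1/4)` the right side has one surviving
term, `uVal`, and the left side two, with sum `uVal² (ξ + 1)`; these agree because `(1 - ξ)(1 + ξ) =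
2`. -/
theorem hecke_braid :
    conv μ (conv μ (heckeU₂ ξ hξ) (heckeV ξ hξ)) (heckeU₂ ξ hξ) =
      conv μ (conv μ (heckeV ξ hξ) (heckeU₂ ξ hξ)) (heckeV ξ hξ) := by
  have hu := heckeU₂_mem ξ hξ
  have hv := heckeV_mem ξ hξ
  have hvu := conv_mem μ hμ hv hu
  have huv := conv_mem μ hμ hu hv
  have hQ := bar_xMat_quarter
  have hQ' : bar (xMat (-(1 / 4))) = bar (yMat (-4)) * (wQuarter⁻¹ * bar (yMat (-4))) := by
    rw [bar_xMat_neg, hQ, bar_yMat_neg]; group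
  rw [conv_assoc μ hμ hu hv hu, conv_assoc μ hμ hv hu hv]
  refine ext_of_suppIn (x := bar (xMat (1 / 4))) (conv_mem μ hμ hu hvu) (conv_mem μ hμ hv huv)
    ?_ ?_ ?_
  · have eG : conv μ (heckeV ξ hξ) (conv μ (heckeU₂ ξ hξ) (heckeV ξ hξ)) (bar (xMat (1 / 4))) =
        uVal ξ := by
      -- As `y(4)` normalizes `K₀(8)`, its double coset is `K₀(8) y(4)`; membership would force
      -- `x(1/2) ∈ K₀(8)`.
      have hz : heckeV ξ hξ (bar (xMat (1 / 2)) * bar (yMat 4)) = 0 := by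
        by_contra h
        obtain ⟨k, hk, k', hk', e⟩ := suppIn_heckeV _ h
        have h1 : xMat (1 / 2) ∈ K0 3 := by
          simp only [mat_mul, bar_mat] at e
          rw [← mul_inv_eq_iff_eq_mul.2 (rfl : xMat (1 / 2) * yMat 4 = _), e, ← yMat_neg, mul_assoc,
            mul_assoc, ← mul_assoc (yMat 4)]
          exact mul_mem hk (yMat_four_conj_mem' hk')
        have := (mem_K0_iff.1 h1).2.1
        rw [xMat_01, norm_div, norm_two, norm_one] at this
        norm_num at this
      rw [heckeV_conv μ hμ huv, hQ, bar_yMat_neg, mul_assoc, inv_mul_cancel_left,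
        heckeU₂_conv μ hμ hv, inv_mul_cancel_left, ← mul_assoc (bar (yMat (-8))),
        wQuarter_conj_yMat, mul_assoc, inv_mul_cancel_left, show -(-8 / 16 : ℚ_[2]) = 1 / 2 by
          norm_num, hz, heckeV_yMat, add_zero, mul_one]
    rw [eG, heckeU₂_conv μ hμ hvu, heckeV_conv μ hμ hu, heckeV_conv μ hμ hu]
    have a1 : bar (yMat (-4)) * (wQuarter⁻¹ * bar (xMat (1 / 4))) =
        bar (yMat (-8)) * wQuarter⁻¹ := by
      rw [hQ, ← mul_assoc wQuarter⁻¹, ← mul_assoc wQuarter⁻¹, mul_assoc wQuarter⁻¹,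
        mul_assoc wQuarter⁻¹, wQuarter_conj_yMat, mul_assoc wQuarter, inv_mul_cancel_left,
        show -(4 / 16 : ℚ_[2]) = -(1 / 4) by norm_num, hQ', bar_yMat_neg 4,
        show (-8 : ℚ_[2]) = -4 + -4 by norm_num, bar_yMat_add, bar_yMat_neg 4]
      group
    have a2 : bar (yMat (-4)) * (wQuarter⁻¹ * (bar (yMat (-8)) * bar (xMat (1 / 4)))) =
        wQuarter * bar (yMat 8) := by
      have h8 : bar (yMat (-8)) * bar (xMat (1 / 4)) = bar (yMat (-4)) * wQuarter * bar (yMat 4) := by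
        rw [hQ, ← mul_assoc, ← mul_assoc, ← bar_yMat_add]; norm_num
      rw [h8, wQuarter_conj_yMat, mul_assoc, inv_mul_cancel_left,
        show -(-4 / 16 : ℚ_[2]) = 1 / 4 by norm_num, hQ, bar_yMat_neg,
        show (8 : ℚ_[2]) = 4 + 4 by norm_num, bar_yMat_add]
      group
    rw [a1, a2, hecke_yMat_mul hu (by rw [norm_neg, norm_eight]; norm_num),
      hecke_mul_yMat hu (by rw [norm_eight]; norm_num),
      hecke_inv_of_mul_self hu wQuarter_mul_self, heckeU₂_wQuarter, uVal_eq hξ]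
    linear_combination ((ξ - 1) / 4) * hξ
  · intro g hg
    obtain ⟨s, hs, h⟩ := support_heckeU₂_conv μ hμ hvu (suppIn_heckeV_conv μ hμ hu suppIn_heckeU₂) hg
    refine InDC.trans ?_ h
    -- `w y(s + 4) w = -x(t)` with `t` in `1/4 ℤ₂ˣ`
    set t : ℚ_[2] := -((s + 4) / 16) with ht
    have em : wQuarter.mat * (yMat s * (yMat 4 * wQuarter.mat)) = -xMat t := by
      have h1 := congrArg Mp2.mat (wQuarter_conj_yMat (s + 4))
      have h2 := congrArg Mp2.mat wQuarter_mul_self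
      simp only [mat_mul, bar_mat] at h1 h2
      rw [← mul_assoc (yMat s), ← yMat_add, h1, ← mul_assoc, h2, neg_one_mul]
    rw [em]
    refine InDC.trans ?_ (InDC.neg _)
    have n4 : ‖s + 4‖ = 1 / 4 := by
      rw [Padic.add_eq_max_of_ne, norm_four, max_eq_right]
      · norm_num
      · linarith
      · rw [norm_four]; intro h; rw [h] at hs; norm_num at hs
    have nt : ‖t‖ = 4 := by
      rw [ht, norm_neg, norm_div, n4, show (16 : ℚ_[2]) = 2 * 8 by norm_num, norm_mul, norm_two,
        norm_eight]
      norm_num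
    have t0 : t ≠ 0 := by intro h; rw [h] at nt; norm_num at nt
    have e := xMat_eq (Units.mk0 t t0)
    rw [Units.val_mk0] at e
    -- Every `x(t)` with `‖t‖ = 4` is in the double coset of `x(1/4)`: in `x(t) = y(1/t) w(t)
    -- y(1/t)` the outer factors differ from `y(4)` by elements of `K₀(8)`, and `w(t) = h(4t)
    -- w(1/4)` with `4t` a unit, which can be moved past `y(4)`.
    have ninv : ‖t⁻¹ - 4‖ ≤ 1 / 8 := by
      rcases even_or_odd_scaled (s := t⁻¹) (c := 4) (by norm_num)
        (by rw [norm_inv, nt, norm_four]) with h | h <;> rw [norm_four] at h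
      · rw [norm_inv, nt] at h; norm_num at h
      · linarith
    set u : ℚ_[2]ˣ := Units.mk0 (4 * t) (mul_ne_zero (by norm_num) t0) with hu4
    have nu : ‖(u : ℚ_[2])‖ = 1 := by
      rw [hu4, Units.val_mk0, norm_mul, nt, norm_four]; norm_num
    have ew : wMat (Units.mk0 t t0) = hMat u * wQuarter.mat := by
      rw [wQuarter, bar_mat]
      apply SL2_ext <;> simp [mul_00, mul_01, mul_10, mul_11, coe_quarter, hu4]
      field_simp
    have e2 : yMat t⁻¹ = yMat (t⁻¹ - 4) * yMat 4 := by rw [← yMat_add, sub_add_cancel]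
    have e3 : yMat t⁻¹ = yMat 4 * yMat (t⁻¹ - 4) := by rw [← yMat_add, add_sub_cancel]
    have ex : xMat t = yMat (t⁻¹ - 4) * (yMat 4 * hMat u * yMat (-4)) *
        (bar (xMat (1 / 4))).mat * yMat (t⁻¹ - 4) := by
      rw [hQ, e, ew]
      nth_rewrite 1 [e2]
      rw [e3, yMat_neg]
      simp only [mat_mul, bar_mat]
      group
    refine ⟨_, mul_mem (yMat_mem ninv) (yMat_four_conj_mem' (hMat_mem nu)), _, yMat_mem ninv, ex⟩
  · refine (suppIn_heckeV_conv μ hμ huv (suppIn_heckeU₂_conv μ hμ hv suppIn_heckeV ?_)).congr ?_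
    · intro s hs
      exact ⟨yMat s, yMat_mem hs, by rw [← yMat_add, ← yMat_add, add_comm]⟩
    · rw [hQ, mat_mul, mat_mul, bar_mat, mul_assoc]
      exact InDC.refl _

end Relations

/-! ### The homomorphism from the presented algebra -/

section Hom

variable {ξ : ℂ} {hξ : ξ ^ 2 = -1}

variable (μ : Measure Mp2) [μ.IsHaarMeasure] (hμ : μ (K0bar 3 : Set Mp2) = 1)

/-- Left convolution by an element of the Hecke algebra, as an endomorphism. -/
noncomputable def convLeft (f : heckeSpace (K0bar 3) (chi1 ξ hξ)) :
    Module.End ℂ (heckeSpace (K0bar 3) (chi1 ξ hξ)) where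
  toFun x := ⟨conv μ f x, conv_mem μ hμ f.2 x.2⟩
  map_add' x y := Subtype.ext (conv_add_right μ hμ f.2 x.2 y.2)
  map_smul' c x := Subtype.ext (conv_smul_right μ c f x)

variable (ξ hξ) in
/-- The elements of the Hecke algebra to which the generators go. -/
noncomputable def heckeGen : Gen → heckeSpace (K0bar 3) (chi1 ξ hξ)
  | Gen.u₁ => ⟨heckeU₁ ξ hξ, heckeU₁_mem ξ hξ⟩
  | Gen.u₂ => ⟨heckeU₂ ξ hξ, heckeU₂_mem ξ hξ⟩
  | Gen.v => ⟨heckeV ξ hξ, heckeV_mem ξ hξ⟩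

theorem convLeft_mul (f g h : heckeSpace (K0bar 3) (chi1 ξ hξ)) (e : conv μ f g = h) :
    convLeft μ hμ f * convLeft μ hμ g = convLeft μ hμ h := by
  ext1 x
  refine Subtype.ext ?_
  change conv μ f (conv μ g x) = conv μ h x
  rw [← e, conv_assoc μ hμ f.2 g.2 x.2]

theorem convLeft_add (f g : heckeSpace (K0bar 3) (chi1 ξ hξ)) :
    convLeft μ hμ (f + g) = convLeft μ hμ f + convLeft μ hμ g := by
  ext1 x
  exact Subtype.ext (conv_add_left μ hμ f.2 g.2 x.2)

variable (ξ hξ) in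
/-- The identity element of the Hecke algebra. -/
noncomputable def heckeId : heckeSpace (K0bar 3) (chi1 ξ hξ) := ⟨heckeOne ξ hξ, heckeOne_mem ξ hξ⟩

theorem convLeft_id : convLeft μ hμ (heckeId ξ hξ) = 1 := by
  ext1 x
  exact Subtype.ext (heckeOne_conv μ hμ x.2)

variable (ξ hξ) in
/-- The action of the presented algebra on the Hecke algebra by left convolution. -/
noncomputable def heckeAction :
    PresentedAlg →ₐ[ℂ] Module.End ℂ (heckeSpace (K0bar 3) (chi1 ξ hξ)) :=
  RingQuot.liftAlgHom ℂ ⟨FreeAlgebra.lift ℂ fun i => convLeft μ hμ (heckeGen ξ hξ i), by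
    intro a b h
    cases h with
    | u₁_sq =>
      simp only [pow_two, map_mul, map_add, map_one, FreeAlgebra.lift_ι_apply]
      rw [← convLeft_id μ hμ, ← convLeft_add]
      exact convLeft_mul μ hμ (heckeGen ξ hξ Gen.u₁) (heckeGen ξ hξ Gen.u₁)
        (heckeId ξ hξ + heckeGen ξ hξ Gen.v) (heckeU₁_conv_self μ hμ)
    | u₂_sq =>
      simp only [pow_two, map_mul, map_one, FreeAlgebra.lift_ι_apply]
      rw [← convLeft_id μ hμ]
      exact convLeft_mul μ hμ (heckeGen ξ hξ Gen.u₂) (heckeGen ξ hξ Gen.u₂) (heckeId ξ hξ)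
        (heckeU₂_conv_self μ hμ)
    | u₁_v =>
      simp only [map_mul, FreeAlgebra.lift_ι_apply]
      exact convLeft_mul μ hμ _ _ _ (heckeU₁_conv_heckeV μ hμ)
    | v_u₁ =>
      simp only [map_mul, FreeAlgebra.lift_ι_apply]
      exact convLeft_mul μ hμ _ _ _ (heckeV_conv_heckeU₁ μ hμ)
    | braid =>
      simp only [map_mul, FreeAlgebra.lift_ι_apply]
      rw [convLeft_mul μ hμ (heckeGen ξ hξ Gen.u₂) (heckeGen ξ hξ Gen.v)
          ⟨_, conv_mem μ hμ (heckeU₂_mem ξ hξ) (heckeV_mem ξ hξ)⟩ rfl,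
        convLeft_mul μ hμ (heckeGen ξ hξ Gen.v) (heckeGen ξ hξ Gen.u₂)
          ⟨_, conv_mem μ hμ (heckeV_mem ξ hξ) (heckeU₂_mem ξ hξ)⟩ rfl,
        convLeft_mul μ hμ _ _ ⟨_, conv_mem μ hμ (conv_mem μ hμ (heckeU₂_mem ξ hξ)
          (heckeV_mem ξ hξ)) (heckeU₂_mem ξ hξ)⟩ rfl]
      exact (convLeft_mul μ hμ _ _ _ (hecke_braid μ hμ).symm).symm⟩

theorem heckeAction_gen (i : Gen) :
    heckeAction ξ hξ μ hμ (gen i) = convLeft μ hμ (heckeGen ξ hξ i) := by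
  rw [heckeAction, gen, RingQuot.liftAlgHom_mkAlgHom_apply, FreeAlgebra.lift_ι_apply]

variable (ξ hξ) in
/-- The map from the presented algebra to the Hecke algebra. -/
noncomputable def heckeMap : PresentedAlg →ₗ[ℂ] heckeSpace (K0bar 3) (chi1 ξ hξ) :=
  (LinearMap.applyₗ (heckeId ξ hξ)).comp (heckeAction ξ hξ μ hμ).toLinearMap

theorem heckeMap_apply (a : PresentedAlg) :
    heckeMap ξ hξ μ hμ a = heckeAction ξ hξ μ hμ a (heckeId ξ hξ) := rfl

theorem heckeMap_one : heckeMap ξ hξ μ hμ 1 = heckeId ξ hξ := by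
  rw [heckeMap_apply, map_one]; rfl

theorem heckeMap_gen (i : Gen) : heckeMap ξ hξ μ hμ (gen i) = heckeGen ξ hξ i := by
  rw [heckeMap_apply, heckeAction_gen]
  exact Subtype.ext (conv_heckeOne μ hμ (heckeGen ξ hξ i).2)

theorem heckeMap_gen_mul (i : Gen) (a : PresentedAlg) :
    (heckeMap ξ hξ μ hμ (gen i * a) : Mp2 → ℂ) =
      conv μ (heckeGen ξ hξ i : Mp2 → ℂ) (heckeMap ξ hξ μ hμ a : Mp2 → ℂ) := by
  rw [heckeMap_apply, map_mul, heckeAction_gen]; rfl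

/-- An induction principle: the presented algebra is spanned by products of generators. -/
theorem presentedAlg_induction {p : PresentedAlg → Prop} (one : p 1)
    (smul : ∀ (c : ℂ) a, p a → p (c • a)) (add : ∀ a b, p a → p b → p (a + b))
    (gen_mul : ∀ i a, p a → p (gen i * a)) (a : PresentedAlg) : p a := by
  suffices h : ∀ (x : FreeAlgebra ℂ Gen) (b : PresentedAlg), p b →
      p (RingQuot.mkAlgHom ℂ HeckeRel x * b) by
    obtain ⟨x, rfl⟩ := RingQuot.mkAlgHom_surjective ℂ HeckeRel a
    simpa using h x 1 one
  intro x
  induction x using FreeAlgebra.induction with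
  | grade0 r =>
    intro b hb
    rw [AlgHom.commutes, ← Algebra.smul_def]
    exact smul r b hb
  | grade1 i => exact fun b hb => gen_mul i b hb
  | mul x y hx hy =>
    intro b hb
    rw [map_mul, mul_assoc]
    exact hx _ (hy b hb)
  | add x y hx hy =>
    intro b hb
    rw [map_add, add_mul]
    exact add _ _ (hx b hb) (hy b hb)

theorem heckeMap_mul (a b : PresentedAlg) : (heckeMap ξ hξ μ hμ (a * b) : Mp2 → ℂ) =
    conv μ (heckeMap ξ hξ μ hμ a : Mp2 → ℂ) (heckeMap ξ hξ μ hμ b : Mp2 → ℂ) := by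
  induction a using presentedAlg_induction with
  | one =>
    rw [one_mul, heckeMap_one]
    exact (heckeOne_conv μ hμ (heckeMap ξ hξ μ hμ b).2).symm
  | smul c a ih =>
    rw [smul_mul_assoc, map_smul, map_smul, Submodule.coe_smul, Submodule.coe_smul, ih,
      conv_smul_left]
  | add a a' ih ih' =>
    rw [add_mul, map_add, map_add, Submodule.coe_add, Submodule.coe_add, ih, ih',
      conv_add_left μ hμ (heckeMap ξ hξ μ hμ a).2 (heckeMap ξ hξ μ hμ a').2
        (heckeMap ξ hξ μ hμ b).2]
  | gen_mul i a ih =>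
    rw [mul_assoc, heckeMap_gen_mul, ih, heckeMap_gen_mul,
      conv_assoc μ hμ (heckeGen ξ hξ i).2 (heckeMap ξ hξ μ hμ a).2 (heckeMap ξ hξ μ hμ b).2]

end Hom

/-! ### Normal forms of words in the generators -/

/-- Names for the normal forms of words in the generators. -/
inductive NormalForm
  | diagPos (m : ℕ) (b : Bool)
  | diagNeg (m : ℕ) (a : Bool)
  | antiPos (m : ℕ)
  | antiNeg (m : ℕ) (a b : Bool)

namespace NormalForm

section Ring

variable {R : Type*} [Ring R] (u w v : R)

/-- The word with a given name, for elements `u`, `w`, `v` of a ring. -/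
def word : NormalForm → R
  | diagPos m b => (u * w) ^ m * cond b v 1
  | diagNeg m a => cond a v 1 * (w * ((u * w) ^ m * u))
  | antiPos m => (u * w) ^ m * u
  | antiNeg m a b => cond a v 1 * (w * ((u * w) ^ m * cond b v 1))

/-- The sums of at most two normal forms. -/
def ShortSum (x : R) : Prop :=
  (∃ n : NormalForm, x = n.word u w v) ∨
    ∃ n n' : NormalForm, x = n.word u w v + n'.word u w v

variable {u w v}

theorem word_shortSum (n : NormalForm) : ShortSum u w v (n.word u w v) := Or.inl ⟨n, rfl⟩

theorem mul_cond (hv : v * v = 1) (b : Bool) : v * cond b v 1 = cond (!b) v 1 := by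
  cases b <;> simp [hv]

/-- A leading `u` absorbs `v`; otherwise `v` toggles the `v` at the front, because `v² = 1`. -/
theorem v_mul_word (hv : v * v = 1) (h : v * u = u) (n : NormalForm) :
    ShortSum u w v (v * n.word u w v) := by
  rcases n with ⟨m, b⟩ | ⟨m, a⟩ | m | ⟨m, a, b⟩
  · rcases m with _ | m
    · rw [show v * (diagPos 0 b).word u w v = (diagPos 0 !b).word u w v by
        simp [word, mul_cond hv]]
      exact word_shortSum _
    · rw [show v * (diagPos (m + 1) b).word u w v = (diagPos (m + 1) b).word u w v by
        simp only [word]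
        rw [pow_succ', ← mul_assoc, ← mul_assoc, ← mul_assoc, h]]
      exact word_shortSum _
  · rw [show v * (diagNeg m a).word u w v = (diagNeg m !a).word u w v by
      simp only [word]
      rw [← mul_assoc, mul_cond hv]]
    exact word_shortSum _
  · rw [show v * (antiPos m).word u w v = (antiPos m).word u w v by
      rcases m with _ | m
      · simp [word, h]
      · simp only [word]
        rw [pow_succ', ← mul_assoc, ← mul_assoc, ← mul_assoc, h]]
    exact word_shortSum _
  · rw [show v * (antiNeg m a b).word u w v = (antiNeg m (!a) b).word u w v by
      simp only [word]
      rw [← mul_assoc, mul_cond hv]]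
    exact word_shortSum _

/-- A leading `w` cancels. Before `v w` the braid relation gives `w v w x = v w v x`, and the inner
`v` is absorbed by a following `u` or merges with the final `v`. -/
theorem w_mul_word (hw : w * w = 1) (hv : v * v = 1) (h : v * u = u)
    (hb : w * v * w = v * w * v) (n : NormalForm) : ShortSum u w v (w * n.word u w v) := by
  have hb' : ∀ x, w * (v * (w * x)) = v * (w * (v * x)) := fun x => by
    rw [← mul_assoc, ← mul_assoc, hb, mul_assoc, mul_assoc]
  have hw' : ∀ x, w * (w * x) = x := fun x => by rw [← mul_assoc, hw, one_mul]
  have hp : ∀ (m : ℕ) x, v * ((u * w) ^ (m + 1) * x) = (u * w) ^ (m + 1) * x := fun m x => by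
    rw [pow_succ', ← mul_assoc, ← mul_assoc, ← mul_assoc, h]
  rcases n with ⟨m, b⟩ | ⟨m, _ | _⟩ | m | ⟨m, _ | _, b⟩
  · exact Or.inl ⟨antiNeg m false b, by simp [word]⟩
  · exact Or.inl ⟨antiPos m, by simp [word, hw']⟩
  · refine Or.inl ⟨diagNeg m true, ?_⟩
    simp only [word, cond_true]
    rw [hb']
    rcases m with _ | m
    · simp [h]
    · rw [hp]
  · exact Or.inl ⟨diagNeg m false, by simp [word]⟩
  · exact Or.inl ⟨diagPos m b, by simp [word, hw']⟩
  · rcases m with _ | m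
    · refine Or.inl ⟨antiNeg 0 true (!b), ?_⟩
      simp only [word, cond_true, pow_zero, one_mul]
      rw [hb', mul_cond hv]
    · refine Or.inl ⟨antiNeg (m + 1) true b, ?_⟩
      simp only [word, cond_true]
      rw [hb', hp]

/-- A leading `v` disappears by `u v = u`, and before `w` the word simply grows. Only a leading `u`
produces two words, through `u² = 1 + v`. -/
theorem u_mul_word (hu : u * u = 1 + v) (h : u * v = u) (n : NormalForm) :
    ShortSum u w v (u * n.word u w v) := by
  have hc : ∀ (a : Bool) x, u * (cond a v 1 * x) = u * x := fun a x => by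
    cases a
    · simp
    · rw [cond_true, ← mul_assoc, h]
  have hp : ∀ (m : ℕ) x, u * (w * ((u * w) ^ m * x)) = (u * w) ^ (m + 1) * x := fun m x => by
    rw [pow_succ', mul_assoc, mul_assoc, ← mul_assoc u]
  have hq : ∀ (m : ℕ) x, u * ((u * w) ^ (m + 1) * x) =
      w * ((u * w) ^ m * x) + v * (w * ((u * w) ^ m * x)) := fun m x => by
    rw [← hp, ← mul_assoc, hu, add_mul, one_mul]
  rcases n with ⟨_ | m, b⟩ | ⟨m, a⟩ | ⟨_ | m⟩ | ⟨m, a, b⟩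
  · refine Or.inl ⟨antiPos 0, ?_⟩
    cases b <;> simp [word, h]
  · exact Or.inr ⟨antiNeg m false b, antiNeg m true b, by simp [word, hq]⟩
  · exact Or.inl ⟨antiPos (m + 1), by simp only [word]; rw [hc, hp]⟩
  · exact Or.inr ⟨diagPos 0 false, diagPos 0 true, by simp [word, hu]⟩
  · exact Or.inr ⟨diagNeg m false, diagNeg m true, by simp [word, hq]⟩
  · exact Or.inl ⟨diagPos (m + 1) b, by simp only [word]; rw [hc, hp]⟩

end Ring

/-- The normal form as an element of the presented algebra. -/
noncomputable def elt (n : NormalForm) : PresentedAlg :=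
  n.word (gen Gen.u₁) (gen Gen.u₂) (gen Gen.v)

end NormalForm

/-! ### The relations in the presented algebra and the span of the normal forms -/

theorem gen_u₁_sq : gen Gen.u₁ * gen Gen.u₁ = 1 + gen Gen.v := by
  have := RingQuot.mkAlgHom_rel ℂ HeckeRel.u₁_sq
  rwa [pow_two, map_mul, map_add, map_one] at this

theorem gen_u₂_sq : gen Gen.u₂ * gen Gen.u₂ = 1 := by
  have := RingQuot.mkAlgHom_rel ℂ HeckeRel.u₂_sq
  rwa [pow_two, map_mul, map_one] at this

theorem gen_u₁_mul_v : gen Gen.u₁ * gen Gen.v = gen Gen.u₁ := by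
  have := RingQuot.mkAlgHom_rel ℂ HeckeRel.u₁_v
  rwa [map_mul] at this

theorem gen_v_mul_u₁ : gen Gen.v * gen Gen.u₁ = gen Gen.u₁ := by
  have := RingQuot.mkAlgHom_rel ℂ HeckeRel.v_u₁
  rwa [map_mul] at this

theorem gen_braid :
    gen Gen.u₂ * gen Gen.v * gen Gen.u₂ = gen Gen.v * gen Gen.u₂ * gen Gen.v := by
  have := RingQuot.mkAlgHom_rel ℂ HeckeRel.braid
  rwa [map_mul, map_mul, map_mul, map_mul] at this

/-- This is a consequence of the defining relations: `v (1 + v) = v u₁² = u₁² = 1 + v`. -/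
theorem gen_v_sq : gen Gen.v * gen Gen.v = 1 := by
  have h : gen Gen.v * (gen Gen.u₁ * gen Gen.u₁) = gen Gen.u₁ * gen Gen.u₁ := by
    rw [← mul_assoc, gen_v_mul_u₁]
  rw [gen_u₁_sq, mul_add, mul_one, add_comm] at h
  exact add_right_cancel h

/-- The normal forms span the presented algebra. -/
theorem span_elt : Submodule.span ℂ (Set.range NormalForm.elt) = ⊤ := by
  rw [eq_top_iff]
  rintro a -
  have hs : ∀ x, NormalForm.ShortSum (gen Gen.u₁) (gen Gen.u₂) (gen Gen.v) x →
      x ∈ Submodule.span ℂ (Set.range NormalForm.elt) := by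
    rintro x (⟨n, rfl⟩ | ⟨n, n', rfl⟩)
    · exact Submodule.subset_span ⟨n, rfl⟩
    · exact add_mem (Submodule.subset_span ⟨n, rfl⟩) (Submodule.subset_span ⟨n', rfl⟩)
  induction a using presentedAlg_induction with
  | one => exact Submodule.subset_span ⟨.diagPos 0 false, by simp [NormalForm.elt, NormalForm.word]⟩
  | smul c a ih => exact Submodule.smul_mem _ c ih
  | add a b iha ihb => exact add_mem iha ihb
  | gen_mul i a ih =>
    induction ih using Submodule.span_induction with
    | mem x hx =>
      obtain ⟨n, rfl⟩ := hx
      refine hs _ ?_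
      cases i with
      | u₁ => exact n.u_mul_word gen_u₁_sq gen_u₁_mul_v
      | u₂ => exact n.w_mul_word gen_u₂_sq gen_v_sq gen_v_mul_u₁ gen_braid
      | v => exact n.v_mul_word gen_v_sq gen_v_mul_u₁
    | zero => rw [mul_zero]; exact zero_mem _
    | add x y _ _ hx hy => rw [mul_add]; exact add_mem hx hy
    | smul c x _ hx => rw [mul_smul_comm]; exact Submodule.smul_mem _ c hx

/-! ### The double cosets of the normal forms are distinct -/

/-- `4` or `0`, according to `b`. -/
noncomputable def fourIf (b : Bool) : ℚ_[2] := cond b 4 0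

@[simp] theorem fourIf_true : fourIf true = 4 := rfl

@[simp] theorem fourIf_false : fourIf false = 0 := rfl

/-- The representative of the double coset that belongs to a normal form. -/
noncomputable def NormalForm.mat : NormalForm → SL2
  | .diagPos m b => hMat (twoPow m) * yMat (fourIf b)
  | .diagNeg m a => yMat (fourIf a) * hMat (twoPow (-(m + 1)))
  | .antiPos m => wMat (twoPow (m - 1))
  | .antiNeg m a b => yMat (fourIf a) * wMat (twoPow (-2 - m)) * yMat (fourIf b)

/-- Bounds for the entries that depend only on the double coset if `0 ≤ i, j ≤ 3`. -/
def LevelLE (i j n : ℤ) (A : SL2) : Prop :=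
  ‖A 0 0‖ ≤ 2 ^ n ∧ ‖A 0 1‖ ≤ 2 ^ (n + j) ∧ ‖A 1 0‖ ≤ 2 ^ (n - i) ∧ ‖A 1 1‖ ≤ 2 ^ (n + j - i)

theorem norm_mul_le_zpow {x y : ℚ_[2]} {m n l : ℤ} (hx : ‖x‖ ≤ 2 ^ m) (hy : ‖y‖ ≤ 2 ^ n)
    (h : m + n ≤ l) : ‖x * y‖ ≤ (2 : ℝ) ^ l := by
  rw [norm_mul]
  calc ‖x‖ * ‖y‖ ≤ 2 ^ m * 2 ^ n := by gcongr
    _ = 2 ^ (m + n) := (zpow_add₀ two_ne_zero _ _).symm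
    _ ≤ 2 ^ l := zpow_le_zpow_right₀ one_le_two h

theorem mem_K0_iff_zpow {A : SL2} : A ∈ K0 3 ↔ ‖A 0 0‖ ≤ (2 : ℝ) ^ (0 : ℤ) ∧
    ‖A 0 1‖ ≤ (2 : ℝ) ^ (0 : ℤ) ∧ ‖A 1 0‖ ≤ (2 : ℝ) ^ (-3 : ℤ) ∧ ‖A 1 1‖ ≤ (2 : ℝ) ^ (0 : ℤ) := by
  rw [mem_K0_iff]
  norm_num [zpow_neg]

theorem LevelLE.mul_left {i j n : ℤ} (hi : 0 ≤ i) (hi' : i ≤ 3) {k A : SL2} (hk : k ∈ K0 3)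
    (h : LevelLE i j n A) : LevelLE i j n (k * A) := by
  obtain ⟨k1, k2, k3, k4⟩ := mem_K0_iff_zpow.1 hk
  obtain ⟨h1, h2, h3, h4⟩ := h
  refine ⟨?_, ?_, ?_, ?_⟩
  · rw [mul_00]
    exact norm_add_le_of_le (norm_mul_le_zpow k1 h1 (by lia)) (norm_mul_le_zpow k2 h3 (by lia))
  · rw [mul_01]
    exact norm_add_le_of_le (norm_mul_le_zpow k1 h2 (by lia)) (norm_mul_le_zpow k2 h4 (by lia))
  · rw [mul_10]
    exact norm_add_le_of_le (norm_mul_le_zpow k3 h1 (by lia)) (norm_mul_le_zpow k4 h3 (by lia))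
  · rw [mul_11]
    exact norm_add_le_of_le (norm_mul_le_zpow k3 h2 (by lia)) (norm_mul_le_zpow k4 h4 (by lia))

theorem LevelLE.mul_right {i j n : ℤ} (hj : 0 ≤ j) (hj' : j ≤ 3) {k A : SL2} (hk : k ∈ K0 3)
    (h : LevelLE i j n A) : LevelLE i j n (A * k) := by
  obtain ⟨k1, k2, k3, k4⟩ := mem_K0_iff_zpow.1 hk
  obtain ⟨h1, h2, h3, h4⟩ := h
  refine ⟨?_, ?_, ?_, ?_⟩
  · rw [mul_00]
    exact norm_add_le_of_le (norm_mul_le_zpow h1 k1 (by lia)) (norm_mul_le_zpow h2 k3 (by lia))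
  · rw [mul_01]
    exact norm_add_le_of_le (norm_mul_le_zpow h1 k2 (by lia)) (norm_mul_le_zpow h2 k4 (by lia))
  · rw [mul_10]
    exact norm_add_le_of_le (norm_mul_le_zpow h3 k1 (by lia)) (norm_mul_le_zpow h4 k3 (by lia))
  · rw [mul_11]
    exact norm_add_le_of_le (norm_mul_le_zpow h3 k2 (by lia)) (norm_mul_le_zpow h4 k4 (by lia))

/-- With `L_i = ℤ₂ ⊕ 2ⁱℤ₂`, the bounds of level `n` say that `A L_j ⊆ 2⁻ⁿ L_i`. The group `K₀(8)`
preserves `L_i` for `0 ≤ i ≤ 3`, so this relative position is an invariant of the double coset. -/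
theorem InDC.levelLE {i j n : ℤ} (hi : 0 ≤ i) (hi' : i ≤ 3) (hj : 0 ≤ j) (hj' : j ≤ 3)
    {A B : SL2} (h : InDC A B) (hA : LevelLE i j n A) : LevelLE i j n B := by
  obtain ⟨k, hk, k', hk', rfl⟩ := h
  exact (hA.mul_left hi hi' hk).mul_right hj hj' hk'

theorem norm_twoPow (m : ℤ) : ‖((twoPow m : ℚ_[2]ˣ) : ℚ_[2])‖ = 2 ^ (-m) := by
  rw [coe_twoPow, norm_two_zpow]

theorem norm_twoPow_inv (m : ℤ) : ‖((twoPow m : ℚ_[2]ˣ) : ℚ_[2])⁻¹‖ = 2 ^ m := by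
  rw [norm_inv, norm_twoPow, zpow_neg, inv_inv]

theorem norm_twoPow_inv_mul_four (m : ℤ) :
    ‖((twoPow m : ℚ_[2]ˣ) : ℚ_[2])⁻¹ * 4‖ = 2 ^ (m - 2) := by
  rw [norm_mul, norm_twoPow_inv, norm_four, zpow_sub₀ two_ne_zero, div_eq_mul_inv]
  norm_num

theorem norm_twoPow_mul_four (m : ℤ) :
    ‖((twoPow m : ℚ_[2]ˣ) : ℚ_[2]) * 4‖ = 2 ^ (-m - 2) := by
  rw [norm_mul, norm_twoPow, norm_four, zpow_sub₀ two_ne_zero, div_eq_mul_inv]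
  norm_num

theorem norm_four_mul_twoPow (m : ℤ) :
    ‖4 * ((twoPow m : ℚ_[2]ˣ) : ℚ_[2])‖ = 2 ^ (-m - 2) := by
  rw [mul_comm, norm_twoPow_mul_four]

theorem zpow_le_two_zpow_iff (m n : ℤ) : (2 : ℝ) ^ m ≤ 2 ^ n ↔ m ≤ n :=
  zpow_le_zpow_iff_right₀ one_lt_two

theorem zero_le_two_zpow (n : ℤ) : (0 : ℝ) ≤ 2 ^ n := by positivity

/-- The least `n` for which the entries of the representative satisfy the bounds of level `n`. -/
def NormalForm.level (i j : ℤ) : NormalForm → ℤ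
  | .diagPos m b => max (max (-m) (m + i - j)) (cond b (m - 2 + i) (-m))
  | .diagNeg m a => max (max (m + 1) (-(m + 1) + i - j)) (cond a (m - 1 + i) (m + 1))
  | .antiPos m => max (1 - m - j) (m - 1 + i)
  | .antiNeg m a b => max (max (m + 2 - j) (cond b m (m + 2 - j)))
      (max (cond a (m + i - j) (m + 2 - j))
        (if a ∧ b then if m = 0 then 0 else m - 2 + i else -m - 2 + i))

/-- The entry is `-2^(m+2) + 2^(2-m)`: its terms cancel for `m = 0`, and otherwise the second has
the larger norm. -/
theorem norm_lowerLeft_antiNeg (m : ℕ) : ‖-((twoPow (-2 - m) : ℚ_[2]ˣ) : ℚ_[2])⁻¹ +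
    4 * ((twoPow (-2 - m) : ℚ_[2]ˣ) : ℚ_[2]) * 4‖ = if m = 0 then 0 else 2 ^ ((m : ℤ) - 2) := by
  split_ifs with h
  · rw [h, coe_twoPow]; norm_num
  · have e : ‖4 * ((twoPow (-2 - m) : ℚ_[2]ˣ) : ℚ_[2]) * 4‖ = 2 ^ ((m : ℤ) - 2) := by
      rw [norm_mul, norm_four_mul_twoPow, norm_four, show (m : ℤ) - 2 = -(-2 - m) - 2 - 2 by ring,
        zpow_sub₀ two_ne_zero (-(-2 - (m : ℤ)) - 2) 2, div_eq_mul_inv]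
      norm_num [-neg_sub]
    have hlt : ‖-((twoPow (-2 - m) : ℚ_[2]ˣ) : ℚ_[2])⁻¹‖ <
        ‖4 * ((twoPow (-2 - m) : ℚ_[2]ˣ) : ℚ_[2]) * 4‖ := by
      rw [norm_neg, norm_twoPow_inv, e]
      exact zpow_lt_zpow_right₀ one_lt_two (by lia)
    rw [Padic.add_eq_max_of_ne hlt.ne, max_eq_right hlt.le, e]

theorem NormalForm.levelLE_mat_iff (x : NormalForm) (i j n : ℤ) :
    LevelLE i j n x.mat ↔ x.level i j ≤ n := by
  rcases x with ⟨m, _ | _⟩ | ⟨m, _ | _⟩ | m | ⟨m, _ | _, _ | _⟩ <;>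
  simp only [LevelLE, NormalForm.mat, NormalForm.level, mul_00, mul_01, mul_10, mul_11,
    yMat_00, yMat_01, yMat_10, yMat_11, wMat_00, wMat_01, wMat_10, wMat_11, hMat_00, hMat_01,
    hMat_10, hMat_11, fourIf_true, fourIf_false, mul_zero, zero_mul, one_mul, mul_one, add_zero,
    zero_add, norm_neg, mul_neg, neg_zero, ← sub_eq_add_neg, zero_sub,
    norm_twoPow,
    norm_twoPow_inv, norm_twoPow_mul_four, norm_four_mul_twoPow, norm_twoPow_inv_mul_four,
    zpow_le_two_zpow_iff, zero_le_two_zpow, norm_zero, true_and, and_true, cond_true, cond_false]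
  all_goals try simp
  all_goals try omega
  -- What remains is `antiNeg m true true`, the one representative with an entry that is a sum of
  -- two nonzero terms.
  rw [norm_lowerLeft_antiNeg]
  split_ifs with h
  · simp only [zero_le_two_zpow, true_and]
    omega
  · rw [zpow_le_two_zpow_iff]
    omega

set_option maxHeartbeats 4000000 in
-- The four extreme pairs of lattices already separate the normal forms; each pair of shapes is a
-- problem in integer linear arithmetic.
theorem NormalForm.eq_of_level {x y : NormalForm} (h1 : x.level 0 0 = y.level 0 0)
    (h2 : x.level 0 3 = y.level 0 3) (h3 : x.level 3 0 = y.level 3 0)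
    (h4 : x.level 3 3 = y.level 3 3) : x = y := by
  rcases x with ⟨m, _ | _⟩ | ⟨m, _ | _⟩ | m | ⟨m, _ | _, _ | _⟩ <;>
  rcases y with ⟨m', _ | _⟩ | ⟨m', _ | _⟩ | m' | ⟨m', _ | _, _ | _⟩ <;>
  simp only [NormalForm.level, cond_true, cond_false, and_true, and_false, if_true, if_false,
    NormalForm.diagPos.injEq, NormalForm.diagNeg.injEq, NormalForm.antiPos.injEq,
    NormalForm.antiNeg.injEq, reduceCtorEq, Bool.true_eq_false, Bool.false_eq_true] at h1 h2 h3 h4 ⊢ <;>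
  omega

/-- Different normal forms have different double cosets. -/
theorem NormalForm.eq_of_inDC {x y : NormalForm} (h : InDC x.mat y.mat) : x = y := by
  have key : ∀ i j : ℤ, 0 ≤ i → i ≤ 3 → 0 ≤ j → j ≤ 3 → x.level i j = y.level i j := by
    intro i j hi hi' hj hj'
    apply le_antisymm
    · rw [← x.levelLE_mat_iff]
      exact h.symm.levelLE hi hi' hj hj' ((y.levelLE_mat_iff _ _ _).2 le_rfl)
    · rw [← y.levelLE_mat_iff]
      exact h.levelLE hi hi' hj hj' ((x.levelLE_mat_iff _ _ _).2 le_rfl)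
  exact eq_of_level (key 0 0 (by lia) (by lia) (by lia) (by lia))
    (key 0 3 (by lia) (by lia) (by lia) (by lia)) (key 3 0 (by lia) (by lia) (by lia) (by lia))
    (key 3 3 (by lia) (by lia) (by lia) (by lia))

/-! ### Double cosets outside the normal forms do not support functions of the Hecke algebra -/

theorem exists_twoPow_mul (t : ℚ_[2]ˣ) :
    ∃ (m : ℤ) (u : ℚ_[2]ˣ), ‖(u : ℚ_[2])‖ = 1 ∧ t = twoPow m * u := by
  refine ⟨(t : ℚ_[2]).valuation, (twoPow (t : ℚ_[2]).valuation)⁻¹ * t, ?_,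
    (mul_inv_cancel_left _ _).symm⟩
  have h := Padic.norm_eq_zpow_neg_valuation t.ne_zero
  rw [Units.val_mul, norm_mul, h, Units.val_inv_eq_inv_val, norm_twoPow_inv, zpow_neg]
  push_cast
  exact mul_inv_cancel₀ (by positivity)

theorem hMat_mul (s t : ℚ_[2]ˣ) : hMat (s * t) = hMat s * hMat t := by
  apply SL2_ext <;> simp [mul_00, mul_01, mul_10, mul_11, mul_comm]

theorem wMat_mul (s t : ℚ_[2]ˣ) : wMat (s * t) = hMat t * wMat s := by
  apply SL2_ext <;> simp [mul_00, mul_01, mul_10, mul_11, mul_comm]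

/-- Modulo `8` an even number is `0` or `4`, which `fourIf` covers, or `±2`, which is the case of
norm `1/2`. -/
theorem exists_fourIf {r : ℚ_[2]} (hr : ‖r‖ ≤ 1 / 2) :
    ‖r‖ = 1 / 2 ∨ ∃ b, ‖r - fourIf b‖ ≤ 1 / 8 := by
  rcases even_or_odd_scaled (s := r) (c := 2) two_ne_zero (by rw [norm_two]; linarith)
    with h | h <;> rw [norm_two] at h
  · right
    rcases even_or_odd_scaled (s := r) (c := 4) (by norm_num) (by rw [norm_four]; linarith)
      with h | h <;> rw [norm_four] at h
    · exact ⟨false, by rw [fourIf_false, sub_zero]; linarith⟩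
    · exact ⟨true, by rw [fourIf_true]; linarith⟩
  · left
    have h2 : ‖(2 : ℚ_[2])‖ = 1 / 2 := by rw [norm_two]; norm_num
    have hlt : ‖r - 2‖ < ‖(2 : ℚ_[2])‖ := by linarith
    rw [← sub_add_cancel r 2, Padic.add_eq_max_of_ne hlt.ne, max_eq_right hlt.le, h2]

section Classification

variable (ξ : ℂ) (hξ : ξ ^ 2 = -1)

/-- All functions of the Hecke algebra vanish above `A`. -/
def Vanishes (A : SL2) : Prop :=
  ∀ f ∈ heckeSpace (K0bar 3) (chi1 ξ hξ), ∀ g : Mp2, g.mat = A → f g = 0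

/-- `A` is in the double coset of a normal form, or all functions of the Hecke algebra vanish
above `A`. -/
def Classified (A : SL2) : Prop := (∃ n : NormalForm, InDC n.mat A) ∨ Vanishes ξ hξ A

variable {ξ hξ}

theorem Classified.congr {A B : SL2} (h : Classified ξ hξ A) (hAB : InDC A B) :
    Classified ξ hξ B := by
  rcases h with ⟨n, hn⟩ | h
  · exact Or.inl ⟨n, hn.trans hAB⟩
  · refine Or.inr fun f hf g hg => eq_zero_of_inDC hf (h f hf (bar A) rfl) ?_
    rwa [hg, bar_mat]

theorem vanishes_yMat_mul {r : ℚ_[2]} (hr : ‖r‖ = 1 / 2) {P : SL2} {q : Mp2} (hq : q.mat ∈ K0 3)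
    (hq1 : chiExt ξ hξ q = 1) (h : bar (xMat 2) * bar P = bar P * q) :
    Vanishes ξ hξ (yMat r * P) := fun f hf g hg =>
  eq_zero_of_inDC hf (hecke_yMat_mul_eq_zero hf hr hq hq1 h) (by rw [hg]; exact InDC.refl _)

theorem vanishes_mul_yMat {r : ℚ_[2]} (hr : ‖r‖ = 1 / 2) {P : SL2} {q : Mp2} (hq : q.mat ∈ K0 3)
    (hq1 : chiExt ξ hξ q = 1) (h : bar P * bar (xMat 2) = q * bar P) :
    Vanishes ξ hξ (P * yMat r) := fun f hf g hg =>
  eq_zero_of_inDC hf (hecke_mul_yMat_eq_zero hf hr hq hq1 h) (by rw [hg]; exact InDC.refl _)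

theorem classified_mat (n : NormalForm) : Classified ξ hξ n.mat := Or.inl ⟨n, InDC.refl _⟩

theorem classified_wMat_twoPow (m : ℤ) : Classified ξ hξ (wMat (twoPow m)) := by
  rcases le_or_gt (-1) m with h | h
  · obtain ⟨k, hk⟩ := Int.eq_ofNat_of_zero_le (show 0 ≤ m + 1 by lia)
    obtain rfl : m = k - 1 := by lia
    exact classified_mat (.antiPos k)
  · obtain ⟨k, hk⟩ := Int.eq_ofNat_of_zero_le (show 0 ≤ -2 - m by lia)
    obtain rfl : m = -2 - k := by lia
    have := classified_mat (ξ := ξ) (hξ := hξ) (.antiNeg k false false)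
    simpa [NormalForm.mat, yMat_zero] using this

theorem classified_wMat (t : ℚ_[2]ˣ) : Classified ξ hξ (wMat t) := by
  obtain ⟨m, u, hu, rfl⟩ := exists_twoPow_mul t
  rw [wMat_mul]
  exact (classified_wMat_twoPow m).congr ((InDC.refl _).mul_left (hMat_mem hu))

theorem norm_div_twoPow_sq (x : ℚ_[2]) (m : ℤ) :
    ‖x / ((twoPow m : ℚ_[2]ˣ) : ℚ_[2]) ^ 2‖ = ‖x‖ * 2 ^ (2 * m) := by
  rw [div_eq_mul_inv, ← inv_pow, norm_mul, norm_pow, norm_twoPow_inv, ← zpow_natCast, ← zpow_mul]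
  congr 2; push_cast; ring

theorem norm_mul_twoPow_sq (x : ℚ_[2]) (m : ℤ) :
    ‖x * ((twoPow m : ℚ_[2]ˣ) : ℚ_[2]) ^ 2‖ = ‖x‖ * 2 ^ (-(2 * m)) := by
  rw [norm_mul, norm_pow, norm_twoPow, ← zpow_natCast, ← zpow_mul]
  congr 2; push_cast; ring

theorem two_zpow_le_one {m : ℤ} (h : m ≤ 0) : (2 : ℝ) ^ m ≤ 1 := zpow_le_one_of_nonpos₀ one_le_two h

theorem two_zpow_le_quarter {m : ℤ} (h : m ≤ -2) : (2 : ℝ) ^ m ≤ 1 / 4 := by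
  calc (2 : ℝ) ^ m ≤ 2 ^ (-2 : ℤ) := zpow_le_zpow_right₀ one_le_two h
    _ = 1 / 4 := by norm_num

theorem classified_hMat_twoPow (m : ℤ) : Classified ξ hξ (hMat (twoPow m)) := by
  rcases le_or_gt 0 m with h | h
  · obtain ⟨k, rfl⟩ := Int.eq_ofNat_of_zero_le h
    have := classified_mat (ξ := ξ) (hξ := hξ) (.diagPos k false)
    simpa [NormalForm.mat, yMat_zero] using this
  · obtain ⟨k, hk⟩ := Int.eq_ofNat_of_zero_le (show 0 ≤ -m - 1 by lia)
    obtain rfl : m = -(k + 1) := by lia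
    have := classified_mat (ξ := ξ) (hξ := hξ) (.diagNeg k false)
    simpa only [NormalForm.mat, fourIf_false, yMat_zero, one_mul] using this

theorem yMat_sub_mul (r s : ℚ_[2]) : yMat r = yMat (r - s) * yMat s := by
  rw [← yMat_add, sub_add_cancel]

theorem yMat_mul_sub (r s : ℚ_[2]) : yMat r = yMat s * yMat (r - s) := by
  rw [← yMat_add, add_sub_cancel]

/-- For `m ≥ 1` the factor `y(r)` passes through `h(2^m)` into `S`. For `m ≤ 0` it is `x(2)` that
passes through, becoming an integral `x(2 · 4^(-m))`; so functions vanish if `r ∈ 2ℤ₂ˣ`, and the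
other `r` may be replaced by `0` or `4`. -/
theorem classified_yMat_mul_hMat_twoPow {r : ℚ_[2]} (hr : ‖r‖ ≤ 1 / 2) (m : ℤ) :
    Classified ξ hξ (yMat r * hMat (twoPow m)) := by
  rcases le_or_gt 1 m with h | h
  · rw [yMat_mul_hMat]
    refine (classified_hMat_twoPow m).congr ((InDC.refl _).mul_right (yMat_mem ?_))
    rw [norm_mul_twoPow_sq]
    have := two_zpow_le_quarter (show -(2 * m) ≤ -2 by lia)
    nlinarith [norm_nonneg r]
  rcases exists_fourIf hr with hr | ⟨b, hb⟩
  · have n : ‖2 / ((twoPow m : ℚ_[2]ˣ) : ℚ_[2]) ^ 2‖ ≤ 1 := by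
      rw [norm_div_twoPow_sq, norm_two]
      have := two_zpow_le_one (show 2 * m ≤ 0 by lia)
      linarith
    refine Or.inr (vanishes_yMat_mul hr (q := bar (xMat (2 / (twoPow m : ℚ_[2]) ^ 2)))
      (xMat_mem n) (chiExt_xMat ξ hξ n) (bar_xMat_conj ?_))
    rw [bar_mat, xMat_mul_hMat]; congr 2; ring
  · rw [yMat_sub_mul r (fourIf b), mul_assoc]
    refine Classified.congr ?_ ((InDC.refl _).mul_left (yMat_mem hb))
    -- The exponent `0` is named by `diagPos 0`, as the exponents of `diagNeg` begin with `-1`.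
    rcases eq_or_lt_of_le (show m ≤ 0 by lia) with rfl | h0
    · have := classified_mat (ξ := ξ) (hξ := hξ) (.diagPos 0 b)
      have e : hMat (twoPow 0) = 1 := by apply SL2_ext <;> simp [coe_twoPow]
      rw [NormalForm.mat, Nat.cast_zero, e, one_mul] at this
      rwa [e, mul_one]
    · obtain ⟨k, hk⟩ := Int.eq_ofNat_of_zero_le (show 0 ≤ -m - 1 by lia)
      obtain rfl : m = -(k + 1) := by lia
      exact classified_mat (.diagNeg k b)

theorem classified_hMat_twoPow_mul_yMat {r : ℚ_[2]} (hr : ‖r‖ ≤ 1 / 2) (m : ℤ) :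
    Classified ξ hξ (hMat (twoPow m) * yMat r) := by
  rcases le_or_gt m (-1) with h | h
  · have e := yMat_mul_hMat (r / (twoPow m : ℚ_[2]) ^ 2) (twoPow m)
    rw [div_mul_cancel₀ _ (by simp)] at e
    rw [← e]
    refine (classified_hMat_twoPow m).congr ((InDC.refl _).mul_left (yMat_mem ?_))
    rw [norm_div_twoPow_sq]
    have := two_zpow_le_quarter (show 2 * m ≤ -2 by lia)
    nlinarith [norm_nonneg r]
  obtain ⟨k, rfl⟩ := Int.eq_ofNat_of_zero_le (show 0 ≤ m by lia)
  rcases exists_fourIf hr with hr | ⟨b, hb⟩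
  · have n : ‖2 * ((twoPow k : ℚ_[2]ˣ) : ℚ_[2]) ^ 2‖ ≤ 1 := by
      rw [norm_mul_twoPow_sq, norm_two]
      have := two_zpow_le_one (show -(2 * (k : ℤ)) ≤ 0 by lia)
      linarith
    refine Or.inr (vanishes_mul_yMat hr (q := bar (xMat (2 * (twoPow k : ℚ_[2]) ^ 2)))
      (xMat_mem n) (chiExt_xMat ξ hξ n) (bar_xMat_conj ?_).symm)
    rw [bar_mat, xMat_mul_hMat]; congr 2
    have : (twoPow k : ℚ_[2]) ≠ 0 := by simp
    field_simp
  · rw [yMat_mul_sub r (fourIf b), ← mul_assoc]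
    exact (classified_mat (.diagPos k b)).congr ((InDC.refl _).mul_right (yMat_mem hb))

theorem classified_yMat_mul_hMat {r : ℚ_[2]} (hr : ‖r‖ ≤ 1 / 2) (t : ℚ_[2]ˣ) :
    Classified ξ hξ (yMat r * hMat t) := by
  obtain ⟨m, u, hu, rfl⟩ := exists_twoPow_mul t
  rw [mul_comm, hMat_mul, ← mul_assoc, yMat_mul_hMat, mul_assoc]
  refine Classified.congr (classified_yMat_mul_hMat_twoPow ?_ m)
    ((InDC.refl _).mul_left (hMat_mem hu))
  rw [norm_mul, norm_pow, hu]; simpa using hr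

theorem classified_hMat_mul_yMat {r : ℚ_[2]} (hr : ‖r‖ ≤ 1 / 2) (t : ℚ_[2]ˣ) :
    Classified ξ hξ (hMat t * yMat r) := by
  obtain ⟨m, u, hu, rfl⟩ := exists_twoPow_mul t
  have e := yMat_mul_hMat (r / (u : ℚ_[2]) ^ 2) u
  rw [div_mul_cancel₀ _ (by simp)] at e
  rw [hMat_mul, mul_assoc, ← e, ← mul_assoc]
  refine Classified.congr (classified_hMat_twoPow_mul_yMat ?_ m)
    ((InDC.refl _).mul_right (hMat_mem hu))
  rw [norm_div, norm_pow, hu]; simpa using hr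

/-- The element `w(1/2)` turns a neighbouring `y(4)` into `x(-1)` on its other side. So one double
coset belongs to the exponent `-1`, where for smaller exponents there are four. -/
theorem inDC_wHalf_mat (a b : Bool) :
    InDC wHalf.mat (yMat (fourIf a) * wHalf.mat * yMat (fourIf b)) := by
  have hb : InDC wHalf.mat (wHalf.mat * yMat (fourIf b)) := by
    cases b
    · rw [fourIf_false, yMat_zero, mul_one]; exact InDC.refl _
    · rw [fourIf_true, wHalf_mat_mul_yMat_four]
      exact (InDC.refl _).mul_left (xMat_mem (by simp))
  cases a
  · rwa [fourIf_false, yMat_zero, one_mul]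
  · rw [fourIf_true, yMat_four_mul_wHalf_mat, mul_assoc]
    obtain ⟨k, hk, e⟩ : ∃ k ∈ K0 3, xMat (-1) * yMat (fourIf b) = yMat (fourIf b) * k := by
      cases b
      · exact ⟨xMat (-1), xMat_mem (by simp), by rw [fourIf_false, yMat_zero, one_mul, mul_one]⟩
      · exact xMat_mul_yMat_four (by simp)
    rw [e, ← mul_assoc]
    exact hb.mul_right hk

/-- For `m ≤ -1` the element `x(2)` passes through `w(2^m)` as `y(-2/4^m)` with `2/4^m ∈ 8ℤ₂`, from
either side, and commutes there with the outer `y`. So functions vanish if `r` or `s` is in `2ℤ₂ˣ`;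
otherwise both reduce to `0` or `4`. -/
theorem classified_yMat_mul_wMat_twoPow_mul_yMat {r s : ℚ_[2]} (hr : ‖r‖ ≤ 1 / 2) (hs : ‖s‖ ≤ 1 / 2)
    {m : ℤ} (hm : m ≤ -1) : Classified ξ hξ (yMat r * wMat (twoPow m) * yMat s) := by
  have n : ‖-(2 / ((twoPow m : ℚ_[2]ˣ) : ℚ_[2]) ^ 2)‖ ≤ 1 / 8 := by
    rw [norm_neg, norm_div_twoPow_sq, norm_two]
    have := two_zpow_le_quarter (show 2 * m ≤ -2 by lia)
    linarith
  rcases exists_fourIf hr with hr | ⟨a, ha⟩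
  · rw [mul_assoc]
    refine Or.inr (vanishes_yMat_mul hr (q := bar (yMat (-(2 / (twoPow m : ℚ_[2]) ^ 2))))
      (yMat_mem n) (chiExt_yMat ξ hξ n) (bar_xMat_conj_yMat ?_))
    rw [bar_mat, ← mul_assoc, xMat_mul_wMat, mul_assoc, mul_assoc, ← yMat_add, ← yMat_add,
      add_comm]
    congr 3; ring
  rcases exists_fourIf hs with hs | ⟨b, hb⟩
  · refine Or.inr (vanishes_mul_yMat hs (q := bar (yMat (-(2 / (twoPow m : ℚ_[2]) ^ 2))))
      (yMat_mem n) (chiExt_yMat ξ hξ n) (bar_yMat_conj_xMat ?_).symm)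
    have : (twoPow m : ℚ_[2]) ≠ 0 := by simp
    rw [bar_mat, ← mul_assoc, ← yMat_add, add_comm, yMat_add, mul_assoc, yMat_mul_wMat, mul_assoc]
    congr 3
    field_simp
  rw [yMat_sub_mul r (fourIf a), yMat_mul_sub s (fourIf b), mul_assoc (yMat (r - fourIf a)),
    mul_assoc (yMat (r - fourIf a)), ← mul_assoc _ _ (yMat (s - fourIf b)),
    ← mul_assoc (yMat (r - fourIf a))]
  refine Classified.congr ?_ (((InDC.refl _).mul_left (yMat_mem ha)).mul_right (yMat_mem hb))
  rcases eq_or_lt_of_le hm with rfl | h0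
  · exact (classified_wMat_twoPow (-1)).congr (inDC_wHalf_mat a b)
  · obtain ⟨k, hk⟩ := Int.eq_ofNat_of_zero_le (show 0 ≤ -2 - m by lia)
    obtain rfl : m = -2 - k := by lia
    exact classified_mat (.antiNeg k a b)

theorem classified_yMat_mul_wMat_mul_yMat {r s : ℚ_[2]} (hr : ‖r‖ ≤ 1 / 2) (hs : ‖s‖ ≤ 1 / 2)
    {t : ℚ_[2]ˣ} (ht : 1 < ‖(t : ℚ_[2])‖) : Classified ξ hξ (yMat r * wMat t * yMat s) := by
  obtain ⟨m, u, hu, rfl⟩ := exists_twoPow_mul t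
  have hm : m ≤ -1 := by
    by_contra! h
    rw [Units.val_mul, norm_mul, hu, mul_one, norm_twoPow] at ht
    exact absurd (two_zpow_le_one (show -m ≤ 0 by lia)) ht.not_ge
  rw [wMat_mul, ← mul_assoc, yMat_mul_hMat, mul_assoc, mul_assoc, ← mul_assoc (yMat _)]
  refine Classified.congr (classified_yMat_mul_wMat_twoPow_mul_yMat ?_ hs hm)
    ((InDC.refl _).mul_left (hMat_mem hu))
  rw [norm_mul, norm_pow, hu]; simpa using hr

theorem norm_le_half_mul {x y : ℚ_[2]} (h : ‖x‖ < ‖y‖) : ‖x / y‖ ≤ 1 / 2 := by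
  have hy : 0 < ‖y‖ := (norm_nonneg x).trans_lt h
  have hlt : ‖x / y‖ < 1 := by rwa [norm_div, div_lt_one hy]
  rcases eq_or_ne (x / y) 0 with h0 | h0
  · rw [h0, norm_zero]; norm_num
  · have e := Padic.norm_eq_zpow_neg_valuation h0
    push_cast at e
    rw [e, ← zpow_zero (2 : ℝ)] at hlt
    have := (zpow_lt_zpow_iff_right₀ (one_lt_two (α := ℝ))).1 hlt
    rw [e]
    calc (2 : ℝ) ^ (-(x / y).valuation) ≤ 2 ^ (-1 : ℤ) := zpow_le_zpow_right₀ one_le_two (by lia)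
      _ = 1 / 2 := by norm_num

/-- Gaussian elimination with a dominant entry as pivot. Ties are resolved so that every multiplier
of an `x` lies in `ℤ₂`, and that factor belongs to `K₀(8)`, while every multiplier of a `y` lies in
`2ℤ₂`, as the preceding cases require. -/
theorem classified (A : SL2) : Classified ξ hξ A := by
  have hdet := det_eq A
  have hn : ∀ {x y : ℚ_[2]}, ‖x‖ ≤ ‖y‖ → ‖-(x / y)‖ ≤ 1 := fun {x y} h => by
    rw [norm_neg, norm_div]; exact div_le_one_of_le₀ h (norm_nonneg y)
  by_cases hC : ‖A 0 0‖ ≤ ‖A 1 0‖ ∧ ‖A 1 1‖ ≤ ‖A 1 0‖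
  · have c0 : A 1 0 ≠ 0 := by
      intro h0
      rw [h0, norm_zero] at hC
      rw [norm_le_zero_iff.1 hC.1, norm_le_zero_iff.1 hC.2, h0] at hdet
      norm_num at hdet
    have e : A = xMat (A 0 0 / A 1 0) * wMat (-(Units.mk0 _ c0)⁻¹) * xMat (A 1 1 / A 1 0) := by
      apply SL2_ext <;> simp [mul_00, mul_01, mul_10, mul_11] <;> field_simp
      linear_combination -hdet
    rw [e]
    refine (classified_wMat _).congr (((InDC.refl _).mul_left (xMat_mem ?_)).mul_right (xMat_mem ?_))
    · rw [← norm_neg]; exact hn hC.1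
    · rw [← norm_neg]; exact hn hC.2
  by_cases hA : ‖A 1 0‖ < ‖A 0 0‖ ∧ ‖A 0 1‖ ≤ ‖A 0 0‖
  · have a0 : A 0 0 ≠ 0 := norm_pos_iff.1 ((norm_nonneg _).trans_lt hA.1)
    have e : A = yMat (A 1 0 / A 0 0) * hMat (Units.mk0 _ a0) * xMat (A 0 1 / A 0 0) := by
      apply SL2_ext <;> simp [mul_00, mul_01, mul_10, mul_11] <;> field_simp
      linear_combination hdet
    rw [e]
    refine (classified_yMat_mul_hMat (norm_le_half_mul hA.1) _).congr
      ((InDC.refl _).mul_right (xMat_mem ?_))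
    rw [← norm_neg]; exact hn hA.2
  by_cases hD : ‖A 1 0‖ < ‖A 1 1‖ ∧ ‖A 0 1‖ ≤ ‖A 1 1‖
  · have d0 : A 1 1 ≠ 0 := norm_pos_iff.1 ((norm_nonneg _).trans_lt hD.1)
    have e : A = xMat (A 0 1 / A 1 1) * (hMat (Units.mk0 _ d0)⁻¹ * yMat (A 1 0 / A 1 1)) := by
      apply SL2_ext <;> simp [mul_00, mul_01, mul_10, mul_11] <;> field_simp
      linear_combination hdet
    rw [e]
    refine (classified_hMat_mul_yMat (norm_le_half_mul hD.1) _).congr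
      ((InDC.refl _).mul_left (xMat_mem ?_))
    rw [← norm_neg]; exact hn hD.2
  -- A diagonal entry exceeds `c` because the first case fails; the failure of its own case makes
  -- `b` exceed it in turn.
  have hB : ‖A 0 0‖ < ‖A 0 1‖ ∧ ‖A 1 0‖ < ‖A 0 1‖ ∧ ‖A 1 1‖ < ‖A 0 1‖ := by
    rw [not_and_or, not_le, not_le] at hC
    rw [not_and_or, not_lt, not_le] at hA hD
    rcases hC with h | h
    · have h1 := hA.resolve_left h.not_ge
      exact ⟨h1, h.trans h1, by rcases hD with h2 | h2 <;> linarith⟩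
    · have h1 := hD.resolve_left h.not_ge
      exact ⟨by rcases hA with h2 | h2 <;> linarith, h.trans h1, h1⟩
  have b0 : A 0 1 ≠ 0 := norm_pos_iff.1 ((norm_nonneg _).trans_lt hB.1)
  -- If `‖b‖ ≤ 1`, the other entries would all have norm less than `1`, and so would the
  -- determinant.
  have hb1 : 1 < ‖A 0 1‖ := by
    by_contra! h
    have h1 : ‖A 0 0 * A 1 1 - A 0 1 * A 1 0‖ < 1 := by
      rw [sub_eq_add_neg]
      refine (Padic.nonarchimedean _ _).trans_lt (max_lt ?_ ?_)
      · rw [norm_mul]; nlinarith [norm_nonneg (A 0 0), norm_nonneg (A 1 1)]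
      · rw [norm_neg, norm_mul]; nlinarith [norm_nonneg (A 0 1), norm_nonneg (A 1 0)]
    rw [hdet, norm_one] at h1
    exact lt_irrefl _ h1
  have e : A = yMat (A 1 1 / A 0 1) * wMat (Units.mk0 _ b0) * yMat (A 0 0 / A 0 1) := by
    apply SL2_ext <;> simp [mul_00, mul_01, mul_10, mul_11] <;> field_simp
    linear_combination -hdet
  rw [e]
  exact classified_yMat_mul_wMat_mul_yMat (norm_le_half_mul hB.2.2) (norm_le_half_mul hB.1) hb1

end Classification

/-! ### The normal forms give a basis of the Hecke algebra -/

theorem twoPow_sub (m n : ℤ) : twoPow (m - n) = twoPow m * (twoPow n)⁻¹ := zpow_sub _ _ _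

theorem wMat_mul_hMat (s t : ℚ_[2]ˣ) : wMat s * hMat t = wMat (s * t⁻¹) := by
  apply SL2_ext <;> simp [mul_00, mul_01, mul_10, mul_11, mul_comm]

theorem wMat_mul_wMat (s t : ℚ_[2]ˣ) : wMat s * wMat t = -hMat (s * t⁻¹) := by
  apply SL2_ext <;> simp [mul_00, mul_01, mul_10, mul_11, mul_comm]

namespace NormalForm

theorem mat_diagPos_zero_false : (diagPos 0 false).mat = 1 := by
  apply SL2_ext <;> simp [mat, coe_twoPow, mul_00, mul_01, mul_10, mul_11]

theorem mat_diagPos_zero_true : (diagPos 0 true).mat = yMat 4 := by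
  apply SL2_ext <;> simp [mat, coe_twoPow, mul_00, mul_01, mul_10, mul_11]

/-- Up to the sign `-I`, which lies in `K₀(8)`, left multiplication by `w(1/4)`, `w(1/2)` and `y(4)`
acts on representatives as `u₂`, `u₁` and `v` act on words. This carries the induction in
`supportedOn_elt`. -/
theorem wQuarter_mul_diagPos (m : ℕ) (b : Bool) :
    wQuarter.mat * (diagPos m b).mat = (antiNeg m false b).mat := by
  simp only [mat, fourIf_false, yMat_zero, one_mul]
  rw [← mul_assoc, wQuarter, bar_mat, wMat_mul_hMat, ← twoPow_sub]

theorem wHalf_mul_antiNeg (m : ℕ) (b : Bool) :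
    wHalf.mat * (antiNeg m false b).mat = -(diagPos (m + 1) b).mat := by
  simp only [mat, fourIf_false, yMat_zero, one_mul]
  rw [← mul_assoc, wHalf, bar_mat, wMat_mul_wMat, ← twoPow_sub, neg_mul]
  congr 4; push_cast; ring

theorem wQuarter_mul_antiPos (m : ℕ) :
    wQuarter.mat * (antiPos m).mat = -(diagNeg m false).mat := by
  simp only [mat, fourIf_false, yMat_zero, one_mul]
  rw [wQuarter, bar_mat, wMat_mul_wMat, ← twoPow_sub]
  congr 3; ring

theorem wHalf_mul_diagNeg (m : ℕ) :
    wHalf.mat * (diagNeg m false).mat = (antiPos (m + 1)).mat := by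
  simp only [mat, fourIf_false, yMat_zero, one_mul]
  rw [wHalf, bar_mat, wMat_mul_hMat, ← twoPow_sub]
  congr 2

theorem yMat_mul_antiNeg (m : ℕ) (b : Bool) :
    yMat 4 * (antiNeg m false b).mat = (antiNeg m true b).mat := by
  simp only [mat, fourIf_false, fourIf_true, yMat_zero, one_mul, mul_assoc]

theorem yMat_mul_diagNeg (m : ℕ) :
    yMat 4 * (diagNeg m false).mat = (diagNeg m true).mat := by
  simp only [mat, fourIf_false, fourIf_true, yMat_zero, one_mul]

theorem elt_antiNeg_false (m : ℕ) (b : Bool) :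
    (antiNeg m false b).elt = gen Gen.u₂ * (diagPos m b).elt := by
  simp [elt, word]

theorem elt_antiNeg_true (m : ℕ) (b : Bool) :
    (antiNeg m true b).elt = gen Gen.v * (antiNeg m false b).elt := by
  simp [elt, word]

theorem elt_diagPos_succ (m : ℕ) (b : Bool) :
    (diagPos (m + 1) b).elt = gen Gen.u₁ * (antiNeg m false b).elt := by
  simp [elt, word, pow_succ', mul_assoc]

theorem elt_diagNeg_false (m : ℕ) : (diagNeg m false).elt = gen Gen.u₂ * (antiPos m).elt := by
  simp [elt, word]

theorem elt_diagNeg_true (m : ℕ) : (diagNeg m true).elt = gen Gen.v * (diagNeg m false).elt := by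
  simp [elt, word]

theorem elt_antiPos_succ (m : ℕ) : (antiPos (m + 1)).elt = gen Gen.u₁ * (diagNeg m false).elt := by
  simp [elt, word, pow_succ', mul_assoc]

/-- `K₀(8)` contains the conjugates by the representative that the product with `𝒰₂` needs. -/
theorem yMat_mul_diagPos (m : ℕ) (b : Bool) {s : ℚ_[2]} (hs : ‖s‖ ≤ 1 / 8) :
    ∃ k ∈ K0 3, yMat s * (diagPos m b).mat = (diagPos m b).mat * k := by
  refine ⟨yMat (s * (twoPow m : ℚ_[2]) ^ 2), yMat_mem ?_, ?_⟩
  · rw [norm_mul_twoPow_sq]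
    have := two_zpow_le_one (show -(2 * (m : ℤ)) ≤ 0 by lia)
    nlinarith [norm_nonneg s]
  · simp only [mat]
    rw [← mul_assoc, yMat_mul_hMat, mul_assoc, mul_assoc, ← yMat_add, ← yMat_add, add_comm]

theorem yMat_mul_antiPos (m : ℕ) {s : ℚ_[2]} (hs : ‖s‖ ≤ 1 / 8) :
    ∃ k ∈ K0 3, yMat s * (antiPos m).mat = (antiPos m).mat * k := by
  refine ⟨_, xMat_mem ?_, yMat_mul_wMat _ _⟩
  rw [norm_neg, norm_mul_twoPow_sq]
  have : (2 : ℝ) ^ (-(2 * ((m : ℤ) - 1))) ≤ 2 ^ (2 : ℤ) := zpow_le_zpow_right₀ one_le_two (by lia)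
  rw [show (2 : ℝ) ^ (2 : ℤ) = 4 by norm_num] at this
  nlinarith [norm_nonneg s]

theorem xMat_mul_antiNeg (m : ℕ) (b : Bool) {s : ℚ_[2]} (hs : ‖s‖ ≤ 1) :
    ∃ k ∈ K0 3, xMat s * (antiNeg m false b).mat = (antiNeg m false b).mat * k := by
  refine ⟨yMat (-(s / (twoPow (-2 - m) : ℚ_[2]) ^ 2)), yMat_mem ?_, ?_⟩
  · rw [norm_neg, norm_div_twoPow_sq]
    have : (2 : ℝ) ^ (2 * (-2 - (m : ℤ))) ≤ 2 ^ (-3 : ℤ) := zpow_le_zpow_right₀ one_le_two (by lia)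
    norm_num at this
    nlinarith [norm_nonneg s]
  · simp only [mat, fourIf_false, yMat_zero, one_mul]
    rw [← mul_assoc, xMat_mul_wMat, mul_assoc, mul_assoc, ← yMat_add, ← yMat_add, add_comm]

theorem xMat_mul_diagNeg (m : ℕ) {s : ℚ_[2]} (hs : ‖s‖ ≤ 1) :
    ∃ k ∈ K0 3, xMat s * (diagNeg m false).mat = (diagNeg m false).mat * k := by
  simp only [mat, fourIf_false, yMat_zero, one_mul]
  refine ⟨_, xMat_mem ?_, xMat_mul_hMat _ _⟩
  rw [norm_div_twoPow_sq]
  have := two_zpow_le_one (show 2 * -((m : ℤ) + 1) ≤ 0 by lia)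
  nlinarith [norm_nonneg s]

end NormalForm

section Basis

variable {ξ : ℂ} {hξ : ξ ^ 2 = -1}

variable (μ : Measure Mp2) [μ.IsHaarMeasure] (hμ : μ (K0bar 3 : Set Mp2) = 1)

variable (ξ hξ) in
/-- The image of `a` in the Hecke algebra is nonzero and supported on the double coset of `A`. -/
def SupportedOn (a : PresentedAlg) (A : SL2) : Prop :=
  SuppIn (heckeMap ξ hξ μ hμ a) A ∧ heckeMap ξ hξ μ hμ a ≠ 0

variable {μ hμ}

theorem SupportedOn.congr {a : PresentedAlg} {A B : SL2} (h : SupportedOn ξ hξ μ hμ a A)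
    (hAB : InDC A B) : SupportedOn ξ hξ μ hμ a B := ⟨h.1.congr hAB, h.2⟩

theorem heckeMap_mul_eq_zero {a b : PresentedAlg} (h : heckeMap ξ hξ μ hμ b = 0) :
    heckeMap ξ hξ μ hμ (a * b) = 0 := by
  rw [heckeMap_apply] at h
  rw [heckeMap_apply, map_mul, Module.End.mul_apply, h, map_zero]

theorem supportedOn_one : SupportedOn ξ hξ μ hμ 1 1 := by
  rw [SupportedOn, heckeMap_one]
  refine ⟨suppIn_heckeOne, fun h => ?_⟩
  have := congrFun (congrArg Subtype.val h) 1
  change heckeOne ξ hξ 1 = 0 at this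
  rw [heckeOne_one] at this
  exact one_ne_zero this

/-- The image stays nonzero because `v² = 1`; in the same way `u₂² = 1` serves for `u₂`. -/
theorem SupportedOn.v_mul {a : PresentedAlg} {A : SL2} (h : SupportedOn ξ hξ μ hμ a A) :
    SupportedOn ξ hξ μ hμ (gen Gen.v * a) (yMat 4 * A) := by
  refine ⟨?_, fun h0 => h.2 ?_⟩
  · rw [heckeMap_gen_mul]
    exact suppIn_heckeV_conv μ hμ (heckeMap ξ hξ μ hμ a).2 h.1
  · have := heckeMap_mul_eq_zero (a := gen Gen.v) h0
    rwa [← mul_assoc, gen_v_sq, one_mul] at this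

theorem SupportedOn.u₂_mul {a : PresentedAlg} {A : SL2} (h : SupportedOn ξ hξ μ hμ a A)
    (hA : ∀ s : ℚ_[2], ‖s‖ ≤ 1 / 8 → ∃ k ∈ K0 3, yMat s * A = A * k) :
    SupportedOn ξ hξ μ hμ (gen Gen.u₂ * a) (wQuarter.mat * A) := by
  refine ⟨?_, fun h0 => h.2 ?_⟩
  · rw [heckeMap_gen_mul]
    exact suppIn_heckeU₂_conv μ hμ (heckeMap ξ hξ μ hμ a).2 h.1 hA
  · have := heckeMap_mul_eq_zero (a := gen Gen.u₂) h0
    rwa [← mul_assoc, gen_u₂_sq, one_mul] at this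

/-- If `u₁ a` went to zero, so would `u₁² a = a + v a`; but by `hA'` the images of `a` and `v a`
live on different double cosets and cannot cancel. -/
theorem SupportedOn.u₁_mul {a : PresentedAlg} {A : SL2} (h : SupportedOn ξ hξ μ hμ a A)
    (hA : ∀ s : ℚ_[2], ‖s‖ ≤ 1 → ∃ k ∈ K0 3, xMat s * A = A * k) (hA' : ¬ InDC A (yMat 4 * A)) :
    SupportedOn ξ hξ μ hμ (gen Gen.u₁ * a) (wHalf.mat * A) := by
  refine ⟨?_, fun h0 => h.2 ?_⟩
  · rw [heckeMap_gen_mul]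
    exact suppIn_heckeU₁_conv μ hμ (heckeMap ξ hξ μ hμ a).2 h.1 hA
  · have h1 := heckeMap_mul_eq_zero (a := gen Gen.u₁) h0
    rw [← mul_assoc, gen_u₁_sq, add_mul, one_mul, map_add] at h1
    refine Subtype.ext (funext fun g => ?_)
    by_contra hg
    have h2 := congrFun (congrArg Subtype.val h1) g
    rw [Submodule.coe_add, Pi.add_apply] at h2
    refine hA' ((h.1 g hg).trans (h.v_mul.1 g fun h3 => hg ?_).symm)
    rwa [h3, add_zero] at h2

theorem supportedOn_antiNeg_false {m : ℕ} {b : Bool}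
    (h : SupportedOn ξ hξ μ hμ (NormalForm.diagPos m b).elt (NormalForm.diagPos m b).mat) :
    SupportedOn ξ hξ μ hμ (NormalForm.antiNeg m false b).elt
      (NormalForm.antiNeg m false b).mat := by
  rw [NormalForm.elt_antiNeg_false, ← NormalForm.wQuarter_mul_diagPos]
  exact h.u₂_mul fun s hs => NormalForm.yMat_mul_diagPos m b hs

theorem supportedOn_diagPos (m : ℕ) (b : Bool) :
    SupportedOn ξ hξ μ hμ (NormalForm.diagPos m b).elt (NormalForm.diagPos m b).mat := by
  induction m with
  | zero =>
    cases b
    · rw [NormalForm.mat_diagPos_zero_false,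
        show (NormalForm.diagPos 0 false).elt = 1 by simp [NormalForm.elt, NormalForm.word]]
      exact supportedOn_one
    · rw [NormalForm.mat_diagPos_zero_true, show (NormalForm.diagPos 0 true).elt = gen Gen.v * 1 by
        simp [NormalForm.elt, NormalForm.word], ← mul_one (yMat 4)]
      exact supportedOn_one.v_mul
  | succ m ih =>
    rw [NormalForm.elt_diagPos_succ]
    have := (supportedOn_antiNeg_false ih).u₁_mul (fun s hs => NormalForm.xMat_mul_antiNeg m b hs)
      -- Multiplication by `v` changes `antiNeg m false b` into `antiNeg m true b`, which has a
      -- different double coset.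
      (fun h => by
        rw [NormalForm.yMat_mul_antiNeg] at h
        simpa using NormalForm.eq_of_inDC h)
    rw [NormalForm.wHalf_mul_antiNeg] at this
    exact this.congr (InDC.neg _).symm

theorem supportedOn_diagNeg_false {m : ℕ}
    (h : SupportedOn ξ hξ μ hμ (NormalForm.antiPos m).elt (NormalForm.antiPos m).mat) :
    SupportedOn ξ hξ μ hμ (NormalForm.diagNeg m false).elt (NormalForm.diagNeg m false).mat := by
  rw [NormalForm.elt_diagNeg_false]
  have := h.u₂_mul fun s hs => NormalForm.yMat_mul_antiPos m hs
  rw [NormalForm.wQuarter_mul_antiPos] at this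
  exact this.congr (InDC.neg _).symm

theorem supportedOn_antiPos (m : ℕ) :
    SupportedOn ξ hξ μ hμ (NormalForm.antiPos m).elt (NormalForm.antiPos m).mat := by
  induction m with
  | zero =>
    rw [show (NormalForm.antiPos 0).elt = gen Gen.u₁ * 1 by simp [NormalForm.elt, NormalForm.word],
      show (NormalForm.antiPos 0).mat = wHalf.mat * 1 by
        rw [mul_one, NormalForm.mat, Nat.cast_zero, zero_sub]; rfl]
    exact supportedOn_one.u₁_mul (fun s hs => ⟨_, xMat_mem hs, by rw [mul_one, one_mul]⟩)
      (by rw [mul_one]; exact not_inDC_one_yMat_four)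
  | succ m ih =>
    rw [NormalForm.elt_antiPos_succ, ← NormalForm.wHalf_mul_diagNeg]
    exact (supportedOn_diagNeg_false ih).u₁_mul (fun s hs => NormalForm.xMat_mul_diagNeg m hs)
      (fun h => by
        rw [NormalForm.yMat_mul_diagNeg] at h
        simpa using NormalForm.eq_of_inDC h)

theorem supportedOn_elt (n : NormalForm) : SupportedOn ξ hξ μ hμ n.elt n.mat := by
  rcases n with ⟨m, b⟩ | ⟨m, _ | _⟩ | m | ⟨m, _ | _, b⟩
  · exact supportedOn_diagPos m b
  · exact supportedOn_diagNeg_false (supportedOn_antiPos m)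
  · rw [NormalForm.elt_diagNeg_true, ← NormalForm.yMat_mul_diagNeg]
    exact (supportedOn_diagNeg_false (supportedOn_antiPos m)).v_mul
  · exact supportedOn_antiPos m
  · exact supportedOn_antiNeg_false (supportedOn_diagPos m b)
  · rw [NormalForm.elt_antiNeg_true, ← NormalForm.yMat_mul_antiNeg]
    exact (supportedOn_antiNeg_false (supportedOn_diagPos m b)).v_mul

theorem heckeMap_elt_self (n : NormalForm) :
    (heckeMap ξ hξ μ hμ n.elt : Mp2 → ℂ) (bar n.mat) ≠ 0 := by
  intro h
  refine (supportedOn_elt (ξ := ξ) (hξ := hξ) (μ := μ) (hμ := hμ) n).2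
    (Subtype.ext (funext fun g => ?_))
  by_contra hg
  exact hg (eq_zero_of_inDC (heckeMap ξ hξ μ hμ n.elt).2 h ((supportedOn_elt n).1 g hg))

theorem heckeMap_elt_of_ne {n n' : NormalForm} (hn : n ≠ n') :
    (heckeMap ξ hξ μ hμ n.elt : Mp2 → ℂ) (bar n'.mat) = 0 := by
  by_contra h
  exact hn (NormalForm.eq_of_inDC ((supportedOn_elt n).1 _ h))

variable (ξ hξ) in
/-- Evaluation at the representative of the double coset of a normal form. -/
noncomputable def evalAt (n : NormalForm) : heckeSpace (K0bar 3) (chi1 ξ hξ) →ₗ[ℂ] ℂ :=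
  (LinearMap.proj (bar n.mat)).comp (heckeSpace (K0bar 3) (chi1 ξ hξ)).subtype

theorem evalAt_apply (n : NormalForm) (f : heckeSpace (K0bar 3) (chi1 ξ hξ)) :
    evalAt ξ hξ n f = (f : Mp2 → ℂ) (bar n.mat) := rfl

theorem ext_of_evalAt {f f' : heckeSpace (K0bar 3) (chi1 ξ hξ)}
    (h : ∀ n, evalAt ξ hξ n f = evalAt ξ hξ n f') : f = f' := by
  refine Subtype.ext (funext fun g => ?_)
  rcases classified (ξ := ξ) (hξ := hξ) g.mat with ⟨n, hn⟩ | hv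
  · exact eq_of_suppIn f.2 f'.2 (h n) hn
  · rw [hv f f.2 g rfl, hv f' f'.2 g rfl]

/-- The support meets finitely many left cosets, and distinct normal forms, having distinct double
cosets, lie in distinct left cosets. -/
theorem finite_evalAt_ne_zero (f : heckeSpace (K0bar 3) (chi1 ξ hξ)) :
    {n | evalAt ξ hξ n f ≠ 0}.Finite := by
  obtain ⟨s, -, hs⟩ := hecke_support f.2
  have h : ∀ n : {n | evalAt ξ hξ n f ≠ 0}, ∃ i : s, ((i : Mp2)⁻¹ * bar n.1.mat).mat ∈ K0 3 :=
    fun n => by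
      obtain ⟨i, hi, h⟩ := hs _ n.2
      exact ⟨⟨i, hi⟩, h⟩
  choose φ hφ using h
  refine @Set.toFinite _ _ (Finite.of_injective φ fun n n' e => Subtype.ext ?_)
  have h1 := hφ n
  have h2 := hφ n'
  rw [← e] at h2
  refine NormalForm.eq_of_inDC ⟨1, one_mem _, _, mul_mem (inv_mem h1) h2, ?_⟩
  simp only [mat_mul, mat_inv, bar_mat]
  group

/-- Evaluation at the representatives is a diagonal system on the images of the normal forms, with
nonzero diagonal, so it reads off every coefficient. -/
theorem heckeMap_injective : Function.Injective (heckeMap ξ hξ μ hμ) := by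
  rw [injective_iff_map_eq_zero]
  intro a ha
  have hmem : a ∈ Submodule.span ℂ (Set.range NormalForm.elt) := by rw [span_elt]; trivial
  obtain ⟨c, rfl⟩ := Finsupp.mem_span_range_iff_exists_finsupp.1 hmem
  suffices h : c = 0 by rw [h, Finsupp.sum_zero_index]
  ext n
  have h := congrArg (evalAt ξ hξ n) ha
  rw [map_finsuppSum, map_finsuppSum, map_zero, Finsupp.sum_eq_single n] at h
  · rw [map_smul, map_smul, smul_eq_mul, evalAt_apply] at h
    exact (mul_eq_zero.1 h).resolve_right (heckeMap_elt_self n)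
  · intro n' _ hn
    rw [map_smul, map_smul, evalAt_apply, heckeMap_elt_of_ne hn, smul_zero]
  · intro _
    rw [zero_smul, map_zero, map_zero]

theorem heckeMap_surjective : Function.Surjective (heckeMap ξ hξ μ hμ) := by
  classical
  intro f
  have hfin := finite_evalAt_ne_zero f
  refine ⟨∑ n ∈ hfin.toFinset,
    (evalAt ξ hξ n f / evalAt ξ hξ n (heckeMap ξ hξ μ hμ n.elt)) • n.elt, ext_of_evalAt fun n => ?_⟩
  rw [map_sum, map_sum, Finset.sum_eq_single n]
  · rw [map_smul, map_smul, smul_eq_mul]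
    exact div_mul_cancel₀ _ (heckeMap_elt_self n)
  · intro n' _ hn
    rw [map_smul, map_smul, evalAt_apply n (heckeMap ξ hξ μ hμ n'.elt), heckeMap_elt_of_ne hn,
      smul_zero]
  · intro hn
    rw [Set.Finite.mem_toFinset, Set.mem_ofPred_eq, not_not] at hn
    rw [hn, zero_div, zero_smul, map_zero, map_zero]

end Basis

end Metaplectic

open Metaplectic MeasureTheory

/-- The Hecke algebra of the inverse image of `K₀(8)` and `χ₁`, with convolution for the Haar
measure that gives the inverse image of `K₀(8)` mass `1`, is the algebra presented by the three
generators and the relations; the generators go to `𝒰₁ / √2`, `𝒰₂ / √2` and `𝒱`. -/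
theorem theorem1 (ξ : ℂ) (hξ : ξ ^ 2 = -1) (μ : Measure Mp2) [μ.IsHaarMeasure]
    (hμ : μ (K0bar 3 : Set Mp2) = 1) :
    ∃ Φ : PresentedAlg ≃ₗ[ℂ] heckeSpace (K0bar 3) (chi1 ξ hξ),
      (∀ a b : PresentedAlg, (Φ (a * b) : Mp2 → ℂ) = conv μ (Φ a : Mp2 → ℂ) (Φ b : Mp2 → ℂ)) ∧
      (Φ 1 : Mp2 → ℂ) = doubleCosetFun (chi1 ξ hξ) 1 1 ∧
      (Φ (gen Gen.u₁) : Mp2 → ℂ) = (1 / (Real.sqrt 2 : ℂ)) • heckeU ξ hξ 1 ∧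
      (Φ (gen Gen.u₂) : Mp2 → ℂ) = (1 / (Real.sqrt 2 : ℂ)) • heckeU ξ hξ 2 ∧
      (Φ (gen Gen.v) : Mp2 → ℂ) = heckeV ξ hξ := by
  exact ⟨LinearEquiv.ofBijective (heckeMap ξ hξ μ hμ) ⟨heckeMap_injective, heckeMap_surjective⟩,
    heckeMap_mul μ hμ, congrArg Subtype.val (heckeMap_one μ hμ),
    congrArg Subtype.val (heckeMap_gen μ hμ Gen.u₁),
    congrArg Subtype.val (heckeMap_gen μ hμ Gen.u₂),
    congrArg Subtype.val (heckeMap_gen μ hμ Gen.v)⟩
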